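/- Let $\mathbb{C}^\infty=\bigcup_k\mathbb{C}^k$ and $\mathbb{C}P^\infty$ carry their usual colimit topologies, and let $\lambda:E\to\mathbb{C}P^\infty$ be the tautological line bundle, i.e. $E=\{(v,l)\in\mathbb{C}^\infty\times\mathbb{C}P^\infty\mid v\in l\}$ and $\lambda(v,l)=l$. For $n\in\mathbb{N}$ let $$E(\lambda,n)=\{(e_1,\dots,e_n)\in E^n\mid e_i\neq e_j\text{ and }\lambda(e_i)=\lambda(e_j)\text{ for all } i\neq j\}$$ be the ordered fiberwise configuration space, topologized as a subspace of $E^n$, on which the symmetric group $\Sigma_n$ acts by permuting the coordinates; let $E(\lambda,n)/\Sigma_n$ be the quotient space. Let $B_n=\pi_1(C_n(\mathbb{C}))$ and $PB_n=\pi_1(F_n(\mathbb{C}))$ be the braid group and the pure braid group on $n$ strands, where $F_n(\mathbb{C})$ is the space of ordered $n$-tuples of distinct points of $\mathbb{C}$ and $C_n(\mathbb{C})=F_n(\mathbb{C})/\Sigma_n$, and let $Z(-)$ denote the center of a group. A space $X$ is called a classifying space for a discrete group $G$ if $X$ is the base of a principal $G$-bundle (covering space with group $G$) whose total space is contractible.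 1. For every $n\geq 3$, the space $E(\lambda,n)/\Sigma_n$ is a classifying space for $B_n/Z(B_n)$. 2. For every $n\geq 2$, the space $E(\lambda,n)$ is a classifying space for $PB_n/Z(PB_n)$. -/

import Mathlib

noncomputable section

/-- `ℂ^∞`: finitely supported sequences of complex numbers. -/
def CInf : Type := ℕ →₀ ℂ

instance : AddCommGroup CInf := inferInstanceAs (AddCommGroup (ℕ →₀ ℂ))

instance : Module ℂ CInf := inferInstanceAs (Module ℂ (ℕ →₀ ℂ))

/-- The standard inclusion `ℂ^k → ℂ^∞` as the first `k` coordinates. -/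
def CInf.incl (k : ℕ) (v : Fin k → ℂ) : CInf :=
  ∑ i : Fin k, (Finsupp.single (i : ℕ) (v i) : ℕ →₀ ℂ)

/-- The colimit topology on `ℂ^∞ = ⋃ ℂ^k`: a set is open iff its trace on every `ℂ^k` is open. -/
instance : TopologicalSpace CInf :=
  ⨆ k : ℕ, TopologicalSpace.coinduced (CInf.incl k) inferInstance

/-- `ℂP^∞`: the space of lines through the origin in `ℂ^∞`. -/
abbrev CPInf : Type := Projectivization ℂ CInf

/-- The quotient topology on `ℂP^∞` from `ℂ^∞ ∖ {0}` (which is also the colimit topology of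
the spaces `ℂP^k`). -/
instance : TopologicalSpace CPInf :=
  TopologicalSpace.coinduced
    (fun v : {v : CInf // v ≠ 0} => Projectivization.mk ℂ v.1 v.2) inferInstance

/-- Total space of the tautological line bundle, `{(v, l) ∈ ℂ^∞ × ℂP^∞ | v ∈ l}`. -/
def TautBundle : Type := {x : CInf × CPInf // x.1 ∈ x.2.submodule}

instance : TopologicalSpace TautBundle :=
  inferInstanceAs (TopologicalSpace {x : CInf × CPInf // x.1 ∈ x.2.submodule})

/-- The bundle projection of the tautological line bundle. -/
def tautProj (e : TautBundle) : CPInf := e.1.2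

/-- The ordered fiberwise configuration space of `p : E → B`: tuples of `n` pairwise distinct
points of `E` lying in a common fiber, topologized as a subspace of `E^n`. -/
def FiberConf {E B : Type*} (p : E → B) (n : ℕ) : Type _ :=
  {e : Fin n → E // ∀ i j, i ≠ j → e i ≠ e j ∧ p (e i) = p (e j)}

instance {E B : Type*} [TopologicalSpace E] (p : E → B) (n : ℕ) :
    TopologicalSpace (FiberConf p n) :=
  inferInstanceAs
    (TopologicalSpace {e : Fin n → E // ∀ i j, i ≠ j → e i ≠ e j ∧ p (e i) = p (e j)})

/-- The symmetric group permutes the entries of a fiberwise configuration. -/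
instance {E B : Type*} (p : E → B) (n : ℕ) :
    MulAction (Equiv.Perm (Fin n)) (FiberConf p n) where
  smul σ e := ⟨fun i => e.1 (σ⁻¹ i), fun _ _ hij =>
    e.2 _ _ fun h => hij (σ⁻¹.injective h)⟩
  one_smul _ := rfl
  mul_smul _ _ _ := rfl

/-- The unordered fiberwise configuration space: the quotient of the ordered one by the
symmetric group, with the quotient topology. -/
abbrev UFiberConf {E B : Type*} (p : E → B) (n : ℕ) : Type _ :=
  MulAction.orbitRel.Quotient (Equiv.Perm (Fin n)) (FiberConf p n)

/-- The ordinary ordered configuration space `F_n(Y)`: here all of `Y` is a single fiber, so the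
second condition in `FiberConf` is void. -/
abbrev Conf (Y : Type*) (n : ℕ) : Type _ := FiberConf (fun _ : Y => ()) n

/-- The ordinary unordered configuration space `C_n(Y) = F_n(Y)/Σ_n`. -/
abbrev UConf (Y : Type*) (n : ℕ) : Type _ := UFiberConf (fun _ : Y => ()) n

/-- The base configuration `(0, 1, …, n - 1)` in the plane. -/
def baseConf (n : ℕ) : Conf ℂ n :=
  ⟨fun i => ((i : ℕ) : ℂ), fun _ _ hij =>
    ⟨fun h => hij (Fin.ext (Nat.cast_injective h)), rfl⟩⟩

/-- The braid group `B_n` on `n` strands in its geometric form: homotopy classes of motions of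
`n` indistinguishable distinct points in the plane, i.e. `π₁(C_n(ℂ))`. -/
abbrev BraidGroup (n : ℕ) : Type :=
  FundamentalGroup (UConf ℂ n) (Quotient.mk _ (baseConf n))

/-- The pure braid group `PB_n` on `n` strands in its geometric form, `π₁(F_n(ℂ))`. -/
abbrev PureBraidGroup (n : ℕ) : Type :=
  FundamentalGroup (Conf ℂ n) (baseConf n)

/-- `X` is a classifying space for the discrete group `G`: it is the base of a principal
`G`-bundle (a covering that is the quotient by a free, properly discontinuous action
of `G`) with contractible total space. -/
def IsClassifyingSpace (G : Type) [Group G] (X : Type) [TopologicalSpace X] : Prop :=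
  ∃ (P : Type) (_ : TopologicalSpace P) (_ : MulAction G P) (q : P → X),
    IsQuotientCoveringMap q G ∧ ContractibleSpace P

end

/-!
Write `E_n` for the ordered fiberwise configuration space of the tautological bundle, `F_n` and
`C_n` for the configuration spaces of the plane, and `M_n` for the space of configurations in `F_n`
that start with `0` and `1` (`NormConf`), i.e. `F_n` modulo affine maps of the plane.

The difference of the first two points of a fiberwise configuration is a nonzero vector of `ℂ^∞`;
it spans the line and serves as a coordinate on it. So a point of `E_n` amounts to a nonzero
vector, the coordinate of the first point, and an element of `M_n`. Nonzero vectors form a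
contractible space (`CInf.contractibleSpace_ne_zero`), hence `E_n` is aspherical as soon as `M_n` is
(`TautConf.isAspherical`), and `π₁(E_n) → π₁(M_n)` is injective (`TautConf.map_norm_injective`).
The inclusion `F_n → E_n` of the configurations on one line followed by `E_n → M_n` is the
normalization `F_n → M_n`, which is a retraction; so `PB_n → π₁(E_n)` is onto, and
`π₁(E_n) ≅ π₁(M_n)`.

Forgetting the last point, `M_{n+1} → M_n`, is a fibration with a punctured plane as fiber
(`NormConf.isRegularFibration_forget`; the lifting property is `exists_avoiding_lift`). By induction
`M_n` is aspherical and `π₁(M_n)` has trivial center. The case of the punctured plane rests on an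
explicit universal covering (`PuncturedPlane.bundleCore`) whose deck group is a free group of
permutations of a regular tree: a sheet over the complement of downward, or upward, rays is a vertex
of the tree, and a point of the covering traces a zigzag in the plane along the path in the tree
from the root. These zigzags contract the projection (`PuncturedPlane.nullhomotopic_proj`), so the
covering space is contractible.

A pure braid in the kernel of `PB_n → π₁(M_n)` is homotopic to a rotation of the base configuration
about the origin. The rotations act on `C_n` as well, so the trace of such a loop commutes with all
braids (`FiberConf.map_unorder_mem_center`). As `π₁(M_n)` has trivial center, the kernel of the
epimorphism `PB_n → π₁(E_n)` is exactly the center (`TautConf.ker_pureMap`). For `B_n` compare the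
extensions of the symmetric group by `PB_n` and by `π₁(E_n)`: the map `B_n → π₁(E_n / Σ_n)` is onto
and has the same kernel. For `n ≥ 3` the symmetric group has trivial center, so the center of `B_n`
consists of pure braids, and it is that kernel (`TautConf.ker_braidMap`).

A connected aspherical space, locally as simple as these are, is a classifying space of its
fundamental group by way of its universal covering (`UnivCover.isClassifyingSpace`). Asphericity is
here the property that maps from all spaces which lift through coverings are nullhomotopic
(`IsAspherical`). This avoids higher homotopy groups and CW structures: the projection of the
universal covering is such a map, and lifting a nullhomotopy of it contracts the total space.
-/

noncomputable section

open Topology unitInterval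

/-! ### Coverings and aspherical spaces -/

/-- `S` lifts through coverings: every continuous map out of `S` lifts through every surjective
covering map. This holds for simply connected, locally path-connected spaces, and also for the
square with its boundary collapsed to a point. -/
def LiftsCoverings (S : Type) [TopologicalSpace S] : Prop :=
  ∀ (P X : Type) [TopologicalSpace P] [TopologicalSpace X] (p : P → X), IsCoveringMap p →
    Function.Surjective p → ∀ f : C(S, X), ∃ F : C(S, P), ∀ s, p (F s) = f s

/-- Asphericity, tested on all spaces that lift through coverings: every map from such a space
is nullhomotopic. -/
def IsAspherical (X : Type) [TopologicalSpace X] : Prop :=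
  ∀ (S : Type) [TopologicalSpace S], LiftsCoverings S → ∀ f : C(S, X), f.Nullhomotopic

theorem LiftsCoverings.of_simplyConnected (S : Type) [TopologicalSpace S]
    [SimplyConnectedSpace S] [LocallyPathConnectedSpace S] : LiftsCoverings S := by
  intro P X _ _ p hp hsurj f
  obtain ⟨s₀⟩ : Nonempty S := PathConnectedSpace.nonempty
  obtain ⟨e₀, he₀⟩ := hsurj (f s₀)
  obtain ⟨F, ⟨-, hF⟩, -⟩ := hp.existsUnique_continuousMap_lifts f s₀ e₀ he₀
  exact ⟨F, fun s => congrFun hF s⟩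

/-- A covering space whose projection is nullhomotopic is contractible: a nullhomotopy of the
projection lifts to a homotopy from the identity to a map into a discrete fiber. -/
theorem IsCoveringMap.contractibleSpace_of_nullhomotopic {P X : Type} [TopologicalSpace P]
    [TopologicalSpace X] [PathConnectedSpace P] {p : P → X} (hp : IsCoveringMap p)
    (h : (⟨p, hp.continuous⟩ : C(P, X)).Nullhomotopic) : ContractibleSpace P := by
  obtain ⟨y, ⟨H⟩⟩ := h
  rw [contractible_iff_id_nullhomotopic]
  have H0 : ∀ a, H.toContinuousMap (0, a) = p (ContinuousMap.id P a) := fun a => by simp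
  let L := hp.liftHomotopy H.toContinuousMap (ContinuousMap.id P) H0
  have hL : ∀ t a, p (L (t, a)) = H (t, a) := fun t a =>
    congrFun (hp.liftHomotopy_lifts H.toContinuousMap (ContinuousMap.id P) H0) (t, a)
  obtain ⟨a₀⟩ : Nonempty P := PathConnectedSpace.nonempty
  refine ⟨L (1, a₀), ⟨⟨L, fun a => hp.liftHomotopy_zero _ _ H0 a, fun a => ?_⟩⟩⟩
  refine hp.const_of_comp (g := fun a => L (1, a)) (by fun_prop) (fun a b => ?_) a a₀
  simp [hL]

theorem IsAspherical.of_covering {P X : Type} [TopologicalSpace P] [TopologicalSpace X]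
    {p : P → X} (hp : IsCoveringMap p) (hs : Function.Surjective p) (hP : IsAspherical P) :
    IsAspherical X := by
  intro S _ hS f
  obtain ⟨F, hF⟩ := hS P X p hp hs f
  have : f = (⟨p, hp.continuous⟩ : C(P, X)).comp F := by ext s; simp [hF]
  rw [this]
  exact (hP S hS F).comp_right _

theorem IsAspherical.of_contractible (X : Type) [TopologicalSpace X] [ContractibleSpace X] :
    IsAspherical X := fun S _ _ f => by
  simpa using (id_nullhomotopic X).comp_left f

theorem IsAspherical.prod {X Y : Type} [TopologicalSpace X] [TopologicalSpace Y]
    (hX : IsAspherical X) (hY : IsAspherical Y) : IsAspherical (X × Y) := by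
  intro S _ hS f
  obtain ⟨x, ⟨H⟩⟩ := hX S hS (ContinuousMap.fst.comp f)
  obtain ⟨y, ⟨K⟩⟩ := hY S hS (ContinuousMap.snd.comp f)
  exact ⟨(x, y), ⟨H.prod K⟩⟩

/-! ### The universal covering space -/

namespace Path.Homotopic.Quotient

variable {X : Type*} [TopologicalSpace X] {x y z : X}

theorem symm_symm_eq (c : Homotopic.Quotient x y) : c.symm.symm = c := by
  obtain ⟨c⟩ := c
  change mk c.symm.symm = mk c
  rw [Path.symm_symm]

theorem symm_trans_eq (c : Homotopic.Quotient x y) (d : Homotopic.Quotient y z) :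
    (c.trans d).symm = d.symm.trans c.symm := by
  obtain ⟨c⟩ := c
  obtain ⟨d⟩ := d
  change mk (c.trans d).symm = mk (d.symm.trans c.symm)
  rw [Path.trans_symm]

end Path.Homotopic.Quotient

/-- The universal covering space of `X`, as the set of homotopy classes of paths starting at
`x₀`. -/
@[ext] structure UnivCover (X : Type) [TopologicalSpace X] (x₀ : X) : Type where
  /-- The endpoint. -/
  pt : X
  /-- The homotopy class of paths. -/
  cls : Path.Homotopic.Quotient x₀ pt

namespace UnivCover

variable {X : Type} [TopologicalSpace X] {x₀ : X}

/-- Extend a class of paths by a path. -/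
def extend (c : UnivCover X x₀) {y : X} (δ : Path c.pt y) : UnivCover X x₀ :=
  ⟨y, c.cls.trans (.mk δ)⟩

/-- The topology of path extension: a set is open if with each class of paths it contains all
extensions by sufficiently small paths. -/
instance : TopologicalSpace (UnivCover X x₀) where
  IsOpen S := ∀ c ∈ S, ∃ U : Set X, IsOpen U ∧ c.pt ∈ U ∧
    ∀ (y : X) (δ : Path c.pt y), (∀ t, δ t ∈ U) → c.extend δ ∈ S
  isOpen_univ c _ := ⟨Set.univ, isOpen_univ, trivial, fun _ _ _ => trivial⟩
  isOpen_inter S T hS hT c hc := by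
    obtain ⟨U, hU, hcU, h⟩ := hS c hc.1
    obtain ⟨V, hV, hcV, h'⟩ := hT c hc.2
    exact ⟨U ∩ V, hU.inter hV, ⟨hcU, hcV⟩, fun y δ hδ =>
      ⟨h y δ fun t => (hδ t).1, h' y δ fun t => (hδ t).2⟩⟩
  isOpen_sUnion 𝒮 h c hc := by
    obtain ⟨S, hS, hcS⟩ := hc
    obtain ⟨U, hU, hcU, h'⟩ := h S hS c hcS
    exact ⟨U, hU, hcU, fun y δ hδ => ⟨S, hS, h' y δ hδ⟩⟩

/-- The sheet over `U` through `c`: all extensions of `c` by paths in `U`. -/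
def sheet (c : UnivCover X x₀) (U : Set X) : Set (UnivCover X x₀) :=
  {d | ∃ (y : X) (δ : Path c.pt y), (∀ t, δ t ∈ U) ∧ d = c.extend δ}

@[simp] theorem extend_refl (c : UnivCover X x₀) : c.extend (Path.refl c.pt) = c := by
  simp [extend]

theorem extend_trans (c : UnivCover X x₀) {y z : X} (δ : Path c.pt y) (ε : Path y z) :
    c.extend (δ.trans ε) = (c.extend δ).extend ε := by
  simp [extend]

theorem mem_sheet_self (c : UnivCover X x₀) {U : Set X} (h : c.pt ∈ U) : c ∈ c.sheet U :=
  ⟨c.pt, Path.refl _, fun _ => h, c.extend_refl.symm⟩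

theorem isOpen_sheet (c : UnivCover X x₀) {U : Set X} (hU : IsOpen U) : IsOpen (c.sheet U) := by
  rintro _ ⟨y, δ, hδ, rfl⟩
  refine ⟨U, hU, by simpa [extend] using hδ 1, fun z (ε : Path y z) hε =>
    ⟨z, δ.trans ε, fun t => ?_, (c.extend_trans δ ε).symm⟩⟩
  rw [Path.trans_apply]; split_ifs
  exacts [hδ _, hε _]

theorem continuous_pt : Continuous (pt : UnivCover X x₀ → X) := by
  refine continuous_def.mpr fun U hU c hc => ⟨U, hU, hc, fun y δ hδ => ?_⟩
  have := hδ 1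
  rwa [δ.target] at this

theorem isOpenMap_pt [LocallyPathConnectedSpace X] :
    IsOpenMap (pt : UnivCover X x₀ → X) := by
  intro S hS
  rw [isOpen_iff_mem_nhds]
  rintro _ ⟨c, hc, rfl⟩
  obtain ⟨U, hU, hcU, h⟩ := hS c hc
  obtain ⟨V, ⟨hV, hVc⟩, hVU⟩ := (LocallyPathConnectedSpace.path_connected_basis c.pt).mem_iff.mp
    (hU.mem_nhds hcU)
  refine Filter.mem_of_superset hV fun y hy => ?_
  obtain ⟨δ, hδ⟩ := hVc.joinedIn _ (mem_of_mem_nhds hV) y hy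
  exact ⟨_, h y δ fun t => hVU (hδ t), rfl⟩

/-- The action of a class of loops by precomposition with its inverse. -/
def precomp (g : Path.Homotopic.Quotient x₀ x₀) (c : UnivCover X x₀) : UnivCover X x₀ :=
  ⟨c.pt, g.symm.trans c.cls⟩

theorem precomp_extend (g : Path.Homotopic.Quotient x₀ x₀) (c : UnivCover X x₀) {y : X}
    (δ : Path c.pt y) : precomp g (c.extend δ) = (precomp g c).extend δ := by
  simp [extend, precomp]

instance : MulAction (FundamentalGroup X x₀) (UnivCover X x₀) where
  smul g c := precomp g c
  one_smul c := by
    change precomp (.refl x₀) c = c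
    exact UnivCover.ext rfl (heq_of_eq (Path.Homotopic.Quotient.refl_trans c.cls))
  mul_smul g h c := by
    change precomp (Path.Homotopic.Quotient.trans h g) c = precomp g (precomp h c)
    simp only [precomp, Path.Homotopic.Quotient.symm_trans_eq, Path.Homotopic.Quotient.trans_assoc]

end UnivCover

/-- Every point has a neighborhood in which any two paths starting there and having the same
endpoint are homotopic in the ambient space. -/
def SemilocallySimplyConnected (X : Type) [TopologicalSpace X] : Prop :=
  ∀ x : X, ∃ U : Set X, IsOpen U ∧ x ∈ U ∧ ∀ (y : X) (γ δ : Path x y), (∀ t, γ t ∈ U) →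
    (∀ t, δ t ∈ U) → γ.Homotopic δ

namespace UnivCover

variable {X : Type} [TopologicalSpace X] {x₀ : X}

theorem isQuotientCoveringMap_pt [PathConnectedSpace X] [LocallyPathConnectedSpace X]
    (hX : SemilocallySimplyConnected X) :
    IsQuotientCoveringMap (pt : UnivCover X x₀ → X) (FundamentalGroup X x₀) where
  toIsQuotientMap := by
    refine (isOpenMap_pt).isQuotientMap continuous_pt fun x => ?_
    obtain ⟨γ⟩ := PathConnectedSpace.joined x₀ x
    exact ⟨⟨x, .mk γ⟩, rfl⟩
  continuous_const_smul g := by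
    refine continuous_def.mpr fun S hS c hc => ?_
    obtain ⟨U, hU, hcU, h⟩ := hS _ hc
    refine ⟨U, hU, hcU, fun y δ hδ => ?_⟩
    change precomp g (c.extend δ) ∈ S
    rw [precomp_extend]
    exact h y δ hδ
  apply_eq_iff_mem_orbit {e₁ e₂} := by
    constructor
    · intro h
      obtain ⟨x, c⟩ := e₁
      obtain ⟨y, d⟩ := e₂
      obtain rfl : x = y := h
      refine ⟨Path.Homotopic.Quotient.symm (c.trans d.symm), ?_⟩
      change precomp (Path.Homotopic.Quotient.symm (c.trans d.symm)) ⟨x, d⟩ = ⟨x, c⟩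
      simp [precomp, Path.Homotopic.Quotient.symm_symm_eq]
    · rintro ⟨g, rfl⟩
      rfl
  disjoint c := by
    obtain ⟨U, hU, hcU, h⟩ := hX c.pt
    refine ⟨c.sheet U, (c.isOpen_sheet hU).mem_nhds (c.mem_sheet_self hcU), fun g => ?_⟩
    rintro ⟨_, ⟨_, ⟨y, δ, hδ, rfl⟩, rfl⟩, ⟨z, ε, hε, he⟩⟩
    change precomp g (c.extend δ) = c.extend ε at he
    obtain rfl : y = z := congrArg pt he
    have he := eq_of_heq (UnivCover.ext_iff.mp he).2
    have hδε : Path.Homotopic.Quotient.mk δ = .mk ε :=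
      Path.Homotopic.Quotient.eq.mpr (h y δ ε hδ hε)
    simp only [precomp, extend, hδε] at he
    have h1 : Path.Homotopic.Quotient.symm g = Path.Homotopic.Quotient.refl x₀ := by
      have := congrArg (fun q => (q.trans (Path.Homotopic.Quotient.mk ε).symm).trans c.cls.symm) he
      simpa using this
    change (g : Path.Homotopic.Quotient x₀ x₀) = .refl x₀
    have := congrArg Path.Homotopic.Quotient.symm h1
    rwa [Path.Homotopic.Quotient.symm_symm_eq] at this

/-- The lift of a path `δ` at the class `c`: at time `t`, the extension of `c` by the initial
segment of `δ` up to `t`. -/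
def lift (c : UnivCover X x₀) {y : X} (δ : Path c.pt y) (t : I) : UnivCover X x₀ :=
  c.extend ((δ.subpath 0 t).cast δ.source.symm rfl)

theorem lift_zero (c : UnivCover X x₀) {y : X} (δ : Path c.pt y) : c.lift δ 0 = c := by
  have h : ∀ (z : X) (hz : z = c.pt) (δ : Path c.pt z) (_ : δ = (Path.refl c.pt).cast rfl hz),
      c.extend δ = c := by
    rintro z rfl δ rfl
    exact c.extend_refl
  refine h _ δ.source _ ?_
  ext t
  simp

theorem lift_one (c : UnivCover X x₀) {y : X} (δ : Path c.pt y) : c.lift δ 1 = c.extend δ := by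
  have h : ∀ (z : X) (hz : z = y) (δ' : Path c.pt z) (_ : δ' = δ.cast rfl hz),
      c.extend δ' = c.extend δ := by
    rintro z rfl δ rfl
    rfl
  refine h _ δ.target _ ?_
  ext t
  simp

theorem lift_extend (c : UnivCover X x₀) {y : X} (δ : Path c.pt y) (s t : I) :
    (c.lift δ t).extend (δ.subpath t s) = c.lift δ s := by
  have h : Path.Homotopic (((δ.subpath 0 t).cast δ.source.symm rfl).trans (δ.subpath t s))
      ((δ.subpath 0 s).cast δ.source.symm rfl) := by
    refine ⟨((Path.Homotopy.subpathTransSubpath δ 0 t s).pathCast δ.source.symm rfl).cast ?_ rfl⟩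
    ext r
    simp [Path.trans_apply]
  refine (c.extend_trans _ _).symm.trans ?_
  simp only [lift, extend]
  rw [Path.Homotopic.Quotient.eq.mpr h]

theorem continuous_lift (c : UnivCover X x₀) {y : X} (δ : Path c.pt y) :
    Continuous (c.lift δ) := by
  refine continuous_def.mpr fun S hS => ?_
  rw [isOpen_iff_mem_nhds]
  intro t ht
  obtain ⟨U, hU, hcU, h⟩ := hS _ ht
  have hcU : δ t ∈ U := hcU
  obtain ⟨ε, hε, hεU⟩ := Metric.mem_nhds_iff.mp ((hU.preimage δ.continuous).mem_nhds hcU)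
  refine Filter.mem_of_superset (Metric.ball_mem_nhds t hε) fun s hs => ?_
  have h2 : ∀ r, δ.subpath t s r ∈ U := fun r => ?_
  · have := h _ (δ.subpath t s) h2
    rwa [lift_extend] at this
  · have h1 : δ.subpath t s r ∈ δ '' Set.uIcc t s :=
      Path.range_subpath δ t s ▸ Set.mem_range_self r
    obtain ⟨u, hu, hur⟩ := h1
    rw [← hur]
    refine hεU ?_
    rw [Metric.mem_ball] at hs ⊢
    have hu' : (u : ℝ) ∈ Set.uIcc (t : ℝ) s := hu
    rw [Subtype.dist_eq, Real.dist_eq] at hs ⊢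
    have := Set.abs_sub_left_of_mem_uIcc hu'
    exact lt_of_le_of_lt this hs

theorem joinedIn_sheet (c : UnivCover X x₀) {y : X} (δ : Path c.pt y) {U : Set X}
    (hδ : ∀ t, δ t ∈ U) : JoinedIn (c.sheet U) c (c.extend δ) :=
  ⟨⟨⟨c.lift δ, c.continuous_lift δ⟩, c.lift_zero δ, c.lift_one δ⟩, fun t =>
    ⟨_, _, fun r => by
      have h1 : δ.subpath 0 t r ∈ δ '' Set.uIcc 0 t :=
        Path.range_subpath δ 0 t ▸ Set.mem_range_self r
      obtain ⟨u, -, hu⟩ := h1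
      rw [Path.cast_coe, ← hu]
      exact hδ u, rfl⟩⟩

theorem isPathConnected_sheet (c : UnivCover X x₀) {U : Set X} (hc : c.pt ∈ U) :
    IsPathConnected (c.sheet U) :=
  ⟨c, c.mem_sheet_self hc, by
    rintro _ ⟨y, δ, hδ, rfl⟩
    exact c.joinedIn_sheet δ hδ⟩

instance : LocallyPathConnectedSpace (UnivCover X x₀) where
  path_connected_basis c := by
    rw [Filter.hasBasis_self]
    intro S hS
    obtain ⟨T, hTS, hT, hcT⟩ := mem_nhds_iff.mp hS
    obtain ⟨U, hU, hcU, h⟩ := hT c hcT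
    refine ⟨c.sheet U, (c.isOpen_sheet hU).mem_nhds (c.mem_sheet_self hcU),
      c.isPathConnected_sheet hcU, ?_⟩
    rintro _ ⟨y, δ, hδ, rfl⟩
    exact hTS (h y δ hδ)

instance : PathConnectedSpace (UnivCover X x₀) := by
  rw [pathConnectedSpace_iff_univ]
  convert (⟨x₀, .refl x₀⟩ : UnivCover X x₀).isPathConnected_sheet (Set.mem_univ _)
  symm
  rw [Set.eq_univ_iff_forall]
  rintro ⟨y, ⟨δ⟩⟩
  refine ⟨y, δ, fun _ => trivial, UnivCover.ext rfl (heq_of_eq ?_)⟩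
  exact (Path.Homotopic.Quotient.refl_trans (.mk δ)).symm

theorem simplyConnectedSpace [PathConnectedSpace X] [LocallyPathConnectedSpace X]
    (hX : SemilocallySimplyConnected X) : SimplyConnectedSpace (UnivCover X x₀) := by
  have hcov := (isQuotientCoveringMap_pt (x₀ := x₀) hX).isCoveringMap
  rw [simply_connected_iff_loops_nullhomotopic]
  refine ⟨inferInstance, fun c Γ => ?_⟩
  let γ : Path c.pt c.pt := Γ.map continuous_pt
  -- The loop is the lift of its projection, so it can only close up if the latter is null.
  have hΓ : (Γ : I → UnivCover X x₀) = c.lift γ :=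
    hcov.eq_of_comp_eq Γ.continuous (c.continuous_lift γ) rfl 0 (by rw [lift_zero, Γ.source])
  have h1 : c.extend γ = c := by
    rw [← lift_one, ← hΓ, Γ.target]
  have h2 : c.cls.trans (.mk γ) = c.cls := eq_of_heq (UnivCover.ext_iff.mp h1).2
  have h3 : Path.Homotopic.Quotient.mk γ = .refl c.pt := by
    have := congrArg (fun q => c.cls.symm.trans q) h2
    simpa [← Path.Homotopic.Quotient.trans_assoc] using this
  have := hcov.injective_path_homotopic_map c c (a₁ := .mk Γ) (a₂ := .refl c) (by
    change Path.Homotopic.Quotient.mk γ = _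
    rw [h3]; rfl)
  exact Path.Homotopic.Quotient.eq.mp this

theorem contractibleSpace [PathConnectedSpace X] [LocallyPathConnectedSpace X]
    (hX : SemilocallySimplyConnected X) (h : IsAspherical X) :
    ContractibleSpace (UnivCover X x₀) := by
  have := simplyConnectedSpace (x₀ := x₀) hX
  exact (isQuotientCoveringMap_pt (x₀ := x₀) hX).isCoveringMap.contractibleSpace_of_nullhomotopic
    (h _ (LiftsCoverings.of_simplyConnected _) _)

end UnivCover

/-- Semilocal simple connectedness descends along surjective local homeomorphisms. -/
theorem SemilocallySimplyConnected.of_isLocalHomeomorph {E X : Type} [TopologicalSpace E]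
    [TopologicalSpace X] {p : E → X} (hp : IsLocalHomeomorph p) (hs : Function.Surjective p)
    (hE : SemilocallySimplyConnected E) : SemilocallySimplyConnected X := by
  intro x
  obtain ⟨e, rfl⟩ := hs x
  obtain ⟨U, hU, heU, h⟩ := hE e
  have hc := hp.continuous
  obtain ⟨φ, heφ, rfl⟩ := hp e
  refine ⟨φ.target ∩ φ.symm ⁻¹' U, φ.symm.isOpen_inter_preimage hU,
    ⟨φ.map_source heφ, by simpa [φ.left_inv heφ] using heU⟩, fun y γ δ hγ hδ => ?_⟩
  have hy : y ∈ φ.target := by simpa using (hγ 1).1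
  -- Transport the two paths to `E` along the local inverse.
  have key : ∀ γ : Path (φ e) y, (∀ t, γ t ∈ φ.target ∩ φ.symm ⁻¹' U) →
      ∃ γ' : Path e (φ.symm y), (∀ t, γ' t ∈ U) ∧
        (γ'.map hc).cast rfl (φ.right_inv hy).symm = γ := by
    intro γ hγ
    refine ⟨(γ.map' (φ.continuousOn_symm.mono (by rintro _ ⟨t, rfl⟩; exact (hγ t).1))).cast
      (φ.left_inv heφ).symm rfl, fun t => (hγ t).2, ?_⟩
    ext t
    exact φ.right_inv (hγ t).1
  obtain ⟨γ', hγ', rfl⟩ := key γ hγ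
  obtain ⟨δ', hδ', rfl⟩ := key δ hδ
  exact ((h _ γ' δ' hγ' hδ').map ⟨φ, hc⟩).pathCast _ _

theorem UnivCover.isClassifyingSpace {X : Type} [TopologicalSpace X] [PathConnectedSpace X]
    [LocallyPathConnectedSpace X] (hX : SemilocallySimplyConnected X) (h : IsAspherical X)
    (x₀ : X) (G : Type) [Group G] (e : G ≃* FundamentalGroup X x₀) : IsClassifyingSpace G X := by
  let _ : MulAction G (UnivCover X x₀) := MulAction.compHom _ e.toMonoidHom
  have hq := UnivCover.isQuotientCoveringMap_pt (x₀ := x₀) hX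
  refine ⟨UnivCover X x₀, inferInstance, inferInstance, UnivCover.pt, ?_,
    UnivCover.contractibleSpace hX h⟩
  exact {
    toIsQuotientMap := hq.toIsQuotientMap
    continuous_const_smul := fun g => hq.continuous_const_smul (e g)
    apply_eq_iff_mem_orbit := by
      intro c d
      rw [hq.apply_eq_iff_mem_orbit]
      constructor
      · rintro ⟨g, hg⟩
        refine ⟨e.symm g, ?_⟩
        change e (e.symm g) • d = c
        rwa [e.apply_symm_apply]
      · rintro ⟨g, hg⟩
        exact ⟨e g, hg⟩
    disjoint := fun c => by
      obtain ⟨U, hU, h⟩ := hq.disjoint c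
      exact ⟨U, hU, fun g hg => e.map_eq_one_iff.mp (h (e g) hg)⟩ }

/-! ### The colimit topology on `ℂ^∞` -/

namespace CInf

/-- The coordinate functions on `ℂ^∞`. -/
def coord (i : ℕ) : CInf →ₗ[ℂ] ℂ := Finsupp.lapply (M := ℂ) (R := ℂ) (α := ℕ) i

theorem ext_coord {u v : CInf} (h : ∀ i, coord i u = coord i v) : u = v :=
  Finsupp.ext (f := (u : ℕ →₀ ℂ)) (g := v) h

theorem exists_coord_eq_zero (v : CInf) : ∃ m, ∀ i, m ≤ i → coord i v = 0 := by
  obtain ⟨m, hm⟩ := (Finsupp.support (v : ℕ →₀ ℂ)).exists_nat_subset_range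
  refine ⟨m, fun i hi => ?_⟩
  by_contra h
  have := hm (Finsupp.mem_support_iff.mpr h)
  simp at this
  omega

theorem coord_incl (k : ℕ) (x : Fin k → ℂ) (i : ℕ) :
    coord i (incl k x) = if h : i < k then x ⟨i, h⟩ else 0 := by
  have h1 : coord i (incl k x) = ∑ j : Fin k, (Finsupp.single (j : ℕ) (x j) : ℕ →₀ ℂ) i :=
    Finsupp.finsetSum_apply Finset.univ (fun j : Fin k => Finsupp.single (j : ℕ) (x j)) i
  rw [h1]
  split_ifs with h
  · rw [Finset.sum_eq_single ⟨i, h⟩]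
    · simp
    · intro j _ hj
      rw [Finsupp.single_apply, if_neg]
      exact fun hji => hj (Fin.ext hji)
    · simp
  · refine Finset.sum_eq_zero fun j _ => ?_
    rw [Finsupp.single_apply, if_neg]
    have := j.2
    omega

theorem isOpen_iff {U : Set CInf} : IsOpen U ↔ ∀ k, IsOpen (incl k ⁻¹' U) := by
  rw [isOpen_iSup_iff]
  rfl

theorem continuous_incl (k : ℕ) : Continuous (incl k) :=
  continuous_def.mpr fun _ hU => isOpen_iff.mp hU k

theorem continuous_of_comp_incl {Z : Type*} [TopologicalSpace Z] {f : CInf → Z}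
    (h : ∀ k, Continuous fun x => f (incl k x)) : Continuous f :=
  continuous_def.mpr fun _ hU => isOpen_iff.mpr fun k => hU.preimage (h k)

theorem continuous_const_add (v : CInf) : Continuous fun u : CInf => v + u := by
  refine continuous_of_comp_incl fun k => ?_
  obtain ⟨m, hm⟩ := exists_coord_eq_zero v
  have : (fun x : Fin k → ℂ => v + incl k x) = fun x => incl (max m k)
      (fun i => coord i v + if h : (i : ℕ) < k then x ⟨i, h⟩ else 0) := by
    ext1 x
    refine ext_coord fun i => ?_
    rw [map_add, coord_incl, coord_incl]
    by_cases h : i < max m k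
    · simp [h]
    · have h1 : ¬ i < k := by omega
      simp [h, h1, hm i (by omega)]
  rw [this]
  refine (continuous_incl _).comp (continuous_pi fun i => continuous_const.add ?_)
  split_ifs <;> fun_prop

/-- One step of the construction of a box: a compact polydisc in `ℂ^k` inside an open set
thickens in the next coordinate direction. -/
theorem exists_thickening {U : Set CInf} (hU : IsOpen U) (k : ℕ) (ε : ℕ → ℝ)
    (h : ∀ x : Fin k → ℂ, (∀ i, ‖x i‖ ≤ ε i) → incl k x ∈ U) :
    ∃ r > 0, ∀ x : Fin (k + 1) → ℂ, (∀ i : Fin k, ‖x i.castSucc‖ ≤ ε i) →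
      ‖x (Fin.last k)‖ ≤ r → incl (k + 1) x ∈ U := by
  let K : Set (Fin k → ℂ) := Set.univ.pi fun i : Fin k => Metric.closedBall 0 (ε i)
  have hK : IsCompact K := isCompact_univ_pi fun i => isCompact_closedBall _ _
  let Φ : (Fin k → ℂ) × ℂ → CInf := fun p => incl (k + 1) (Fin.snoc (α := fun _ => ℂ) p.1 p.2)
  have hΦ : Continuous Φ := (continuous_incl _).comp
    (Continuous.finSnoc (A := fun _ => ℂ) continuous_fst continuous_snd)
  have hsub : K ×ˢ {(0 : ℂ)} ⊆ Φ ⁻¹' U := by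
    rintro ⟨x, z⟩ ⟨hx, rfl : z = 0⟩
    have h1 : Φ (x, 0) = incl k x := by
      refine ext_coord fun i => ?_
      rw [coord_incl, coord_incl]
      by_cases hi : i < k
      · rw [dif_pos hi, dif_pos (by omega)]
        exact Fin.snoc_castSucc (α := fun _ => ℂ) 0 x ⟨i, hi⟩
      · rw [dif_neg hi]
        split_ifs with h2
        · have : (⟨i, h2⟩ : Fin (k + 1)) = Fin.last k := Fin.ext (by simp; omega)
          rw [this]
          exact Fin.snoc_last (α := fun _ => ℂ) 0 x
        · rfl
    rw [Set.mem_preimage, h1]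
    exact h x fun i => by simpa using hx i trivial
  obtain ⟨u, v, hu, hv, hKu, h0v, huv⟩ :=
    generalized_tube_lemma hK isCompact_singleton (hU.preimage hΦ) hsub
  obtain ⟨r, hr, hrv⟩ := Metric.mem_nhds_iff.mp (hv.mem_nhds (h0v rfl))
  refine ⟨r / 2, by positivity, fun x hx hxl => ?_⟩
  have := huv (a := (fun i => x i.castSucc, x (Fin.last k)))
    ⟨hKu fun i _ => by simpa using hx i, hrv (by
      rw [mem_ball_zero_iff]; linarith)⟩
  simpa [Φ, Fin.snoc_castSucc, Fin.snoc_init_self] using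
    (show incl (k + 1) (Fin.snoc (α := fun _ => ℂ) (Fin.init x) (x (Fin.last k))) ∈ U from this)

/-- The open box of radii `ε` around the origin. -/
def box (ε : ℕ → ℝ) : Set CInf := {u | ∀ i, ‖coord i u‖ < ε i}

theorem isOpen_box {ε : ℕ → ℝ} (hε : ∀ i, 0 < ε i) : IsOpen (box ε) := by
  refine isOpen_iff.mpr fun k => ?_
  have : incl k ⁻¹' box ε = ⋂ i : Fin k, {x | ‖x i‖ < ε i} := by
    ext x
    simp only [box, Set.mem_preimage, Set.mem_ofPred_eq, coord_incl, Set.mem_iInter]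
    constructor
    · intro h i
      simpa using h i
    · intro h i
      split_ifs with hi
      · exact h ⟨i, hi⟩
      · simpa using hε i
  rw [this]
  exact isOpen_iInter_of_finite fun i => isOpen_lt (by fun_prop) continuous_const

theorem exists_box_subset {U : Set CInf} (hU : IsOpen U) (h0 : 0 ∈ U) :
    ∃ ε : ℕ → ℝ, (∀ i, 0 < ε i) ∧ box ε ⊆ U := by
  classical
  have step : ∀ (k : ℕ) (ε : ℕ → ℝ), ∃ r > 0,
      (∀ x : Fin k → ℂ, (∀ i, ‖x i‖ ≤ ε i) → incl k x ∈ U) →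
      ∀ x : Fin (k + 1) → ℂ, (∀ i : Fin k, ‖x i.castSucc‖ ≤ ε i) →
        ‖x (Fin.last k)‖ ≤ r → incl (k + 1) x ∈ U := by
    intro k ε
    by_cases h : ∀ x : Fin k → ℂ, (∀ i, ‖x i‖ ≤ ε i) → incl k x ∈ U
    · obtain ⟨r, hr, h'⟩ := exists_thickening hU k ε h
      exact ⟨r, hr, fun _ => h'⟩
    · exact ⟨1, one_pos, fun h' => absurd h' h⟩
  choose r hr hstep using step
  let E : ℕ → ℕ → ℝ := fun k => Nat.rec (fun _ => 0) (fun k e => Function.update e k (r k e)) k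
  have hE : ∀ k, E (k + 1) = Function.update (E k) k (r k (E k)) := fun k => rfl
  have hstab : ∀ i m, i < m → E m i = E (i + 1) i := by
    intro i m h
    induction m, h using Nat.le_induction with
    | base => rfl
    | succ m hm ih => rw [hE, Function.update_of_ne (by omega), ih]
  have hQ : ∀ k, ∀ x : Fin k → ℂ, (∀ i, ‖x i‖ ≤ E k i) → incl k x ∈ U := by
    intro k
    induction k with
    | zero =>
      intro x _
      have : incl 0 x = 0 := ext_coord fun i => by rw [coord_incl]; simp
      rwa [this]
    | succ k ih =>
      intro x hx
      refine hstep k (E k) ih x (fun i => ?_) ?_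
      · have := hx i.castSucc
        rwa [hE, Function.update_of_ne (by simpa using i.2.ne)] at this
      · simpa [hE] using hx (Fin.last k)
  refine ⟨fun i => E (i + 1) i, fun i => by simpa [hE] using hr i (E i), fun u hu => ?_⟩
  obtain ⟨m, hm⟩ := exists_coord_eq_zero u
  have : u = incl m fun i => coord i u := by
    refine ext_coord fun i => ?_
    rw [coord_incl]
    split_ifs with h
    · rfl
    · exact hm i (by omega)
  rw [this]
  exact hQ m _ fun i => by rw [hstab i m i.2]; exact (hu i).le

theorem hasBasis_nhds_zero : (𝓝 (0 : CInf)).HasBasis (fun ε : ℕ → ℝ => ∀ i, 0 < ε i) box := by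
  refine ⟨fun S => ⟨fun hS => ?_, ?_⟩⟩
  · obtain ⟨U, hUS, hU, h0⟩ := mem_nhds_iff.mp hS
    obtain ⟨ε, hε, h⟩ := exists_box_subset hU h0
    exact ⟨ε, hε, h.trans hUS⟩
  · rintro ⟨ε, hε, h⟩
    exact Filter.mem_of_superset ((isOpen_box hε).mem_nhds fun i => by simpa using hε i) h

/-- Boxes around the origin are halved coordinatewise, so addition is continuous although the
colimit topology is not metrizable. -/
instance : IsTopologicalAddGroup CInf := by
  refine IsTopologicalAddGroup.of_comm_of_nhds_zero ?_ ?_ fun v => ?_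
  · refine ((hasBasis_nhds_zero.prod_self).tendsto_iff hasBasis_nhds_zero).mpr fun ε hε =>
      ⟨fun i => ε i / 2, fun i => half_pos (hε i), fun p hp i => ?_⟩
    have h1 := hp.1 i
    have h2 := hp.2 i
    change ‖coord i (p.1 + p.2)‖ < ε i
    rw [map_add]
    exact (norm_add_le _ _).trans_lt (by linarith)
  · refine (hasBasis_nhds_zero.tendsto_iff hasBasis_nhds_zero).mpr fun ε hε =>
      ⟨ε, hε, fun u hu i => ?_⟩
    simpa using hu i
  · let e : CInf ≃ₜ CInf :=
      { Equiv.addLeft v with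
        continuous_toFun := continuous_const_add v
        continuous_invFun := continuous_const_add (-v) }
    have := e.map_nhds_eq 0
    rw [show e 0 = v from add_zero v] at this
    exact this.symm

instance : ContinuousSMul ℂ CInf := by
  refine ContinuousSMul.of_nhds_zero ?_ (fun u => ?_) (fun a => ?_)
  · refine ((Metric.nhds_basis_ball.prod hasBasis_nhds_zero).tendsto_iff hasBasis_nhds_zero).mpr
      fun ε hε => ⟨(1, ε), ⟨one_pos, hε⟩, fun p hp i => ?_⟩
    have h1 := hp.1
    have h2 := hp.2 i
    rw [mem_ball_zero_iff] at h1
    simp only [map_smul, smul_eq_mul, norm_mul]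
    nlinarith [norm_nonneg p.1, norm_nonneg (coord i p.2)]
  · refine (Metric.nhds_basis_ball.tendsto_iff hasBasis_nhds_zero).mpr fun ε hε => ?_
    obtain ⟨m, hm⟩ := exists_coord_eq_zero u
    have : ∀ᶠ a : ℂ in 𝓝 0, ∀ i ∈ Finset.range m, ‖a * coord i u‖ < ε i := by
      rw [Filter.eventually_all_finset]
      intro i _
      have : Filter.Tendsto (fun a : ℂ => ‖a * coord i u‖) (𝓝 0) (𝓝 ‖0 * coord i u‖) :=
        Continuous.tendsto (by fun_prop) 0
      exact this.eventually_lt_const (by simpa using hε i)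
    obtain ⟨r, hr, h⟩ := Metric.eventually_nhds_iff_ball.mp this
    refine ⟨r, hr, fun a ha i => ?_⟩
    by_cases hi : i < m
    · simpa using h a ha i (Finset.mem_range.mpr hi)
    · simpa [hm i (by omega)] using hε i
  · refine (hasBasis_nhds_zero.tendsto_iff hasBasis_nhds_zero).mpr fun ε hε =>
      ⟨fun i => ε i / (‖a‖ + 1), fun i => div_pos (hε i) (by positivity), fun u hu i => ?_⟩
    have h1 := hu i
    rw [lt_div_iff₀ (by positivity)] at h1
    simp only [map_smul, smul_eq_mul, norm_mul]
    nlinarith [norm_nonneg a, norm_nonneg (coord i u)]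

instance : LocallyConvexSpace ℝ CInf := by
  refine LocallyConvexSpace.ofBasisZero ℝ CInf box (fun ε : ℕ → ℝ => ∀ i, 0 < ε i)
    hasBasis_nhds_zero fun ε hε => ?_
  have : box ε = ⋂ i, ((coord i).restrictScalars ℝ) ⁻¹' Metric.ball 0 (ε i) := by
    ext u
    simp [box]
  rw [this]
  exact convex_iInter fun i => (convex_ball _ _).linear_preimage _

theorem continuous_linearMap {F : Type*} [AddCommGroup F] [Module ℂ F] [TopologicalSpace F]
    [IsTopologicalAddGroup F] [ContinuousSMul ℂ F] (f : CInf →ₗ[ℂ] F) : Continuous f := by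
  refine continuous_of_comp_incl fun k => ?_
  let L : (Fin k → ℂ) →ₗ[ℂ] CInf :=
    { toFun := incl k
      map_add' := fun x y => ext_coord fun i => by
        rw [map_add]; simp only [coord_incl]; split_ifs <;> simp
      map_smul' := fun a x => ext_coord fun i => by
        rw [map_smul]; simp only [coord_incl]; split_ifs <;> simp }
  exact (f ∘ₗ L).continuous_of_finiteDimensional

@[fun_prop]
theorem continuous_coord (i : ℕ) : Continuous (coord i) := continuous_linearMap _

instance : T2Space CInf := by
  refine T2Space.of_injective_continuous (Y := ℕ → ℂ) (f := fun u i => coord i u)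
    (fun u v h => ext_coord (congrFun h)) (by fun_prop)

/-- The shift `e_i ↦ e_{i+1}`. -/
def shift : CInf →ₗ[ℂ] CInf := Finsupp.lmapDomain ℂ ℂ Nat.succ

theorem coord_zero_shift (u : CInf) : coord 0 (shift u) = 0 :=
  Finsupp.mapDomain_of_notMem_range (f := Nat.succ) u 0 (by simp)

theorem coord_succ_shift (u : CInf) (i : ℕ) : coord (i + 1) (shift u) = coord i u :=
  Finsupp.mapDomain_apply Nat.succ_injective u i

/-- The first basis vector. -/
def e₀ : CInf := (Finsupp.single 0 1 : ℕ →₀ ℂ)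

theorem coord_e₀ : coord 0 e₀ = 1 := Finsupp.single_eq_same

theorem e₀_ne_zero : e₀ ≠ 0 := fun h => by simpa [h] using coord_e₀

theorem shift_ne_zero {u : CInf} (hu : u ≠ 0) : shift u ≠ 0 := fun h => hu <|
  ext_coord fun i => by rw [← coord_succ_shift, h]; simp

/-- The shift has no eigenvectors. -/
theorem segment_shift_ne_zero {u : CInf} (hu : u ≠ 0) (a b : ℂ) (hab : a ≠ 0 ∨ b ≠ 0) :
    a • u + b • shift u ≠ 0 := by
  intro h
  by_cases ha : a = 0
  · have hb : b ≠ 0 := by tauto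
    simp [ha, hb, shift_ne_zero hu] at h
  · refine hu (ext_coord fun i => ?_)
    induction i with
    | zero =>
      have := congrArg (coord 0) h
      simpa [coord_zero_shift, ha] using this
    | succ i ih =>
      have := congrArg (coord (i + 1)) h
      simp only [map_zero] at ih
      simpa [coord_succ_shift, ha, ih] using this

/-- Nonzero vectors form a contractible space: move linearly to the shift, then linearly to the
first basis vector. -/
instance contractibleSpace_ne_zero : ContractibleSpace {u : CInf // u ≠ 0} := by
  have hs : Continuous shift := continuous_linearMap _
  rw [contractible_iff_id_nullhomotopic]
  refine ⟨⟨e₀, e₀_ne_zero⟩, ContinuousMap.Homotopic.trans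
    (g := ⟨fun u => ⟨shift u.1, shift_ne_zero u.2⟩, by fun_prop⟩) ⟨⟨⟨fun p =>
      ⟨((1 - (p.1 : ℝ) : ℝ) : ℂ) • p.2.1 + ((p.1 : ℝ) : ℂ) • shift p.2.1,
        segment_shift_ne_zero p.2.2 _ _ ?_⟩, ?_⟩, ?_, ?_⟩⟩
    ⟨⟨⟨fun p => ⟨((1 - (p.1 : ℝ) : ℝ) : ℂ) • shift p.2.1 + ((p.1 : ℝ) : ℂ) • e₀, ?_⟩, ?_⟩, ?_, ?_⟩⟩⟩
  · by_cases h : (p.1 : ℝ) = 0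
    · left; simp [h]
    · right; exact_mod_cast h
  · fun_prop
  · intro u; simp
  · intro u; simp
  · intro h
    have h0 := congrArg (coord 0) h
    have h1 : (p.1 : ℝ) = 0 := by simpa [coord_zero_shift, coord_e₀] using h0
    simp [h1, shift_ne_zero p.2.2] at h
  · fun_prop
  · intro u; simp
  · intro u; simp

end CInf

/-! ### Avoiding a moving configuration -/

/-- A positive function that depends on a compact parameter has a continuous positive lower bound
independent of the parameter. -/
theorem exists_continuous_pos_le {B K : Type*} [TopologicalSpace B] [TopologicalSpace K]
    [CompactSpace K] [Nonempty K] {g : B × K → ℝ} (hg : Continuous g) (hpos : ∀ p, 0 < g p) :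
    ∃ δ : B → ℝ, Continuous δ ∧ (∀ b, 0 < δ b) ∧ ∀ b k, δ b ≤ g (b, k) := by
  have hb : ∀ b, IsCompact ((fun k => g (b, k)) '' Set.univ) := fun b =>
    isCompact_univ.image (by fun_prop)
  have hne : ∀ b, ((fun k => g (b, k)) '' Set.univ).Nonempty := fun b =>
    Set.univ_nonempty.image _
  refine ⟨fun b => sInf ((fun k => g (b, k)) '' Set.univ),
    isCompact_univ.continuous_sInf (f := fun b k => g (b, k)) hg, fun b => ?_, fun b k => ?_⟩
  · obtain ⟨k, -, hk⟩ := (hb b).sInf_mem (hne b)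
    simp only [← hk]
    exact hpos _
  · exact csInf_le (hb b).bddBelow ⟨k, trivial, rfl⟩

/-- Move the plane so that nearby points `x i` are carried to `y i`: each `x i` drags its
`δ / 2`-neighborhood along, with a strength that decreases linearly with the distance. -/
def drag {n : ℕ} (δ : ℝ) (x y : Fin n → ℂ) (z : ℂ) : ℂ :=
  z + ∑ i, ((max (1 - 2 * ‖z - x i‖ / δ) 0 : ℝ) : ℂ) * (y i - x i)

@[simp] theorem drag_self {n : ℕ} (δ : ℝ) (x : Fin n → ℂ) (z : ℂ) : drag δ x x z = z := by
  simp [drag]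

theorem drag_point {n : ℕ} {δ : ℝ} (hδ : 0 < δ) {x : Fin n → ℂ} (y : Fin n → ℂ)
    (hx : ∀ i j, i ≠ j → δ ≤ ‖x i - x j‖) (j : Fin n) : drag δ x y (x j) = y j := by
  rw [drag, Finset.sum_eq_single j]
  · simp
  · intro i _ hij
    have h1 : 1 - 2 * ‖x j - x i‖ / δ ≤ 0 := by
      have := hx j i hij.symm
      rw [sub_nonpos, le_div_iff₀ hδ]
      linarith
    rw [max_eq_right h1]
    simp
  · simp

/-- Dragging is injective as long as the displacements are small compared to the separation. -/
theorem drag_ne {n : ℕ} {δ : ℝ} (hδ : 0 < δ) {x y : Fin n → ℂ}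
    (hx : ∀ i j, i ≠ j → δ ≤ ‖x i - x j‖) (hy : ∀ i, ‖y i - x i‖ ≤ δ / (4 * (n + 1)))
    {z : ℂ} {j : Fin n} (hz : z ≠ x j) : drag δ x y z ≠ y j := by
  intro h
  rw [← drag_point hδ y hx j] at h
  have h1 : z - x j = ∑ i, (((max (1 - 2 * ‖x j - x i‖ / δ) 0 -
      max (1 - 2 * ‖z - x i‖ / δ) 0 : ℝ) : ℂ) * (y i - x i)) := by
    simp only [Complex.ofReal_sub, sub_mul, Finset.sum_sub_distrib]
    simp only [drag] at h
    linear_combination h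
  have h2 : ‖z - x j‖ ≤ ∑ _i : Fin n, ‖z - x j‖ / (2 * (n + 1)) := by
    nth_rewrite 1 [h1]
    refine (norm_sum_le _ _).trans (Finset.sum_le_sum fun i _ => ?_)
    rw [norm_mul, Complex.norm_real, Real.norm_eq_abs]
    have h3 : |max (1 - 2 * ‖x j - x i‖ / δ) 0 - max (1 - 2 * ‖z - x i‖ / δ) 0| ≤
        2 * ‖z - x j‖ / δ := by
      refine (abs_max_sub_max_le_abs _ _ _).trans ?_
      have h4 : 1 - 2 * ‖x j - x i‖ / δ - (1 - 2 * ‖z - x i‖ / δ) =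
          2 * (‖z - x i‖ - ‖x j - x i‖) / δ := by ring
      rw [h4, abs_div, abs_mul, abs_of_pos hδ, abs_two]
      have h5 := abs_norm_sub_norm_le (z - x i) (x j - x i)
      rw [sub_sub_sub_cancel_right] at h5
      gcongr
    calc _ ≤ 2 * ‖z - x j‖ / δ * (δ / (4 * (n + 1))) := by
          gcongr
          exact hy i
      _ = ‖z - x j‖ / (2 * (n + 1)) := by
          field_simp
          ring
  rw [Finset.sum_const, Finset.card_univ, Fintype.card_fin, nsmul_eq_mul] at h2
  have h6 : 0 < ‖z - x j‖ := norm_pos_iff.mpr (sub_ne_zero.mpr hz)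
  have h7 : (n : ℝ) * (‖z - x j‖ / (2 * (n + 1))) < ‖z - x j‖ := by
    rw [← mul_div_assoc, div_lt_iff₀ (by positivity)]
    nlinarith
  linarith

/-- Forgetting the last point of a configuration is a fibration: given a continuous family of
moving configurations and a point off the initial configuration, the point can be moved
continuously so as to avoid the moving configuration. Where the configuration stands still, so
does the point. The time interval is cut into steps so short (depending continuously on the
parameter) that in each step the configuration moves little compared to its separation; in each
step the point is dragged along. -/
theorem exists_avoiding_lift {B : Type*} [TopologicalSpace B] {n : ℕ} {x : B × I → Fin n → ℂ}
    (hx : Continuous x) (hinj : ∀ p, Function.Injective (x p)) {z₀ : B → ℂ} (hz₀ : Continuous z₀)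
    (h0 : ∀ b i, z₀ b ≠ x (b, 0) i) :
    ∃ ζ : B × I → ℂ, Continuous ζ ∧ (∀ b, ζ (b, 0) = z₀ b) ∧ (∀ p i, ζ p ≠ x p i) ∧
      ∀ b, (∀ t, x (b, t) = x (b, 0)) → ∀ t, ζ (b, t) = z₀ b := by
  -- The separation of the points.
  obtain ⟨δ, hδc, hδ, hδx⟩ : ∃ δ : B → ℝ, Continuous δ ∧ (∀ b, 0 < δ b) ∧
      ∀ b t i j, i ≠ j → δ b ≤ ‖x (b, t) i - x (b, t) j‖ := by
    have hpair : ∀ i j : Fin n, ∃ δ : B → ℝ, Continuous δ ∧ (∀ b, 0 < δ b) ∧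
        ∀ b t, i ≠ j → δ b ≤ ‖x (b, t) i - x (b, t) j‖ := by
      intro i j
      by_cases hij : i = j
      · exact ⟨fun _ => 1, continuous_const, fun _ => one_pos, fun _ _ h => absurd hij h⟩
      · obtain ⟨δ, h1, h2, h3⟩ := exists_continuous_pos_le (B := B) (K := I)
          (g := fun p => ‖x p i - x p j‖) (by fun_prop)
          fun p => norm_pos_iff.mpr (sub_ne_zero.mpr fun h => hij (hinj p h))
        exact ⟨δ, h1, h2, fun b t _ => h3 b t⟩
    choose d hd1 hd2 hd3 using hpair
    let S : Finset (Option (Fin n × Fin n)) := Finset.univ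
    have hS : S.Nonempty := ⟨none, Finset.mem_univ _⟩
    let D : Option (Fin n × Fin n) → B → ℝ := fun o => o.elim (fun _ => 1) fun q => d q.1 q.2
    refine ⟨fun b => S.inf' hS fun o => D o b, ?_, fun b => ?_, fun b t i j hij => ?_⟩
    · refine Continuous.finset_inf'_apply hS fun o _ => ?_
      rcases o with _ | q
      · exact continuous_const
      · exact hd1 _ _
    · rw [Finset.lt_inf'_iff]
      rintro (_ | q) _
      · exact one_pos
      · exact hd2 _ _ b
    · exact (Finset.inf'_le _ (Finset.mem_univ (some (i, j)))).trans (hd3 i j b t hij)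
  -- The step length.
  obtain ⟨τ, hτc, hτ, hτx⟩ : ∃ τ : B → ℝ, Continuous τ ∧ (∀ b, 0 < τ b) ∧
      ∀ b (s t : I), |(s : ℝ) - t| ≤ τ b → ∀ i, ‖x (b, t) i - x (b, s) i‖ ≤
        δ b / (4 * (n + 1)) := by
    obtain ⟨τ, h1, h2, h3⟩ := exists_continuous_pos_le (B := B) (K := I × I)
      (g := fun p => |(p.2.1 : ℝ) - p.2.2| +
        max 0 (δ p.1 / (4 * (n + 1)) - ‖x (p.1, p.2.2) - x (p.1, p.2.1)‖)) (by fun_prop) (by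
          rintro ⟨b, s, t⟩
          by_cases hst : s = t
          · subst hst
            have : 0 < δ b / (4 * ((n : ℝ) + 1)) := div_pos (hδ b) (by positivity)
            simpa using this
          · have : 0 < |(s : ℝ) - t| :=
              abs_pos.mpr (sub_ne_zero.mpr fun h => hst (Subtype.ext h))
            positivity)
    refine ⟨fun b => τ b / 2, by fun_prop, fun b => half_pos (h2 b), fun b s t hst i => ?_⟩
    refine (norm_le_pi_norm (x (b, t) - x (b, s)) i).trans ?_
    by_contra hlt
    have h4 := h3 b (s, t)
    simp only at h4
    rw [max_eq_left (by linarith), add_zero] at h4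
    have := h2 b
    linarith
  -- The position after `k` steps, where time is stopped at `t`.
  let T : ℕ → B × I → I := fun k p => ⟨min (k * τ p.1) p.2,
    le_min (mul_nonneg k.cast_nonneg (hτ _).le) p.2.2.1, (min_le_right _ _).trans p.2.2.2⟩
  have hT : ∀ k, Continuous (T k) := fun k => by
    refine Continuous.subtype_mk ?_ _
    fun_prop
  let Z : ℕ → B × I → ℂ := fun k => Nat.rec (fun p => z₀ p.1)
    (fun k f p => drag (δ p.1) (x (p.1, T k p)) (x (p.1, T (k + 1) p)) (f p)) k
  have hZ : ∀ k p, Z (k + 1) p =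
    drag (δ p.1) (x (p.1, T k p)) (x (p.1, T (k + 1) p)) (Z k p) := fun k p => rfl
  have hZc : ∀ k, Continuous (Z k) := by
    intro k
    induction k with
    | zero => exact hz₀.comp continuous_fst
    | succ k ih =>
      have h1 := hT k
      have h2 := hT (k + 1)
      have h3 : ∀ p : B × I, δ p.1 ≠ 0 := fun p => (hδ p.1).ne'
      simp only [funext (hZ k), drag]
      fun_prop (disch := assumption)
  have hT0 : ∀ p, T 0 p = 0 := fun p => by
    refine Subtype.ext ?_
    simpa [T] using p.2.2.1
  have hZne : ∀ k p i, Z k p ≠ x (p.1, T k p) i := by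
    intro k p
    induction k with
    | zero => intro i; rw [hT0]; exact h0 p.1 i
    | succ k ih =>
      intro i
      rw [hZ]
      refine drag_ne (hδ _) (fun i j hij => hδx _ _ i j hij) (hτx _ _ _ ?_) (ih i)
      simp only [T]
      have h1 := hτ p.1
      rw [abs_sub_le_iff]
      push_cast
      constructor
      · have : min (k * τ p.1) (p.2 : ℝ) ≤ min ((k + 1) * τ p.1) (p.2 : ℝ) :=
          min_le_min_right _ (by linarith)
        linarith
      · rcases le_total (k * τ p.1) (p.2 : ℝ) with h | h
        · rw [min_eq_left h]
          have := min_le_left ((k + 1) * τ p.1) (p.2 : ℝ)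
          linarith
        · rw [min_eq_right h]
          have := min_le_right ((k + 1) * τ p.1) (p.2 : ℝ)
          linarith
  have hTend : ∀ (k : ℕ) p, 1 ≤ k * τ p.1 → T k p = p.2 := fun k p h =>
    Subtype.ext (min_eq_right (p.2.2.2.trans h))
  have hstab : ∀ (k m : ℕ) p, 1 ≤ k * τ p.1 → k ≤ m → Z m p = Z k p := by
    intro k m p hk hkm
    induction m, hkm using Nat.le_induction with
    | base => rfl
    | succ m hm ih =>
      have h1 : 1 ≤ m * τ p.1 := hk.trans (by have := hτ p.1; gcongr)
      have h2 : 1 ≤ ((m + 1 : ℕ) : ℝ) * τ p.1 := h1.trans (by have := hτ p.1; gcongr; simp)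
      rw [hZ, hTend m p h1, hTend (m + 1) p h2, drag_self, ih]
  let N : B → ℕ := fun b => ⌈1 / τ b⌉₊
  have hN : ∀ b, 1 ≤ N b * τ b := fun b => by
    rw [← div_le_iff₀ (hτ b)]
    exact Nat.le_ceil _
  refine ⟨fun p => Z (N p.1) p, ?_, fun b => ?_, fun p i => ?_, fun b hb t => ?_⟩
  · rw [continuous_iff_continuousAt]
    intro p
    -- Near `p` the number of steps is bounded, and extra steps change nothing.
    have h1 : ∀ᶠ q : B × I in 𝓝 p, 1 / τ q.1 < 1 / τ p.1 + 1 := by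
      have : Continuous fun q : B × I => 1 / τ q.1 :=
        continuous_const.div (by fun_prop) fun q => (hτ q.1).ne'
      exact this.continuousAt.eventually_lt_const (by linarith)
    refine (hZc (⌈1 / τ p.1 + 1⌉₊)).continuousAt.congr ?_
    filter_upwards [h1] with q hq
    exact hstab _ _ q (hN q.1) (Nat.ceil_le_ceil hq.le)
  · have : ∀ k, Z k (b, 0) = z₀ b := by
      intro k
      induction k with
      | zero => rfl
      | succ k ih =>
        have h1 : ∀ k, T k (b, 0) = 0 := fun k =>
          Subtype.ext (min_eq_right (mul_nonneg k.cast_nonneg (hτ b).le))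
        rw [hZ, h1, h1, drag_self, ih]
    exact this _
  · have := hZne (N p.1) p i
    rwa [hTend _ _ (hN p.1)] at this
  · have : ∀ k, Z k (b, t) = z₀ b := by
      intro k
      induction k with
      | zero => rfl
      | succ k ih =>
        rw [hZ, hb (T k (b, t)), hb (T (k + 1) (b, t)), drag_self, ih]
    exact this _

/-! ### Reduced words and a free group without center -/

section

/-- Reduced words: lists without equal neighbors. They are the vertices of a regular tree rooted
at the empty word; the head of a list is the last step of the path from the root. -/
def RedWord (α : Type) : Type := {l : List α // l.IsChain (· ≠ ·)}

namespace RedWord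

variable {α : Type} [DecidableEq α]

/-- The empty word. -/
def nil : RedWord α := ⟨[], .nil⟩

/-- Move along the edge with label `k`. -/
def toggleList (k : α) : List α → List α
  | [] => [k]
  | h :: t => if h = k then t else k :: h :: t

theorem isChain_toggleList (k : α) {l : List α} (hl : l.IsChain (· ≠ ·)) :
    (toggleList k l).IsChain (· ≠ ·) := by
  cases l with
  | nil => simp [toggleList]
  | cons h t =>
    simp only [toggleList]
    split_ifs with hk
    · exact hl.tail
    · exact List.isChain_cons_cons.mpr ⟨Ne.symm hk, hl⟩

theorem toggleList_toggleList (k : α) {l : List α} (hl : l.IsChain (· ≠ ·)) :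
    toggleList k (toggleList k l) = l := by
  cases l with
  | nil => simp [toggleList]
  | cons h t =>
    by_cases hk : h = k
    · subst hk
      cases t with
      | nil => simp [toggleList]
      | cons h' t =>
        have := (List.isChain_cons_cons.mp hl).1
        simp [toggleList, this.symm]
    · simp [toggleList, hk]

/-- Moving along the edges with label `k`, as a permutation of the vertices. -/
def toggle (k : α) : Equiv.Perm (RedWord α) :=
  Function.Involutive.toPerm (fun w => ⟨toggleList k w.1, isChain_toggleList k w.2⟩)
    fun w => Subtype.ext (toggleList_toggleList k w.2)

theorem toggle_val (k : α) (w : RedWord α) : (toggle k w).1 = toggleList k w.1 := rfl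

@[simp] theorem toggle_mul_self (k : α) : toggle k * toggle k = 1 :=
  Equiv.ext fun w => Subtype.ext (toggleList_toggleList k w.2)

@[simp] theorem toggle_inv (k : α) : (toggle k)⁻¹ = toggle k :=
  inv_eq_of_mul_eq_one_left (toggle_mul_self k)

theorem toggle_eq_cons {k : α} {w : RedWord α} (h : w.1.head? ≠ some k) :
    (toggle k w).1 = k :: w.1 := by
  rw [toggle_val]
  rcases w with ⟨_ | ⟨a, t⟩, hw⟩
  · rfl
  · simp only [List.head?_cons, ne_eq, Option.some.injEq] at h
    simp [toggleList, h]

theorem odd_length_toggle (k : α) (w : RedWord α) :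
    Odd (toggle k w).1.length ↔ Even w.1.length := by
  rw [toggle_val]
  rcases w with ⟨_ | ⟨a, t⟩, hw⟩
  · simp [toggleList]
  · simp only [toggleList]
    split_ifs <;> simp [parity_simps]

theorem even_length_toggle (k : α) (w : RedWord α) :
    Even (toggle k w).1.length ↔ Odd w.1.length := by
  rw [← Nat.not_odd_iff_even, odd_length_toggle, Nat.not_even_iff_odd]

end RedWord

open RedWord

variable {α : Type} [DecidableEq α]

/-- The group of even products of edge moves; it is a free group. It is generated by the
products of a move with the move `o`. -/
def EvenWordGroup (o : α) : Type :=
  Subgroup.closure (Set.range fun k : α => toggle k * toggle o)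

namespace EvenWordGroup

variable {o : α}

instance : Group (EvenWordGroup o) := inferInstanceAs (Group (Subgroup.closure _))

instance : TopologicalSpace (EvenWordGroup o) := ⊥

instance : DiscreteTopology (EvenWordGroup o) := ⟨rfl⟩

/-- The underlying permutation. -/
def toPerm : EvenWordGroup o →* Equiv.Perm (RedWord α) := Subgroup.subtype _

theorem toPerm_injective : Function.Injective (toPerm (o := o)) := Subtype.val_injective

/-- The generators. -/
def gen (k : α) : EvenWordGroup o :=
  ⟨toggle k * toggle o, Subgroup.subset_closure ⟨k, rfl⟩⟩

theorem toPerm_gen (k : α) : toPerm (gen (o := o) k) = toggle k * toggle o := rfl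

theorem gen_self : gen (o := o) o = 1 := toPerm_injective (by simp [toPerm_gen])

theorem closure_range_gen : Subgroup.closure (Set.range (gen (o := o))) = ⊤ := by
  have h := Subgroup.closure_closure_coe_preimage
    (k := Set.range fun k : α => toggle k * toggle o)
  have hs : Set.range (gen (o := o)) = (Subtype.val ⁻¹' Set.range fun k : α =>
      toggle k * toggle o : Set (Subgroup.closure (Set.range fun k : α => toggle k * toggle o))) := by
    refine Set.ext fun g => ⟨?_, ?_⟩
    · rintro ⟨k, rfl⟩
      exact ⟨k, rfl⟩
    · rintro ⟨k, hk⟩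
      exact ⟨k, Subtype.ext hk⟩
  rw [hs]
  exact h

/-- The vertex reached from the root by the inverse of a group element. -/
def word (g : EvenWordGroup o) : RedWord α := (toPerm g)⁻¹ nil

theorem even_length_word (g : EvenWordGroup o) : Even (word g).1.length := by
  have key : ∀ g : EvenWordGroup o, ∀ w : RedWord α,
      Even (toPerm g w).1.length ↔ Even w.1.length := by
    intro g
    have hg : g ∈ Subgroup.closure (Set.range (gen (o := o))) := by
      rw [closure_range_gen]; trivial
    induction hg using Subgroup.closure_induction with
    | mem x hx =>
      obtain ⟨k, rfl⟩ := hx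
      intro w
      rw [toPerm_gen, Equiv.Perm.mul_apply, even_length_toggle, odd_length_toggle]
    | one => simp
    | mul x y _ _ hx hy => intro w; rw [map_mul, Equiv.Perm.mul_apply, hx, hy]
    | inv x _ hx =>
      intro w
      rw [map_inv, ← hx ((toPerm x)⁻¹ w),
        show toPerm x ((toPerm x)⁻¹ w) = w from Equiv.apply_symm_apply _ w]
  rw [word, ← map_inv, key]
  simp [nil]

theorem word_mul_gen (g : EvenWordGroup o) (k : α) :
    word (g * gen k) = toggle o (toggle k (word g)) := by
  rw [word, map_mul, mul_inv_rev, toPerm_gen, mul_inv_rev, toggle_inv, toggle_inv]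
  rfl

/-- Every element of the group acts as the product of the edge moves spelled by the image of the
root. -/
theorem toPerm_eq_prod (g : EvenWordGroup o) :
    toPerm g = ((toPerm g nil).1.map toggle).prod := by
  have hcons : ∀ (k : α) (w : RedWord α),
      toggle k * (w.1.map toggle).prod = ((toggle k w).1.map toggle).prod := by
    intro k w
    rw [toggle_val]
    rcases w with ⟨_ | ⟨a, t⟩, hw⟩
    · simp [toggleList]
    · simp only [toggleList]
      split_ifs with h
      · subst h
        simp [← mul_assoc]
      · simp
  have key : ∀ g : EvenWordGroup o, ∀ w : RedWord α,
      toPerm g * (w.1.map toggle).prod = ((toPerm g w).1.map toggle).prod := by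
    intro g
    have hg : g ∈ Subgroup.closure (Set.range (gen (o := o))) := by
      rw [closure_range_gen]; trivial
    induction hg using Subgroup.closure_induction with
    | mem x hx =>
      obtain ⟨k, rfl⟩ := hx
      intro w
      rw [toPerm_gen, mul_assoc, hcons, hcons, Equiv.Perm.mul_apply]
    | one => simp
    | mul x y _ _ hx hy => intro w; rw [map_mul, mul_assoc, hy, hx, Equiv.Perm.mul_apply]
    | inv x _ hx =>
      intro w
      rw [map_inv, inv_mul_eq_iff_eq_mul, hx,
        show toPerm x ((toPerm x)⁻¹ w) = w from Equiv.apply_symm_apply _ w]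
  have := key g nil
  simpa [nil] using this

theorem exists_toPerm_eq (j k : α) : ∃ g : EvenWordGroup o, toPerm g = toggle j * toggle k := by
  refine ⟨gen j * (gen k)⁻¹, ?_⟩
  rw [map_mul, map_inv, toPerm_gen, toPerm_gen, mul_inv_rev, toggle_inv, toggle_inv]
  rw [mul_assoc, ← mul_assoc (toggle o), toggle_mul_self, one_mul]

theorem prod_toggle_apply (l : List α) (m : RedWord α) (h : (l ++ m.1).IsChain (· ≠ ·)) :
    (((l.map toggle).prod : Equiv.Perm (RedWord α)) m).1 = l ++ m.1 := by
  induction l with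
  | nil => rfl
  | cons k l ih =>
    have h' : (l ++ m.1).IsChain (· ≠ ·) := by simpa using h.tail
    rw [List.map_cons, List.prod_cons, Equiv.Perm.mul_apply, toggle_eq_cons, ih h']
    · rfl
    · rw [ih h']
      intro h2
      rcases hlm : l ++ m.1 with _ | ⟨a, t⟩
      · simp [hlm] at h2
      · rw [hlm] at h2
        rw [List.cons_append, hlm] at h
        have := (List.isChain_cons_cons.mp h).1
        simp only [List.head?_cons, Option.some.injEq] at h2
        exact this h2.symm

/-- With at least three labels the group has trivial center: compare the normal forms of the two
products of a central element with a suitable two-letter word. -/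
theorem center_eq_bot [Fintype α] (hα : 3 ≤ Fintype.card α) :
    Subgroup.center (EvenWordGroup o) = ⊥ := by
  rw [Subgroup.eq_bot_iff_forall]
  intro z hz
  by_contra hne
  obtain ⟨w, hw⟩ : ∃ w : RedWord α, w = toPerm z nil := ⟨_, rfl⟩
  have hprod := toPerm_eq_prod z
  rw [← hw] at hprod
  have hwne : w.1 ≠ [] := by
    intro h
    rw [h] at hprod
    exact hne (toPerm_injective (by simpa using hprod))
  obtain ⟨p, hp⟩ : ∃ p, w.1.head? = some p := by
    rcases h : w.1 with _ | ⟨p, t⟩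
    · exact absurd h hwne
    · exact ⟨p, rfl⟩
  obtain ⟨q, hq⟩ : ∃ q, w.1.getLast? = some q := by
    rw [List.getLast?_eq_some_getLast hwne]
    exact ⟨_, rfl⟩
  have hex : ∀ a b : α, ∃ c, c ≠ a ∧ c ≠ b := by
    intro a b
    obtain ⟨c, hc⟩ := Finset.exists_mem_notMem_of_card_lt_card (s := {a, b}) (t := Finset.univ)
      (by rw [Finset.card_univ]; exact lt_of_le_of_lt Finset.card_le_two hα)
    simp only [Finset.mem_insert, Finset.mem_singleton, not_or] at hc
    exact ⟨c, hc.2⟩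
  obtain ⟨j, hjp, hjq⟩ := hex p q
  obtain ⟨k, hkp, hkj⟩ := hex p j
  obtain ⟨g, hg⟩ := exists_toPerm_eq (o := o) j k
  have hcomm := congrArg toPerm (Subgroup.mem_center_iff.mp hz g)
  rw [map_mul, map_mul, hg] at hcomm
  have happ := congrArg (fun f : Equiv.Perm (RedWord α) => (f nil).1) hcomm
  simp only [Equiv.Perm.mul_apply, ← hw] at happ
  have hkw : (toggle k w).1 = k :: w.1 :=
    toggle_eq_cons (by rw [hp]; exact fun h => hkp (Option.some.inj h).symm)
  rw [toggle_eq_cons (by rw [hkw]; exact fun h => hkj (Option.some.inj h)), hkw] at happ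
  have hjk : toggle j (toggle k nil) = (⟨[j, k], by simp [hkj.symm]⟩ : RedWord α) := by
    refine Subtype.ext ?_
    rw [toggle_eq_cons]
    · rfl
    · intro h
      exact hkj (Option.some.inj h)
  have hchain : (w.1 ++ [j, k]).IsChain (· ≠ ·) := by
    rw [List.isChain_append]
    refine ⟨w.2, by simp [hkj.symm], ?_⟩
    intro x hx y hy
    rw [hq] at hx
    simp only [Option.mem_def, Option.some.injEq, List.head?_cons] at hx hy
    subst hx hy
    exact hjq.symm
  rw [hjk, hprod, prod_toggle_apply w.1 ⟨[j, k], by simp [hkj.symm]⟩ hchain] at happ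
  have hhead := congrArg List.head? happ
  rw [List.head?_append, hp] at hhead
  simp only [List.head?_cons, Option.some_or, Option.some.injEq] at hhead
  exact hjp hhead

end EvenWordGroup

end

/-! ### Zigzag paths in the plane -/

/-- The tent function: piecewise linear, supported on `[0, 1]`, with value `1` at `1 / 2`. -/
def tent (x : ℝ) : ℝ := max 0 (1 - |2 * x - 1|)

@[fun_prop] theorem continuous_tent : Continuous tent := by unfold tent; fun_prop

theorem tent_of_nonpos {x : ℝ} (hx : x ≤ 0) : tent x = 0 := by
  rw [tent, abs_of_nonpos (by linarith)]
  exact max_eq_left (by linarith)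

theorem tent_of_one_le {x : ℝ} (hx : 1 ≤ x) : tent x = 0 := by
  rw [tent, abs_of_nonneg (by linarith)]
  exact max_eq_left (by linarith)

theorem tent_of_le_half {x : ℝ} (h0 : 0 ≤ x) (hx : x ≤ 1 / 2) : tent x = 2 * x := by
  rw [tent, abs_of_nonpos (by linarith), max_eq_right (by linarith)]
  ring

theorem tent_one_sub (x : ℝ) : tent (1 - x) = tent x := by
  rw [tent, tent, show 2 * (1 - x) - 1 = -(2 * x - 1) by ring, abs_neg]

theorem tent_half : tent (1 / 2) = 1 := by
  rw [tent_of_le_half] <;> norm_num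

namespace TreePath

variable {α : Type}

/-- The horizontal coordinate at time `τ` of the zigzag spelled by a word: during the time
interval `[m, m + 1]` it moves from `0` to `c k` and back, `k` being the `m`-th letter. -/
def zigzag (c : α → ℝ) : List α → ℝ → ℝ
  | [], _ => 0
  | k :: v, τ => zigzag c v τ + c k * tent (τ - v.length)

@[fun_prop] theorem continuous_zigzag (c : α → ℝ) (v : List α) : Continuous (zigzag c v) := by
  induction v with
  | nil => exact continuous_const
  | cons k v ih => simp only [zigzag]; fun_prop

theorem zigzag_of_nonpos (c : α → ℝ) (v : List α) {τ : ℝ} (hτ : τ ≤ 0) : zigzag c v τ = 0 := by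
  induction v with
  | nil => rfl
  | cons k v ih =>
    have : (0 : ℝ) ≤ v.length := Nat.cast_nonneg _
    rw [zigzag, ih, tent_of_nonpos (by linarith)]
    ring

theorem zigzag_of_length_le (c : α → ℝ) (v : List α) {τ : ℝ} (hτ : v.length ≤ τ) :
    zigzag c v τ = 0 := by
  induction v with
  | nil => rfl
  | cons k v ih =>
    rw [List.length_cons, Nat.cast_succ] at hτ
    rw [zigzag, ih (by linarith), tent_of_one_le (by linarith)]
    ring

theorem zigzag_half (c : α → ℝ) (v : List α) {m : ℕ} (hm : m < v.length) :
    ∃ k, zigzag c v (m + 1 / 2) = c k := by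
  induction v with
  | nil => simp at hm
  | cons k v ih =>
    rw [List.length_cons, Nat.lt_succ_iff_lt_or_eq] at hm
    rcases hm with hm | rfl
    · obtain ⟨j, hj⟩ := ih hm
      refine ⟨j, ?_⟩
      have : (m : ℝ) + 1 ≤ v.length := by exact_mod_cast hm
      rw [zigzag, hj, tent_of_nonpos (by linarith)]
      ring
    · refine ⟨k, ?_⟩
      rw [zigzag, zigzag_of_length_le c v (by linarith), add_sub_cancel_left, tent_half]
      ring

variable [DecidableEq α] [Fintype α]

/-- The distance from the root of the point reached from the vertex `v` by moving by `t k` along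
the edge with label `k`; at most one of the numbers `t k` is nonzero. -/
def height (v : List α) (t : α → ℝ) : ℝ :=
  v.length + ∑ k, if v.head? = some k then -t k else t k

/-- The horizontal coordinate at time `τ` of the zigzag along the path from the root to the point
reached from the vertex `v` by moving by `t k` along the edge with label `k`. -/
def abscissa (c : α → ℝ) (v : List α) (t : α → ℝ) (τ : ℝ) : ℝ :=
  zigzag c v τ + ∑ k, if v.head? = some k then 0 else c k * tent (min (τ - v.length) (t k))

/-- The plane path that follows the path in the tree from the root to a given point: the vertices
of even height are sent to `i`, those of odd height to `-i`, and the edges with label `k` to arcs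
crossing the real axis in `c k`. -/
def planePath (c : α → ℝ) (v : List α) (t : α → ℝ) (s : ℝ) : ℂ :=
  ⟨abscissa c v t (s * height v t), Real.cos (Real.pi * (s * height v t))⟩

theorem continuous_planePath (c : α → ℝ) (v : List α) :
    Continuous fun p : (α → ℝ) × ℝ => planePath c v p.1 p.2 := by
  have h : Continuous fun p : (α → ℝ) × ℝ => height v p.1 := by
    unfold height
    refine continuous_const.add (continuous_finsetSum _ fun k _ => ?_)
    split_ifs <;> fun_prop
  have h1 : Continuous fun p : (α → ℝ) × ℝ => abscissa c v p.1 (p.2 * height v p.1) := by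
    unfold abscissa
    refine ((continuous_zigzag c v).comp (by fun_prop)).add
      (continuous_finsetSum _ fun k _ => ?_)
    split_ifs
    · exact continuous_const
    · exact continuous_const.mul (continuous_tent.comp (by fun_prop))
  exact Complex.equivRealProdCLM.symm.continuous.comp
    (h1.prodMk (Real.continuous_cos.comp (by fun_prop)))

theorem planePath_zero (c : α → ℝ) (v : List α) (t : α → ℝ) : planePath c v t 0 = Complex.I := by
  have : ∀ k, tent (min (-(v.length : ℝ)) (t k)) = 0 := fun k =>
    tent_of_nonpos ((min_le_left _ _).trans (by simp))
  apply Complex.ext <;> simp [planePath, abscissa, zigzag_of_nonpos, this]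

variable {c : α → ℝ} {v : List α} {t : α → ℝ} {k : α}

theorem height_of_head_eq (ht : ∀ j, j ≠ k → t j = 0) (hv : v.head? = some k) :
    height v t = v.length - t k := by
  rw [height, Finset.sum_eq_single k]
  · simp [hv, sub_eq_add_neg]
  · intro j _ hj
    simp [ht j hj]
  · simp

theorem height_of_head_ne (ht : ∀ j, j ≠ k → t j = 0) (hv : v.head? ≠ some k) :
    height v t = v.length + t k := by
  rw [height, Finset.sum_eq_single k]
  · simp [hv]
  · intro j _ hj
    simp [ht j hj]
  · simp

theorem abscissa_of_head_eq (ht : ∀ j, j ≠ k → t j = 0) (hv : v.head? = some k) (τ : ℝ) :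
    abscissa c v t τ = zigzag c v τ := by
  rw [abscissa, Finset.sum_eq_zero, add_zero]
  intro j _
  split_ifs with h
  · rfl
  · have hj : j ≠ k := fun hj => h (hj ▸ hv)
    rw [ht j hj, tent_of_nonpos (min_le_right _ _), mul_zero]

theorem abscissa_of_head_ne (ht : ∀ j, j ≠ k → t j = 0) (hv : v.head? ≠ some k) (τ : ℝ) :
    abscissa c v t τ = zigzag c v τ + c k * tent (min (τ - v.length) (t k)) := by
  rw [abscissa, Finset.sum_eq_single k]
  · simp [hv]
  · intro j _ hj
    split_ifs with h
    · rfl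
    · rw [ht j hj, tent_of_nonpos (min_le_right _ _), mul_zero]
  · simp

theorem planePath_cons {t' : α → ℝ} (ht : ∀ j, j ≠ k → t j = 0) (ht' : ∀ j, j ≠ k → t' j = 0)
    (h0 : 0 ≤ t k) (h1 : t k + t' k = 1) (hv : v.head? ≠ some k) {s : ℝ}
    (hs : s ≤ 1) : planePath c v t s = planePath c (k :: v) t' s := by
  have hh : height (k :: v) t' = height v t := by
    rw [height_of_head_eq ht' rfl, height_of_head_ne ht hv, List.length_cons, Nat.cast_succ]
    linarith
  have hpos : 0 ≤ height v t := by
    rw [height_of_head_ne ht hv]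
    positivity
  rw [planePath, planePath, hh, abscissa_of_head_eq ht' rfl, abscissa_of_head_ne ht hv, zigzag,
    min_eq_left]
  have := mul_le_of_le_one_left hpos hs
  rw [height_of_head_ne ht hv] at this ⊢
  linarith

/-- The two descriptions of a point in the interior of an edge give the same path. -/
theorem planePath_toggle {w : RedWord α} {t' : α → ℝ} (ht : ∀ j, j ≠ k → t j = 0)
    (ht' : ∀ j, j ≠ k → t' j = 0) (h0 : 0 ≤ t k) (h0' : 0 ≤ t' k) (h1 : t k + t' k = 1) {s : ℝ}
    (hs : s ≤ 1) : planePath c w.1 t s = planePath c (RedWord.toggle k w).1 t' s := by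
  by_cases hv : w.1.head? = some k
  · have hw : RedWord.toggle k (RedWord.toggle k w) = w := by
      rw [← Equiv.Perm.mul_apply, RedWord.toggle_mul_self, Equiv.Perm.one_apply]
    have hv' : (RedWord.toggle k w).1.head? ≠ some k := by
      intro h
      rw [RedWord.toggle_val] at h
      obtain ⟨l, hl⟩ := w
      rcases l with _ | ⟨a, _ | ⟨b, l⟩⟩
      · simp at hv
      · simp only [List.head?_cons, Option.some.injEq] at hv
        simp [RedWord.toggleList, hv] at h
      · simp only [List.head?_cons, Option.some.injEq] at hv
        simp only [RedWord.toggleList, hv, if_true, List.head?_cons, Option.some.injEq] at h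
        exact (List.isChain_cons_cons.mp hl).1 (hv.trans h.symm)
    rw [planePath_cons ht' ht h0' (by linarith) hv' hs, ← RedWord.toggle_eq_cons hv', hw]
  · rw [RedWord.toggle_eq_cons hv, planePath_cons ht ht' h0 h1 hv hs]

theorem planePath_one (ht : ∀ j, j ≠ k → t j = 0) (h0 : 0 ≤ t k) (h1 : t k ≤ 1) :
    planePath c v t 1 =
      ⟨∑ j, c j * tent (t j), (-1) ^ v.length * Real.cos (Real.pi * ∑ j, t j)⟩ := by
  have hsum : ∑ j, c j * tent (t j) = c k * tent (t k) :=
    Finset.sum_eq_single k (fun j _ hj => by rw [ht j hj, tent_of_nonpos le_rfl, mul_zero])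
      (by simp)
  have hsum' : ∑ j, t j = t k := Finset.sum_eq_single k (fun j _ hj => ht j hj) (by simp)
  rw [hsum, hsum', planePath, one_mul]
  by_cases hv : v.head? = some k
  · rw [abscissa_of_head_eq ht hv, height_of_head_eq ht hv]
    obtain ⟨v', rfl⟩ : ∃ v', v = k :: v' := by
      rcases v with _ | ⟨a, v'⟩
      · simp at hv
      · simp only [List.head?_cons, Option.some.injEq] at hv
        exact ⟨v', by rw [hv]⟩
    have hlen : ((k :: v').length : ℝ) = v'.length + 1 := by simp
    apply Complex.ext
    · change zigzag c v' _ + _ = _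
      rw [zigzag_of_length_le c v' (by rw [hlen]; linarith), hlen,
        show (v'.length : ℝ) + 1 - t k - v'.length = 1 - t k by ring, tent_one_sub, zero_add]
    · change Real.cos _ = _
      rw [mul_sub, mul_comm Real.pi ((k :: v').length : ℝ), Real.cos_nat_mul_pi_sub]
  · rw [abscissa_of_head_ne ht hv, height_of_head_ne ht hv]
    apply Complex.ext
    · change zigzag c v _ + _ = _
      rw [zigzag_of_length_le c v (by linarith), add_sub_cancel_left, min_self, zero_add]
    · change Real.cos _ = _
      rw [mul_add, mul_comm Real.pi (v.length : ℝ), add_comm, Real.cos_add_nat_mul_pi]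

/-- The path crosses the real axis only in the points `c j`. -/
theorem exists_planePath_re (ht : ∀ j, j ≠ k → t j = 0) (h0 : 0 ≤ t k) (h1 : t k ≤ 1) {s : ℝ}
    (hs0 : 0 ≤ s) (hs : s ≤ 1) (him : (planePath c v t s).im = 0) :
    ∃ j, (planePath c v t s).re = c j := by
  change Real.cos _ = 0 at him
  change ∃ j, abscissa c v t _ = c j
  have hpos : 0 ≤ height v t := by
    by_cases hv : v.head? = some k
    · rw [height_of_head_eq ht hv]
      have : 1 ≤ v.length := by
        rcases v with _ | ⟨a, v'⟩
        · simp at hv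
        · simp
      have : (1 : ℝ) ≤ v.length := by exact_mod_cast this
      linarith
    · rw [height_of_head_ne ht hv]
      positivity
  obtain ⟨m, hm⟩ := Real.cos_eq_zero_iff.mp him
  have hτ : s * height v t = m + 1 / 2 := by
    have := mul_left_cancel₀ Real.pi_ne_zero (hm.trans (by ring :
      (2 * (m : ℝ) + 1) * Real.pi / 2 = Real.pi * (m + 1 / 2)))
    exact this
  have hm0 : 0 ≤ m := by
    have h2 : 0 ≤ s * height v t := mul_nonneg hs0 hpos
    rw [hτ] at h2
    have : (-1 : ℝ) < m := by linarith
    have : (-1 : ℤ) < m := by exact_mod_cast this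
    omega
  lift m to ℕ using hm0
  rw [Int.cast_natCast] at hτ
  have hle := mul_le_of_le_one_left hpos hs
  rw [hτ] at hle ⊢
  by_cases hv : v.head? = some k
  · rw [height_of_head_eq ht hv] at hle
    rw [abscissa_of_head_eq ht hv]
    apply zigzag_half
    have : (m : ℝ) < v.length := by linarith
    exact_mod_cast this
  · rw [height_of_head_ne ht hv] at hle
    rw [abscissa_of_head_ne ht hv]
    rcases lt_or_ge m v.length with hlt | hge
    · obtain ⟨j, hj⟩ := zigzag_half c v hlt
      refine ⟨j, ?_⟩
      have : (m : ℝ) + 1 ≤ v.length := by exact_mod_cast hlt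
      rw [hj, tent_of_nonpos ((min_le_left _ _).trans (by linarith)), mul_zero, add_zero]
    · have hmv : m = v.length := by
        have : (m : ℝ) < v.length + 1 := by linarith
        have : m < v.length + 1 := by exact_mod_cast this
        omega
      refine ⟨k, ?_⟩
      rw [hmv] at hle ⊢
      rw [zigzag_of_length_le c v (by linarith), add_sub_cancel_left, min_eq_left (by linarith),
        tent_half]
      ring

end TreePath

/-! ### Charts of the punctured plane -/

/-- The plane with the points `0, …, n - 1` removed. -/
abbrev PuncturedPlane (n : ℕ) : Type := {z : ℂ // ∀ i : Fin n, z ≠ ((i : ℕ) : ℂ)}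

namespace PuncturedPlane

variable {n : ℕ}

/-- A bump function on the line that is positive exactly on the `k`-th of the `n + 1` intervals
into which the points `0, …, n - 1` divide it. -/
def gap (k : Fin (n + 1)) (x : ℝ) : ℝ :=
  max 0 (min (if (k : ℕ) = 0 then 1 else x - (k - 1)) (if (k : ℕ) = n then 1 else k - x))

@[fun_prop] theorem continuous_gap (k : Fin (n + 1)) : Continuous (gap k) := by
  unfold gap
  split_ifs <;> fun_prop

theorem gap_nonneg (k : Fin (n + 1)) (x : ℝ) : 0 ≤ gap k x := le_max_left _ _

theorem gap_pos_iff {k : Fin (n + 1)} {x : ℝ} :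
    0 < gap k x ↔ ((k : ℕ) ≠ 0 → (k : ℝ) - 1 < x) ∧ ((k : ℕ) ≠ n → x < k) := by
  rw [gap, lt_max_iff, lt_min_iff]
  simp only [lt_irrefl, false_or]
  refine and_congr ?_ ?_ <;> split_ifs with h <;> simp [h]

theorem gap_eq_zero_of_lt {j k : Fin (n + 1)} (hjk : j < k) {x : ℝ} (hj : 0 < gap j x) :
    ¬ 0 < gap k x := by
  intro hk
  rw [gap_pos_iff] at hj hk
  have h1 : (j : ℕ) < k := hjk
  have h2 := hj.2 (by omega)
  have h3 := hk.1 (by omega)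
  have h4 : ((j : ℕ) : ℝ) + 1 ≤ (k : ℕ) := by exact_mod_cast h1
  linarith

theorem eq_of_gap_pos {j k : Fin (n + 1)} {x : ℝ} (hj : 0 < gap j x) (hk : 0 < gap k x) :
    j = k := by
  rcases lt_trichotomy j k with h | h | h
  · exact absurd hk (gap_eq_zero_of_lt h hj)
  · exact h
  · exact absurd hj (gap_eq_zero_of_lt h hk)

theorem gap_eq_zero {j k : Fin (n + 1)} {x : ℝ} (hk : 0 < gap k x) (hj : j ≠ k) : gap j x = 0 :=
  le_antisymm (not_lt.mp fun h => hj (eq_of_gap_pos h hk)) (gap_nonneg j x)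

theorem gap_natCast (k : Fin (n + 1)) (i : Fin n) : gap k ((i : ℕ) : ℝ) = 0 := by
  refine le_antisymm (not_lt.mp fun h => ?_) (gap_nonneg _ _)
  rw [gap_pos_iff] at h
  have h1 : (k : ℕ) ≤ i := by
    by_cases h0 : (k : ℕ) = 0
    · omega
    · have : ((k : ℕ) : ℝ) < (i : ℕ) + 1 := by linarith [h.1 h0]
      have : (k : ℕ) < i + 1 := by exact_mod_cast this
      omega
  have h2 := h.2 (by omega)
  have : (i : ℕ) < k := by exact_mod_cast h2
  omega

/-- The index of the interval containing a point. -/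
def interval (n : ℕ) (x : ℝ) : Fin (n + 1) := ⟨min n ⌈x⌉₊, by omega⟩

theorem gap_interval_pos {x : ℝ} (hx : ∀ i : Fin n, x ≠ (i : ℕ)) : 0 < gap (interval n x) x := by
  rw [gap_pos_iff]
  constructor
  · intro h0
    have h1 : (interval n x : ℕ) - 1 < ⌈x⌉₊ := by
      change min n ⌈x⌉₊ - 1 < _
      change min n ⌈x⌉₊ ≠ 0 at h0
      omega
    rw [Nat.lt_ceil] at h1
    rwa [Nat.cast_sub (Nat.one_le_iff_ne_zero.mpr h0), Nat.cast_one] at h1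
  · intro hn
    have h1 : (interval n x : ℕ) = ⌈x⌉₊ := by
      change min n ⌈x⌉₊ = _
      change min n ⌈x⌉₊ ≠ n at hn
      omega
    refine lt_of_le_of_ne (h1 ▸ Nat.le_ceil x) (hx ⟨interval n x, ?_⟩)
    exact lt_of_le_of_ne (Nat.le_of_lt_succ (interval n x).2) hn

theorem interval_eq {k : Fin (n + 1)} {x : ℝ} (hk : 0 < gap k x) : interval n x = k := by
  refine eq_of_gap_pos (gap_interval_pos fun i hi => ?_) hk
  rw [hi, gap_natCast] at hk
  exact lt_irrefl _ hk

/-- A chosen point of each interval. -/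
def mid (k : Fin (n + 1)) : ℝ := k - 1 / 2

theorem gap_mid_pos (k : Fin (n + 1)) : 0 < gap k (mid k) := by
  rw [gap_pos_iff, mid]
  constructor <;> intro <;> linarith

/-- The sum of the bump functions. It vanishes exactly in the points `0, …, n - 1`. -/
def gaps (n : ℕ) (x : ℝ) : ℝ := ∑ k : Fin (n + 1), gap k x

@[fun_prop] theorem continuous_gaps : Continuous (gaps n) := by unfold gaps; fun_prop

theorem gaps_nonneg (x : ℝ) : 0 ≤ gaps n x := Finset.sum_nonneg fun k _ => gap_nonneg k x

theorem gaps_eq {k : Fin (n + 1)} {x : ℝ} (hk : 0 < gap k x) : gaps n x = gap k x :=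
  Finset.sum_eq_single k (fun _ _ hj => gap_eq_zero hk hj) (by simp)

theorem gap_le_gaps (k : Fin (n + 1)) (x : ℝ) : gap k x ≤ gaps n x :=
  Finset.single_le_sum (f := fun k => gap k x) (fun k _ => gap_nonneg k x) (Finset.mem_univ k)

theorem gaps_natCast (i : Fin n) : gaps n ((i : ℕ) : ℝ) = 0 :=
  Finset.sum_eq_zero fun k _ => gap_natCast k i

theorem exists_gap_pos {x : ℝ} (h : 0 < gaps n x) : ∃ k : Fin (n + 1), 0 < gap k x := by
  by_contra hne
  push Not at hne
  exact absurd h (not_lt.mpr (Finset.sum_nonpos fun k _ => hne k))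

/-- The signs of the two charts: `true` is the complement of the downward rays from the
punctures, `false` that of the upward rays. -/
def sgn : Bool → ℝ
  | true => 1
  | false => -1

/-- A function on the plane that is positive exactly on one of the two charts. -/
def chartFun (n : ℕ) (b : Bool) (z : ℂ) : ℝ := gaps n z.re + max 0 (sgn b * z.im)

/-- A function on the plane that is positive exactly on the punctured plane. -/
def size (n : ℕ) (z : ℂ) : ℝ := gaps n z.re + |z.im|

@[fun_prop] theorem continuous_chartFun (b : Bool) : Continuous (chartFun n b) := by
  unfold chartFun; fun_prop

@[fun_prop] theorem continuous_size : Continuous (size n) := by unfold size; fun_prop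

theorem chartFun_le_size (b : Bool) (z : ℂ) : chartFun n b z ≤ size n z := by
  refine add_le_add le_rfl (max_le (abs_nonneg _) ?_)
  cases b
  · simpa [sgn] using neg_le_abs z.im
  · simpa [sgn] using le_abs_self z.im

theorem gaps_le_chartFun (b : Bool) (z : ℂ) : gaps n z.re ≤ chartFun n b z :=
  le_add_of_nonneg_right (le_max_left _ _)

theorem size_pos_iff {z : ℂ} : 0 < size n z ↔ ∀ i : Fin n, z ≠ ((i : ℕ) : ℂ) := by
  constructor
  · rintro h i rfl
    rw [size, Complex.natCast_re, gaps_natCast] at h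
    simp at h
  · intro h
    by_cases hz : z.im = 0
    · have : 0 < gap (interval n z.re) z.re :=
        gap_interval_pos fun i hi => h i (Complex.ext (by simp [hi]) (by simp [hz]))
      exact add_pos_of_pos_of_nonneg (this.trans_le (gap_le_gaps _ _)) (abs_nonneg _)
    · exact add_pos_of_nonneg_of_pos (gaps_nonneg _) (abs_pos.mpr hz)

theorem exists_chartFun_pos {z : ℂ} (h : 0 < size n z) : ∃ b, 0 < chartFun n b z := by
  rcases le_total 0 z.im with hz | hz
  · refine ⟨true, h.trans_le ?_⟩
    rw [chartFun, size, abs_of_nonneg hz]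
    simp [sgn]
  · refine ⟨false, h.trans_le ?_⟩
    rw [chartFun, size, abs_of_nonpos hz]
    simp [sgn]

theorem gaps_pos {z : ℂ} {b b' : Bool} (hb : b ≠ b') (h : 0 < chartFun n b z)
    (h' : 0 < chartFun n b' z) : 0 < gaps n z.re := by
  rw [chartFun] at h h'
  rcases le_total 0 z.im with hz | hz
  · cases b <;> cases b' <;> simp [sgn, hz] at h h' hb ⊢ <;> assumption
  · cases b <;> cases b' <;> simp [sgn, hz] at h h' hb ⊢ <;> assumption

/-- In the chart `b`, the distance in the tree from the vertex of a sheet of that chart in the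
direction of the label `k`: going through the `k`-th gap it increases from `0` to `1`. -/
def depth (b : Bool) (z : ℂ) (k : Fin (n + 1)) : ℝ :=
  gap k z.re * (1 / chartFun n b z - 1 / 2 * (1 / size n z))

theorem continuousOn_depth (b : Bool) :
    ContinuousOn (depth (n := n) b) {z | 0 < chartFun n b z} := by
  rw [continuousOn_pi]
  intro k
  unfold depth
  have h1 : ∀ z ∈ {z | 0 < chartFun n b z}, chartFun n b z ≠ 0 := fun z hz => ne_of_gt hz
  have h2 : ∀ z ∈ {z | 0 < chartFun n b z}, size n z ≠ 0 := fun z hz =>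
    ne_of_gt (lt_of_lt_of_le hz (chartFun_le_size b z))
  fun_prop (disch := assumption)

theorem depth_eq_zero {b : Bool} {z : ℂ} {j k : Fin (n + 1)} (hk : 0 < gap k z.re) (hj : j ≠ k) :
    depth b z j = 0 := by
  rw [depth, gap_eq_zero hk hj, zero_mul]

theorem depth_eq_zero' {b : Bool} {z : ℂ} (k : Fin (n + 1)) (h : ¬ 0 < gaps n z.re) :
    depth b z k = 0 := by
  have : gap k z.re = 0 := le_antisymm ((gap_le_gaps _ _).trans (not_lt.mp h)) (gap_nonneg _ _)
  rw [depth, this, zero_mul]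

/-- At most one of the depths is nonzero. -/
theorem exists_depth_eq_zero (b : Bool) (z : ℂ) :
    ∃ k : Fin (n + 1), ∀ j, j ≠ k → depth b z j = 0 := by
  by_cases h : 0 < gaps n z.re
  · obtain ⟨k, hk⟩ := exists_gap_pos h
    exact ⟨k, fun j hj => depth_eq_zero hk hj⟩
  · exact ⟨0, fun j _ => depth_eq_zero' j h⟩

variable {b : Bool} {z : ℂ}

theorem depth_nonneg (h : 0 < chartFun n b z) (k : Fin (n + 1)) : 0 ≤ depth b z k := by
  have h1 : 1 / size n z ≤ 1 / chartFun n b z :=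
    one_div_le_one_div_of_le h (chartFun_le_size b z)
  have h2 : 0 < 1 / size n z := one_div_pos.mpr (h.trans_le (chartFun_le_size b z))
  exact mul_nonneg (gap_nonneg _ _) (by linarith)

theorem depth_le_one (h : 0 < chartFun n b z) (k : Fin (n + 1)) : depth b z k ≤ 1 := by
  have h2 : 0 < 1 / size n z := one_div_pos.mpr (h.trans_le (chartFun_le_size b z))
  have h3 : gap k z.re ≤ chartFun n b z := (gap_le_gaps _ _).trans (gaps_le_chartFun b z)
  calc depth b z k ≤ gap k z.re * (1 / chartFun n b z) :=
        mul_le_mul_of_nonneg_left (by linarith) (gap_nonneg _ _)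
    _ ≤ 1 := by rw [mul_one_div]; exact div_le_one_of_le₀ h3 h.le

/-- On the side of the real axis of the chart. -/
theorem depth_of_nonneg (hz : 0 ≤ sgn b * z.im) (k : Fin (n + 1)) :
    depth b z k = 1 / 2 * (gap k z.re / size n z) := by
  have : chartFun n b z = size n z := by
    rw [chartFun, size, max_eq_right hz, ← abs_of_nonneg hz, abs_mul]
    cases b <;> simp [sgn]
  rw [depth, this]
  ring

/-- On the other side of the real axis. -/
theorem depth_of_nonpos (hz : sgn b * z.im ≤ 0) {k : Fin (n + 1)} (hk : 0 < gap k z.re) :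
    depth b z k = 1 - 1 / 2 * (gap k z.re / size n z) := by
  rw [depth, chartFun, max_eq_left hz, add_zero, gaps_eq hk, mul_sub,
    mul_one_div_cancel hk.ne']
  ring

theorem depth_add_depth {b b' : Bool} (hb : b ≠ b') {k : Fin (n + 1)} (hk : 0 < gap k z.re) :
    depth b z k + depth b' z k = 1 := by
  have hs : sgn b' = -sgn b := by cases b <;> cases b' <;> simp_all [sgn]
  rcases le_total 0 (sgn b * z.im) with hz | hz
  · rw [depth_of_nonneg hz, depth_of_nonpos (by rw [hs]; linarith) hk]
    ring
  · rw [depth_of_nonpos hz hk, depth_of_nonneg (by rw [hs]; linarith)]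
    ring

theorem gap_div_size_le_one (z : ℂ) (k : Fin (n + 1)) : gap k z.re / size n z ≤ 1 := by
  refine div_le_one_of_le₀ ((gap_le_gaps _ _).trans ?_) ?_
  · exact le_add_of_nonneg_right (abs_nonneg _)
  · exact add_nonneg (gaps_nonneg _) (abs_nonneg _)

theorem tent_depth (k : Fin (n + 1)) :
    tent (depth b z k) = gap k z.re / size n z := by
  have h0 : 0 ≤ gap k z.re / size n z :=
    div_nonneg (gap_nonneg _ _) (add_nonneg (gaps_nonneg _) (abs_nonneg _))
  have h1 := gap_div_size_le_one z k
  rcases le_total 0 (sgn b * z.im) with hz | hz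
  · rw [depth_of_nonneg hz, tent_of_le_half (by linarith) (by linarith)]
    ring
  · rcases (gap_nonneg k z.re).eq_or_lt with hk | hk
    · rw [depth, ← hk, zero_mul, zero_div, tent_of_nonpos le_rfl]
    · rw [depth_of_nonpos hz hk, tent_one_sub, tent_of_le_half (by linarith) (by linarith)]
      ring

theorem sum_depth (h : 0 < chartFun n b z) :
    ∑ k : Fin (n + 1), depth b z k = 1 / 2 * (1 - sgn b * (z.im / size n z)) := by
  have hs : 0 < size n z := h.trans_le (chartFun_le_size b z)
  have habs : |z.im| = |sgn b * z.im| := by rw [abs_mul]; cases b <;> simp [sgn]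
  have hsum : ∑ k : Fin (n + 1), depth b z k =
      gaps n z.re * (1 / chartFun n b z - 1 / 2 * (1 / size n z)) := by
    simp only [depth, gaps, Finset.sum_mul]
  rw [hsum]
  rcases le_total 0 (sgn b * z.im) with hz | hz
  · have hc : chartFun n b z = size n z := by
      rw [chartFun, size, max_eq_right hz, habs, abs_of_nonneg hz]
    have hg : gaps n z.re = size n z - sgn b * z.im := by
      rw [size, habs, abs_of_nonneg hz]; ring
    rw [hc, hg]
    field_simp
    ring
  · have hc : chartFun n b z = gaps n z.re := by rw [chartFun, max_eq_left hz, add_zero]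
    rw [hc] at h ⊢
    have hg : gaps n z.re = size n z + sgn b * z.im := by
      rw [size, habs, abs_of_nonpos hz]; ring
    rw [mul_sub, mul_one_div_cancel h.ne', hg]
    field_simp
    ring

/-- The endpoint of the zigzag attached to a point: a map of the punctured plane to itself that
preserves each of the two half planes and collapses each interval of the real axis to its chosen
point. -/
def squash (n : ℕ) (z : ℂ) : ℂ :=
  ⟨∑ k : Fin (n + 1), mid k * (gap k z.re / size n z),
    Real.sin (Real.pi / 2 * (z.im / size n z))⟩

theorem planePath_depth_one (h : 0 < chartFun n b z) {v : List (Fin (n + 1))}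
    (hv : (-1) ^ v.length = sgn b) : TreePath.planePath mid v (depth b z) 1 = squash n z := by
  obtain ⟨k, hk⟩ := exists_depth_eq_zero (n := n) b z
  rw [TreePath.planePath_one hk (depth_nonneg h k) (depth_le_one h k), squash]
  apply Complex.ext
  · simp only [tent_depth]
  · change _ * _ = Real.sin _
    rw [hv, sum_depth h, show Real.pi * (1 / 2 * (1 - sgn b * (z.im / size n z))) =
      Real.pi / 2 - sgn b * (Real.pi / 2 * (z.im / size n z)) by ring, Real.cos_pi_div_two_sub]
    cases b <;> simp [sgn]

theorem planePath_mem (h : 0 < chartFun n b z) (v : List (Fin (n + 1))) {s : ℝ} (hs0 : 0 ≤ s)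
    (hs : s ≤ 1) : 0 < size n (TreePath.planePath mid v (depth b z) s) := by
  by_cases him : (TreePath.planePath mid v (depth b z) s).im = 0
  · obtain ⟨k, hk⟩ := exists_depth_eq_zero (n := n) b z
    obtain ⟨j, hj⟩ := TreePath.exists_planePath_re (c := mid) (v := v) hk (depth_nonneg h k)
      (depth_le_one h k) hs0 hs him
    rw [size, hj]
    exact add_pos_of_pos_of_nonneg ((gap_mid_pos j).trans_le (gap_le_gaps _ _)) (abs_nonneg _)
  · exact add_pos_of_nonneg_of_pos (gaps_nonneg _) (abs_pos.mpr him)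

theorem sign_sin_squash (hz : z.im ≠ 0) : 0 < z.im * (squash n z).im := by
  change 0 < z.im * Real.sin _
  have habs : 0 < |z.im| := abs_pos.mpr hz
  have hs : 0 < size n z := add_pos_of_nonneg_of_pos (gaps_nonneg _) habs
  have h1 : |z.im / size n z| ≤ 1 := by
    rw [abs_div, abs_of_pos hs]
    exact div_le_one_of_le₀ (le_add_of_nonneg_left (gaps_nonneg _)) hs.le
  rw [abs_le] at h1
  have hpi := Real.pi_pos
  rcases lt_or_gt_of_ne hz with h | h
  · have h2 : z.im / size n z < 0 := div_neg_of_neg_of_pos h hs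
    exact mul_pos_of_neg_of_neg h (Real.sin_neg_of_neg_of_neg_pi_lt (by nlinarith) (by nlinarith))
  · have h2 : 0 < z.im / size n z := div_pos h hs
    exact mul_pos h (Real.sin_pos_of_pos_of_lt_pi (by positivity) (by nlinarith))

/-- The segment from a point to its image under `squash` avoids the punctures. -/
theorem segment_squash_mem (hz : 0 < size n z) {s : ℝ} (hs0 : 0 ≤ s) (hs : s ≤ 1) :
    0 < size n ((1 - s : ℝ) • z + s • squash n z) := by
  have hre : ((1 - s : ℝ) • z + s • squash n z).re = (1 - s) * z.re + s * (squash n z).re := by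
    simp
  have him : ((1 - s : ℝ) • z + s • squash n z).im = (1 - s) * z.im + s * (squash n z).im := by
    simp
  rw [size, hre, him]
  by_cases hi : z.im = 0
  · have hg : 0 < gaps n z.re := by simpa [size, hi] using hz
    obtain ⟨k, hk⟩ := exists_gap_pos hg
    have hsq : (squash n z).re = mid k := by
      change ∑ k : Fin (n + 1), mid k * (gap k z.re / size n z) = _
      rw [Finset.sum_eq_single k]
      · rw [size, hi, abs_zero, add_zero, gaps_eq hk, div_self hk.ne', mul_one]
      · intro j _ hj
        rw [gap_eq_zero hk hj, zero_div, mul_zero]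
      · simp
    refine add_pos_of_pos_of_nonneg (lt_of_lt_of_le ?_ (gap_le_gaps k _)) (abs_nonneg _)
    have hm := gap_mid_pos k
    rw [hsq]
    rw [gap_pos_iff] at hk hm ⊢
    constructor
    · intro h
      exact convex_Ioi (k - 1 : ℝ) (hk.1 h) (hm.1 h) (sub_nonneg.mpr hs) hs0 (by ring)
    · intro h
      exact convex_Iio (k : ℝ) (hk.2 h) (hm.2 h) (sub_nonneg.mpr hs) hs0 (by ring)
  · refine add_pos_of_nonneg_of_pos (gaps_nonneg _) (abs_pos.mpr fun h0 => ?_)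
    have h1 := sign_sin_squash (n := n) hi
    have h2 : 0 < z.im * z.im := mul_self_pos.mpr hi
    have h3 : (1 - s) * (z.im * z.im) + s * (z.im * (squash n z).im) = 0 := by
      linear_combination z.im * h0
    rcases hs0.eq_or_lt with rfl | hs0
    · simp at h3
      exact hi h3
    · nlinarith [mul_pos hs0 h1, mul_nonneg (sub_nonneg.mpr hs) h2.le]

theorem continuousOn_squash : ContinuousOn (squash n) {z | 0 < size n z} := by
  have h2 : ∀ z ∈ {z | 0 < size n z}, size n z ≠ 0 := fun z hz => ne_of_gt hz
  have h3 : ContinuousOn (fun z => ∑ k : Fin (n + 1), mid k * (gap k z.re / size n z))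
      {z | 0 < size n z} := by
    refine continuousOn_finsetSum _ fun k _ => ?_
    fun_prop (disch := assumption)
  refine Complex.equivRealProdCLM.symm.continuous.comp_continuousOn (h3.prodMk ?_)
  fun_prop (disch := assumption)

end PuncturedPlane

/-! ### The universal covering of the punctured plane -/

theorem Subgroup.center_eq_bot_of_mulEquiv {G H : Type*} [Group G] [Group H] (e : G ≃* H)
    (h : Subgroup.center H = ⊥) : Subgroup.center G = ⊥ := by
  have : Subsingleton (Subgroup.center H) := by rw [h]; infer_instance
  have : Subsingleton (Subgroup.center G) := (Subgroup.centerCongr e).toEquiv.subsingleton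
  exact Subgroup.eq_bot_of_subsingleton _

theorem Subgroup.center_mulOpposite_eq_bot {G : Type*} [Group G]
    (h : Subgroup.center G = ⊥) : Subgroup.center Gᵐᵒᵖ = ⊥ := by
  have : Subsingleton (Subgroup.center G) := by rw [h]; infer_instance
  have : Subsingleton (Subgroup.center Gᵐᵒᵖ) :=
    (Subgroup.centerToMulOpposite (G := G)).symm.toEquiv.subsingleton
  exact Subgroup.eq_bot_of_subsingleton _

namespace PuncturedPlane

variable {n : ℕ}

theorem size_pos (z : PuncturedPlane n) : 0 < size n z.1 := size_pos_iff.mpr z.2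

/-- The deck group of the universal covering of the punctured plane. -/
abbrev Deck (n : ℕ) : Type := EvenWordGroup (0 : Fin (n + 1))

/-- A trivialization of the transition functions: they are `1` on one chart and, on the other
chart, the generator given by the gap. -/
def cocycle (b : Bool) (z : PuncturedPlane n) : Deck n :=
  if b then 1 else EvenWordGroup.gen (interval n z.1.re)

/-- Passing from the upper chart to the lower chart through the `k`-th gap multiplies by the
generator with index `k`. -/
def bundleCore (n : ℕ) : FiberBundleCore Bool (PuncturedPlane n) (Deck n) where
  baseSet b := {z | 0 < chartFun n b z.1}
  isOpen_baseSet b :=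
    isOpen_lt continuous_const ((continuous_chartFun b).comp continuous_subtype_val)
  indexAt z := (exists_chartFun_pos (size_pos z)).choose
  mem_baseSet_at z := (exists_chartFun_pos (size_pos z)).choose_spec
  coordChange i j z g := g * ((cocycle i z)⁻¹ * cocycle j z)
  coordChange_self i z _ g := by simp
  coordChange_comp i j k z _ g := by simp [mul_assoc]
  continuousOn_coordChange i j := by
    rintro ⟨z, g⟩ ⟨⟨hi, hj⟩, -⟩
    refine ContinuousAt.continuousWithinAt ?_
    by_cases hij : i = j
    · subst hij
      simpa using continuous_snd.continuousAt
    · obtain ⟨k, hk⟩ := exists_gap_pos (gaps_pos hij hi hj)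
      have hnhds : ∀ᶠ p : PuncturedPlane n × Deck n in 𝓝 (z, g), 0 < gap k p.1.1.re :=
        continuousAt_const.eventually_lt
          (f := fun _ => (0 : ℝ)) (g := fun p : PuncturedPlane n × Deck n => gap k p.1.1.re)
          (Continuous.continuousAt (by fun_prop)) hk
      have heq : (fun p : PuncturedPlane n × Deck n =>
          p.2 * ((cocycle i p.1)⁻¹ * cocycle j p.1)) =ᶠ[𝓝 (z, g)]
          fun p => p.2 * ((cocycle i z)⁻¹ * cocycle j z) := by
        filter_upwards [hnhds] with p hp
        simp only [cocycle, interval_eq hp, interval_eq hk]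
      refine ContinuousAt.congr ?_ heq.symm
      exact (continuous_of_discreteTopology (f := fun h : Deck n =>
        h * ((cocycle i z)⁻¹ * cocycle j z))).continuousAt.comp continuousAt_snd

/-- The universal covering space of the punctured plane. -/
abbrev Cover (n : ℕ) : Type := (bundleCore n).TotalSpace

theorem coordChange_eq (i j : Bool) (z : PuncturedPlane n) (g : Deck n) :
    (bundleCore n).coordChange i j z g = g * ((cocycle i z)⁻¹ * cocycle j z) := rfl

/-- The point of the covering space over `z` with coordinate `g` in the preferred chart. -/
def mkPoint (z : PuncturedPlane n) (g : Deck n) : Cover n := ⟨z, g⟩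

/-- The coordinate of a point in the preferred chart at its projection. -/
def coordinate (p : Cover n) : Deck n := p.2

theorem mkPoint_coordinate (p : Cover n) : mkPoint p.1 (coordinate p) = p := rfl

instance : MulAction (Deck n) (Cover n) where
  smul γ p := mkPoint p.1 (γ * coordinate p)
  one_smul p := by
    change mkPoint p.1 (1 * coordinate p) = p
    rw [one_mul, mkPoint_coordinate]
  mul_smul γ δ p := by
    change mkPoint p.1 (γ * δ * coordinate p) = mkPoint p.1 (γ * (δ * coordinate p))
    rw [mul_assoc]

theorem isQuotientCoveringMap_proj :
    IsQuotientCoveringMap ((bundleCore n).proj : Cover n → PuncturedPlane n) (Deck n) := by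
  rw [isQuotientCoveringMap_iff_isCoveringMap_and]
  refine ⟨FiberBundle.isCoveringMap, fun z => ⟨mkPoint z 1, rfl⟩, ⟨fun γ => ?_⟩, ?_, ?_⟩
  · rw [continuous_iff_continuousAt]
    intro p
    rw [FiberBundle.continuousAt_totalSpace]
    refine ⟨(bundleCore n).continuous_proj.continuousAt, ?_⟩
    have h := ((FiberBundle.continuousAt_totalSpace (Deck n) (fun q : Cover n => q)
      (x₀ := p)).mp continuousAt_id).2
    refine ((continuous_of_discreteTopology (f := fun h : Deck n =>
      γ * h)).continuousAt.comp h).congr (Filter.Eventually.of_forall fun q => ?_)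
    exact (mul_assoc γ (coordinate q) _).symm
  · refine ⟨fun γ δ p h => ?_⟩
    have h2 : γ * coordinate p = δ * coordinate p := congrArg coordinate h
    exact mul_right_cancel h2
  · intro p p'
    constructor
    · intro (h : p.1 = p'.1)
      refine ⟨coordinate p * (coordinate p')⁻¹, ?_⟩
      change mkPoint p'.1 (coordinate p * (coordinate p')⁻¹ * coordinate p') = p
      rw [inv_mul_cancel_right, ← h, mkPoint_coordinate]
    · rintro ⟨γ, h⟩
      exact (congrArg (fun q : Cover n => q.1) h).symm

/-- The vertex of the tree that belongs to a sheet over a chart. -/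
def vertex (b : Bool) (g : Deck n) : RedWord (Fin (n + 1)) :=
  if b then EvenWordGroup.word g else RedWord.toggle 0 (EvenWordGroup.word g)

theorem neg_one_pow_length_vertex (b : Bool) (g : Deck n) :
    (-1 : ℝ) ^ (vertex b g).1.length = sgn b := by
  have h := EvenWordGroup.even_length_word g
  cases b
  · exact ((RedWord.odd_length_toggle _ _).mpr h).neg_one_pow
  · exact h.neg_one_pow

theorem toggle_toggle (k : Fin (n + 1)) (w : RedWord (Fin (n + 1))) :
    RedWord.toggle k (RedWord.toggle k w) = w := by
  rw [← Equiv.Perm.mul_apply, RedWord.toggle_mul_self, Equiv.Perm.one_apply]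

/-- In the `k`-th gap, the vertices of a sheet for the two charts are joined by an edge with
label `k`. -/
theorem vertex_coordChange {i j : Bool} (hij : i ≠ j) {z : PuncturedPlane n} {k : Fin (n + 1)}
    (hk : 0 < gap k z.1.re) (g : Deck n) :
    vertex j ((bundleCore n).coordChange i j z g) = RedWord.toggle k (vertex i g) := by
  rw [coordChange_eq]
  cases i <;> cases j
  · exact absurd rfl hij
  · simp only [cocycle, interval_eq hk, vertex, if_true, Bool.false_eq_true, if_false, mul_one]
    have h := EvenWordGroup.word_mul_gen (g * (EvenWordGroup.gen (o := (0 : Fin (n + 1))) k)⁻¹) k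
    rw [inv_mul_cancel_right] at h
    rw [h, toggle_toggle, toggle_toggle]
  · simp only [cocycle, interval_eq hk, vertex, if_true, Bool.false_eq_true, if_false, inv_one,
      one_mul, EvenWordGroup.word_mul_gen, toggle_toggle]
  · exact absurd rfl hij

theorem planePath_coordChange {i j : Bool} {z : PuncturedPlane n}
    (hi : 0 < chartFun n i z.1) (hj : 0 < chartFun n j z.1) (g : Deck n) {s : ℝ} (hs : s ≤ 1) :
    TreePath.planePath mid (vertex j ((bundleCore n).coordChange i j z g)).1 (depth j z.1) s =
      TreePath.planePath mid (vertex i g).1 (depth i z.1) s := by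
  by_cases hij : i = j
  · subst hij
    rw [coordChange_eq, inv_mul_cancel, mul_one]
  · obtain ⟨k, hk⟩ := exists_gap_pos (gaps_pos hij hi hj)
    rw [vertex_coordChange hij hk]
    exact (TreePath.planePath_toggle (fun l hl => depth_eq_zero hk hl)
      (fun l hl => depth_eq_zero hk hl) (depth_nonneg hi k) (depth_nonneg hj k)
      (depth_add_depth hij hk) hs).symm

/-- The zigzag in the plane attached to a point of the covering space. -/
def coverPath (p : Cover n) (s : ℝ) : ℂ :=
  TreePath.planePath mid (vertex ((bundleCore n).indexAt p.1) (coordinate p)).1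
    (depth ((bundleCore n).indexAt p.1) p.1.1) s

theorem size_coverPath_pos (p : Cover n) {s : ℝ} (hs0 : 0 ≤ s) (hs : s ≤ 1) :
    0 < size n (coverPath p s) :=
  planePath_mem ((bundleCore n).mem_baseSet_at p.1) _ hs0 hs

theorem coverPath_zero (p : Cover n) : coverPath p 0 = Complex.I :=
  TreePath.planePath_zero _ _ _

theorem coverPath_one (p : Cover n) : coverPath p 1 = squash n p.1.1 :=
  planePath_depth_one ((bundleCore n).mem_baseSet_at p.1) (neg_one_pow_length_vertex _ _)

theorem continuous_coverPath :
    Continuous fun q : Cover n × I => coverPath q.1 (q.2 : ℝ) := by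
  rw [continuous_iff_continuousAt]
  rintro ⟨p₀, s₀⟩
  let i := (bundleCore n).indexAt p₀.1
  have hi : p₀.1 ∈ (bundleCore n).baseSet i := (bundleCore n).mem_baseSet_at p₀.1
  have hloc : ∀ᶠ q : Cover n × I in 𝓝 (p₀, s₀), q.1.1 ∈ (bundleCore n).baseSet i :=
    (((bundleCore n).continuous_proj.comp continuous_fst).continuousAt
      (x := (p₀, s₀))).eventually (((bundleCore n).isOpen_baseSet i).mem_nhds hi)
  have hcoord : ContinuousAt (fun q : Cover n × I =>
      ((bundleCore n).coordChange ((bundleCore n).indexAt q.1.1) i q.1.1 q.1.2 : Deck n))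
      (p₀, s₀) :=
    ((FiberBundle.continuousAt_totalSpace (Deck n) (fun q : Cover n × I => q.1)
      (x₀ := (p₀, s₀))).mp continuousAt_fst).2
  obtain ⟨g₀, hg₀⟩ : ∃ g₀ : Deck n,
      (bundleCore n).coordChange ((bundleCore n).indexAt p₀.1) i p₀.1 p₀.2 = g₀ := ⟨_, rfl⟩
  have hg : ∀ᶠ q : Cover n × I in 𝓝 (p₀, s₀),
      (bundleCore n).coordChange ((bundleCore n).indexAt q.1.1) i q.1.1 q.1.2 = g₀ :=
    hcoord.eventually ((isOpen_discrete {g₀}).mem_nhds hg₀)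
  have hdepth : ContinuousAt (fun q : Cover n × I => depth (n := n) i q.1.1.1) (p₀, s₀) :=
    ContinuousAt.comp (f := fun q : Cover n × I => q.1.1.1) (g := depth i)
      ((continuousOn_depth i).continuousAt
        ((isOpen_lt continuous_const (continuous_chartFun i)).mem_nhds hi))
      (continuous_subtype_val.comp
        ((bundleCore n).continuous_proj.comp continuous_fst)).continuousAt
  have hcont : ContinuousAt (fun q : Cover n × I =>
      TreePath.planePath mid (vertex i g₀).1 (depth i q.1.1.1) (q.2 : ℝ)) (p₀, s₀) :=
    (TreePath.continuous_planePath mid (vertex i g₀).1).continuousAt.comp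
      (hdepth.prodMk (continuous_subtype_val.comp continuous_snd).continuousAt)
  refine hcont.congr ?_
  filter_upwards [hloc, hg] with q hq hqg
  rw [← hqg]
  exact planePath_coordChange ((bundleCore n).mem_baseSet_at q.1.1) hq _ q.2.2.2

/-- The projection of the covering space contracts along the zigzags. -/
theorem nullhomotopic_proj :
    (⟨(bundleCore n).proj, (bundleCore n).continuous_proj⟩ :
      C(Cover n, PuncturedPlane n)).Nullhomotopic := by
  let z₁ : PuncturedPlane n := ⟨Complex.I, fun i h => by
    have := congrArg Complex.im h
    simp at this⟩
  have hcont : Continuous fun p : Cover n => coverPath p ((1 : I) : ℝ) :=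
    continuous_coverPath.comp (f := fun p : Cover n => (p, (1 : I))) (by fun_prop)
  let f : C(Cover n, PuncturedPlane n) := ⟨fun p => ⟨coverPath p ((1 : I) : ℝ), size_pos_iff.mp
    (size_coverPath_pos p (1 : I).2.1 (1 : I).2.2)⟩, hcont.subtype_mk _⟩
  have h1 : (ContinuousMap.const (Cover n) z₁).Homotopic f := by
    refine ⟨⟨⟨fun q => ⟨coverPath q.2 q.1, size_pos_iff.mp
      (size_coverPath_pos q.2 q.1.2.1 q.1.2.2)⟩, ?_⟩, ?_, ?_⟩⟩
    · exact Continuous.subtype_mk (continuous_coverPath.comp continuous_swap) _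
    · intro p
      exact Subtype.ext (coverPath_zero p)
    · intro p
      rfl
  have h2 : (⟨(bundleCore n).proj, (bundleCore n).continuous_proj⟩ :
      C(Cover n, PuncturedPlane n)).Homotopic f := by
    refine ⟨⟨⟨fun q => ⟨(1 - (q.1 : ℝ)) • q.2.1.1 + (q.1 : ℝ) • squash n q.2.1.1,
      size_pos_iff.mp (segment_squash_mem (size_pos q.2.1) q.1.2.1 q.1.2.2)⟩, ?_⟩, ?_, ?_⟩⟩
    · refine Continuous.subtype_mk ?_ _
      have hp : Continuous fun q : I × Cover n => q.2.1.1 :=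
        continuous_subtype_val.comp ((bundleCore n).continuous_proj.comp continuous_snd)
      have hs : Continuous fun q : I × Cover n => squash n q.2.1.1 :=
        continuousOn_squash.comp_continuous hp fun q => size_pos q.2.1
      fun_prop
    · intro p
      exact Subtype.ext (by simp)
    · intro p
      refine Subtype.ext ?_
      change _ = coverPath p ((1 : I) : ℝ)
      rw [Set.Icc.coe_one, coverPath_one]
      simp
  exact ⟨z₁, h2.trans h1.symm⟩

theorem isPathConnected_chart (b : Bool) :
    IsPathConnected {z : PuncturedPlane n | 0 < chartFun n b z.1} := by
  have hsub : ∀ z, 0 < chartFun n b z → 0 < size n z := fun z hz =>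
    lt_of_lt_of_le hz (chartFun_le_size b z)
  -- Move vertically into a half plane, which is convex.
  have hC : IsPathConnected {z : ℂ | 0 < chartFun n b z} := by
    have hmem : ∀ z : ℂ, 0 < sgn b * z.im → 0 < chartFun n b z := fun z hz =>
      add_pos_of_nonneg_of_pos (gaps_nonneg _) (lt_max_of_lt_right hz)
    have hss : sgn b * sgn b = 1 := by cases b <;> simp [sgn]
    refine ⟨⟨0, sgn b⟩, hmem _ (by simp [hss]), fun {z} hz => ?_⟩
    let w : ℂ := ⟨z.re, sgn b * (|z.im| + 1)⟩
    have hw : 0 < sgn b * w.im := by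
      change 0 < sgn b * (sgn b * (|z.im| + 1))
      rw [← mul_assoc, hss]
      positivity
    have h1 : JoinedIn {z : ℂ | 0 < chartFun n b z} ⟨0, sgn b⟩ w := by
      refine JoinedIn.of_segment_subset fun y hy => hmem y ?_
      obtain ⟨c, d, hc, hd, hcd, rfl⟩ := hy
      have h0 : (0 : ℝ) < sgn b * (⟨0, sgn b⟩ : ℂ).im := by simp [hss]
      have := (convex_Ioi (0 : ℝ)) h0 hw hc hd hcd
      simp only [Set.mem_Ioi, smul_eq_mul] at this
      simp only [Complex.add_im, Complex.real_smul, Complex.im_ofReal_mul]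
      linarith
    have h2 : JoinedIn {z : ℂ | 0 < chartFun n b z} z w := by
      refine JoinedIn.of_segment_subset fun y hy => ?_
      obtain ⟨c, d, hc, hd, hcd, rfl⟩ := hy
      have hre : (c • z + d • w).re = z.re := by
        simp only [Complex.add_re, Complex.real_smul, Complex.re_ofReal_mul, w]
        linear_combination z.re * hcd
      have him : (c • z + d • w).im = c * z.im + d * (sgn b * (|z.im| + 1)) := by
        simp only [Complex.add_im, Complex.real_smul, Complex.im_ofReal_mul, w]
      have hz' : 0 < gaps n z.re + max 0 (sgn b * z.im) := hz
      change 0 < gaps n (c • z + d • w).re + max 0 (sgn b * (c • z + d • w).im)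
      rw [hre]
      refine lt_of_lt_of_le hz' (add_le_add le_rfl (max_le_max le_rfl ?_))
      rw [him]
      have h3 : sgn b * z.im ≤ |z.im| := by
        cases b
        · simpa [sgn] using neg_le_abs z.im
        · simpa [sgn] using le_abs_self z.im
      have h4 : sgn b * (c * z.im + d * (sgn b * (|z.im| + 1))) =
          c * (sgn b * z.im) + d * (|z.im| + 1) := by
        linear_combination d * (|z.im| + 1) * hss
      rw [h4]
      obtain rfl : c = 1 - d := by linarith
      linarith [mul_le_mul_of_nonneg_left h3 hd]
    exact h1.trans h2.symm
  have := hC.preimage_coe (U := {z : ℂ | ∀ i : Fin n, z ≠ ((i : ℕ) : ℂ)})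
    fun z hz => size_pos_iff.mp (hsub z hz)
  exact this

/-- The point of the covering space with given coordinates in a chart. -/
def sheetPoint (b : Bool) (g : Deck n) (z : PuncturedPlane n) : Cover n :=
  mkPoint z ((bundleCore n).coordChange b ((bundleCore n).indexAt z) z g)

theorem joined_sheetPoint {b : Bool} (g : Deck n) {z z' : PuncturedPlane n}
    (hz : 0 < chartFun n b z.1) (hz' : 0 < chartFun n b z'.1) :
    Joined (sheetPoint b g z) (sheetPoint b g z') := by
  have hc : ContinuousOn (sheetPoint (n := n) b g) {z | 0 < chartFun n b z.1} := by
    refine ((bundleCore n).localTriv b).continuousOn_invFun.comp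
      (f := fun z : PuncturedPlane n => (z, g)) (by fun_prop) ?_
    intro z hz
    exact ((bundleCore n).mem_localTriv_target b (z, g)).mpr hz
  exact (((isPathConnected_chart b).joinedIn z hz z' hz').map_continuousOn hc).joined

theorem sheetPoint_coordChange (i j : Bool) (g : Deck n) (z : PuncturedPlane n) :
    sheetPoint j ((bundleCore n).coordChange i j z g) z = sheetPoint i g z := by
  simp only [sheetPoint, coordChange_eq, mul_assoc, mul_inv_cancel_left]

theorem exists_eq_sheetPoint (p : Cover n) :
    ∃ b g, 0 < chartFun n b p.1.1 ∧ p = sheetPoint b g p.1 := by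
  refine ⟨(bundleCore n).indexAt p.1, coordinate p, (bundleCore n).mem_baseSet_at p.1, ?_⟩
  rw [sheetPoint, coordChange_eq, inv_mul_cancel, mul_one, mkPoint_coordinate]

/-- The chosen real point of the `k`-th gap. -/
def gapPoint (k : Fin (n + 1)) : PuncturedPlane n :=
  ⟨(mid k : ℝ), size_pos_iff.mp <| by
    rw [size, Complex.ofReal_re]
    exact add_pos_of_pos_of_nonneg ((gap_mid_pos k).trans_le (gap_le_gaps _ _)) (abs_nonneg _)⟩

theorem gap_gapPoint_pos (k : Fin (n + 1)) : 0 < gap k (gapPoint k).1.re := by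
  change 0 < gap k (Complex.ofReal (mid k)).re
  rw [Complex.ofReal_re]
  exact gap_mid_pos k

theorem chartFun_gapPoint_pos (b : Bool) (k : Fin (n + 1)) : 0 < chartFun n b (gapPoint k).1 :=
  ((gap_gapPoint_pos k).trans_le (gap_le_gaps _ _)).trans_le (gaps_le_chartFun _ _)

instance : PathConnectedSpace (Cover n) := by
  let base (g : Deck n) : Cover n := sheetPoint true g (gapPoint 0)
  -- Crossing to the lower chart in the gap `k` and back in the gap `0`.
  have hstep : ∀ g k, Joined (base g) (base (g * EvenWordGroup.gen k)) := by
    intro g k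
    have h1 := joined_sheetPoint g (chartFun_gapPoint_pos true 0) (chartFun_gapPoint_pos true k)
    have h2 := joined_sheetPoint (g * EvenWordGroup.gen k) (chartFun_gapPoint_pos false k)
      (chartFun_gapPoint_pos false (0 : Fin (n + 1)))
    have e1 := sheetPoint_coordChange true false g (gapPoint k)
    have e2 := sheetPoint_coordChange true false (g * EvenWordGroup.gen k) (gapPoint 0)
    simp only [coordChange_eq, cocycle, interval_eq (gap_gapPoint_pos _), if_true,
      Bool.false_eq_true, if_false, inv_one, one_mul, EvenWordGroup.gen_self, mul_one] at e1 e2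
    rw [e1, e2] at h2
    exact h1.trans h2
  have hbase : ∀ g, Joined (base 1) (base g) := by
    intro g
    have hg : g ∈ Subgroup.closure
        (Set.range (EvenWordGroup.gen (o := (0 : Fin (n + 1))))) := by
      rw [EvenWordGroup.closure_range_gen]; trivial
    have key : ∀ h, Joined (base h) (base (h * g)) := by
      induction hg using Subgroup.closure_induction with
      | mem x hx =>
        obtain ⟨k, rfl⟩ := hx
        exact fun h => hstep h k
      | one => intro h; rw [mul_one]
      | mul x y _ _ hx hy =>
        intro h
        rw [← mul_assoc]
        exact (hx h).trans (hy (h * x))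
      | inv x _ hx =>
        intro h
        have := (hx (h * x⁻¹)).symm
        rwa [inv_mul_cancel_right] at this
    simpa using key 1
  have hall : ∀ p : Cover n, Joined (base 1) p := by
    intro p
    obtain ⟨b, g, hb, hp⟩ := exists_eq_sheetPoint p
    have h1 := joined_sheetPoint g (chartFun_gapPoint_pos b 0) hb
    rw [← hp, ← sheetPoint_coordChange b true] at h1
    exact (hbase _).trans h1
  exact ⟨⟨base 1⟩, fun p q => (hall p).symm.trans (hall q)⟩

instance : ContractibleSpace (Cover n) :=
  IsCoveringMap.contractibleSpace_of_nullhomotopic isQuotientCoveringMap_proj.isCoveringMap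
    nullhomotopic_proj

theorem isAspherical : IsAspherical (PuncturedPlane n) :=
  IsAspherical.of_covering isQuotientCoveringMap_proj.isCoveringMap
    isQuotientCoveringMap_proj.surjective (IsAspherical.of_contractible (Cover n))

theorem center_fundamentalGroup (hn : 2 ≤ n) (z : PuncturedPlane n) :
    Subgroup.center (FundamentalGroup (PuncturedPlane n) z) = ⊥ :=
  Subgroup.center_eq_bot_of_mulEquiv
    (isQuotientCoveringMap_proj.fundamentalGroupEquiv ⟨mkPoint z 1, rfl⟩)
    (Subgroup.center_mulOpposite_eq_bot
      (EvenWordGroup.center_eq_bot (by rw [Fintype.card_fin]; omega)))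

end PuncturedPlane

/-! ### Squares with constant boundary -/

/-- The boundary of the unit square. -/
def squareBoundary : Set (I × I) := {p | p.1 = 0 ∨ p.1 = 1 ∨ p.2 = 0 ∨ p.2 = 1}

namespace squareBoundary

/-- Identify all points of the boundary of the square. -/
def setoid : Setoid (I × I) where
  r p q := p = q ∨ (p ∈ squareBoundary ∧ q ∈ squareBoundary)
  iseqv := by
    refine ⟨fun p => Or.inl rfl, ?_, ?_⟩
    · rintro p q (rfl | ⟨h, h'⟩)
      · exact Or.inl rfl
      · exact Or.inr ⟨h', h⟩
    · rintro p q r (rfl | ⟨h, h'⟩) (rfl | ⟨k, k'⟩)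
      · exact Or.inl rfl
      · exact Or.inr ⟨k, k'⟩
      · exact Or.inr ⟨h, h'⟩
      · exact Or.inr ⟨h, k'⟩

theorem liftsCoverings : LiftsCoverings (Quotient setoid) := by
  intro P X _ _ p hp hsurj f
  have : ContractibleSpace I := (convex_Icc (0 : ℝ) 1).contractibleSpace ⟨0, by simp⟩
  have : LocallyPathConnectedSpace I :=
    (isQuotientMap_projIcc (a := (0 : ℝ)) (h := zero_le_one)).locallyPathConnectedSpace
  obtain ⟨F, hF⟩ := LiftsCoverings.of_simplyConnected (I × I) P X p hp hsurj
    (f.comp ⟨Quotient.mk setoid, continuous_quotient_mk'⟩)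
  have hbd : ∀ v ∈ squareBoundary, ∀ w ∈ squareBoundary, p (F v) = p (F w) := by
    intro v hv w hw
    rw [hF, hF]
    exact congrArg f (Quotient.sound (Or.inr ⟨hv, hw⟩))
  -- Along each of the four edges the lift is constant.
  have hedge : ∀ e : C(I, I × I), (∀ t, e t ∈ squareBoundary) → ∀ s t, F (e s) = F (e t) :=
    fun e he s t => hp.const_of_comp (g := fun t => F (e t)) (by fun_prop)
      (fun a b => hbd _ (he a) _ (he b)) s t
  have h0 : ∀ v ∈ squareBoundary, F v = F (0, 0) := by
    have e1 : ∀ t, F (0, t) = F (0, 0) := fun t =>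
      hedge ⟨fun t => (0, t), by fun_prop⟩ (fun t => Or.inl rfl) t 0
    have e2 : ∀ t, F (t, 0) = F (0, 0) := fun t =>
      hedge ⟨fun t => (t, 0), by fun_prop⟩ (fun t => Or.inr (Or.inr (Or.inl rfl))) t 0
    have e3 : ∀ t, F (1, t) = F (0, 0) := fun t =>
      (hedge ⟨fun t => (1, t), by fun_prop⟩ (fun t => Or.inr (Or.inl rfl)) t 0).trans (e2 1)
    have e4 : ∀ t, F (t, 1) = F (0, 0) := fun t =>
      (hedge ⟨fun t => (t, 1), by fun_prop⟩ (fun t => Or.inr (Or.inr (Or.inr rfl))) t 0).trans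
        (e1 1)
    rintro ⟨s, t⟩ (h | h | h | h) <;> simp only at h <;> subst h
    exacts [e1 t, e3 t, e2 s, e4 s]
  refine ⟨⟨Quotient.lift F ?_, F.continuous.quotient_lift _⟩, ?_⟩
  · rintro v w (rfl | ⟨hv, hw⟩)
    · rfl
    · rw [h0 v hv, h0 w hw]
  · intro q
    induction q using Quotient.inductionOn with
    | h v => exact hF v

/-- Stretching of the unit interval, pushing the parts of length `t / 4` at both ends to the end
points. -/
def stretch (v t : I) : I := Set.projIcc 0 1 zero_le_one ((v - t / 4 : ℝ) / (1 - t / 2))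

@[fun_prop] theorem continuous_stretch {Z : Type*} [TopologicalSpace Z] {f g : Z → I}
    (hf : Continuous f) (hg : Continuous g) : Continuous fun z => stretch (f z) (g z) := by
  refine continuous_projIcc.comp (Continuous.div (by fun_prop) (by fun_prop) fun z => ?_)
  have := (g z).2.2
  linarith

theorem stretch_zero_right (v : I) : stretch v 0 = v := by
  rw [stretch, Set.Icc.coe_zero, zero_div, zero_div, sub_zero, sub_zero, div_one]
  exact Set.projIcc_val _ v

theorem stretch_zero_left (t : I) : stretch 0 t = 0 := by
  refine Set.projIcc_of_le_left _ (div_nonpos_of_nonpos_of_nonneg ?_ ?_)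
  · have := t.2.1
    rw [Set.Icc.coe_zero]
    linarith
  · linarith [t.2.2]

theorem stretch_one_left (t : I) : stretch 1 t = 1 := by
  refine Set.projIcc_of_right_le _ ((one_le_div ?_).mpr ?_)
  · linarith [t.2.2]
  · have := t.2.1
    rw [Set.Icc.coe_one]
    linarith

theorem stretch_of_le {v : I} (hv : (v : ℝ) ≤ 1 / 4) : stretch v 1 = 0 := by
  refine Set.projIcc_of_le_left _ (div_nonpos_of_nonpos_of_nonneg ?_ ?_) <;>
    rw [Set.Icc.coe_one] <;> linarith

theorem stretch_of_ge {v : I} (hv : 3 / 4 ≤ (v : ℝ)) : stretch v 1 = 1 := by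
  refine Set.projIcc_of_right_le _ ((one_le_div ?_).mpr ?_) <;>
    rw [Set.Icc.coe_one] <;> linarith

/-- Four times the distance to the boundary, cut off at `1`. -/
def collar (p : I × I) : I :=
  Set.projIcc 0 1 zero_le_one (4 * min (min (p.1 : ℝ) (1 - p.1)) (min (p.2 : ℝ) (1 - p.2)))

@[fun_prop] theorem continuous_collar : Continuous collar := by
  unfold collar
  exact continuous_projIcc.comp (by fun_prop)

theorem collar_of_mem {p : I × I} (hp : p ∈ squareBoundary) : collar p = 0 := by
  refine Set.projIcc_of_le_left _ ?_
  have : min (min (p.1 : ℝ) (1 - p.1)) (min (p.2 : ℝ) (1 - p.2)) ≤ 0 := by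
    rcases hp with h | h | h | h <;> simp [h]
  linarith

theorem stretch_mem {p : I × I} (hp : p ∈ squareBoundary) (t : I) :
    (stretch p.1 t, stretch p.2 t) ∈ squareBoundary := by
  rcases hp with h | h | h | h
  · exact Or.inl (by rw [h, stretch_zero_left])
  · exact Or.inr (Or.inl (by rw [h, stretch_one_left]))
  · exact Or.inr (Or.inr (Or.inl (by rw [h, stretch_zero_left])))
  · exact Or.inr (Or.inr (Or.inr (by rw [h, stretch_one_left])))

theorem stretch_one_mem {p : I × I} (hp : collar p ≠ 1) :
    (stretch p.1 1, stretch p.2 1) ∈ squareBoundary := by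
  have : ¬ 1 ≤ 4 * min (min (p.1 : ℝ) (1 - p.1)) (min (p.2 : ℝ) (1 - p.2)) :=
    fun h => hp (Set.projIcc_of_right_le _ h)
  have h4 : min (min (p.1 : ℝ) (1 - p.1)) (min (p.2 : ℝ) (1 - p.2)) ≤ 1 / 4 := by
    push Not at this
    linarith
  rw [min_le_iff, min_le_iff, min_le_iff] at h4
  rcases h4 with (h | h) | (h | h)
  · exact Or.inl (stretch_of_le h)
  · exact Or.inr (Or.inl (stretch_of_ge (by linarith)))
  · exact Or.inr (Or.inr (Or.inl (stretch_of_le h)))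
  · exact Or.inr (Or.inr (Or.inr (stretch_of_ge (by linarith))))

end squareBoundary

open squareBoundary in
/-- In an aspherical space, a square with constant boundary contracts relative to its boundary.
A free nullhomotopy of the sphere obtained by collapsing the boundary is made relative by
tracing back, in a collar of the boundary, the path run through by the base point. -/
theorem IsAspherical.homotopicRel_const {X : Type} [TopologicalSpace X] (hX : IsAspherical X)
    {g : C(I × I, X)} {x₀ : X} (hg : ∀ p ∈ squareBoundary, g p = x₀) :
    g.HomotopicRel (ContinuousMap.const _ x₀) squareBoundary := by
  let g' : C(Quotient setoid, X) := ⟨Quotient.lift g (by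
    rintro v w (rfl | ⟨hv, hw⟩)
    · rfl
    · rw [hg v hv, hg w hw]), g.continuous.quotient_lift _⟩
  obtain ⟨x₁, ⟨H⟩⟩ := hX _ liftsCoverings g'
  let K : C(I × (I × I), X) := ⟨fun q => H (q.1, Quotient.mk setoid q.2),
    H.continuous.comp (continuous_fst.prodMk (continuous_quotient_mk'.comp continuous_snd))⟩
  have hK0 : ∀ p, K (0, p) = g p := fun p => H.apply_zero _
  have hK1 : ∀ p, K (1, p) = x₁ := fun p => H.apply_one _
  have hKb : ∀ t, ∀ p ∈ squareBoundary, K (t, p) = K (t, (0, 0)) := fun t p hp =>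
    congrArg (fun s => H (t, s)) (Quotient.sound (Or.inr ⟨hp, Or.inl rfl⟩))
  have hx₀ : K (0, (0, 0)) = x₀ := (hK0 _).trans (hg _ (Or.inl rfl))
  let m : C(I × I, X) := ⟨fun p => K (collar p, (0, 0)), by fun_prop⟩
  have h1 : g.HomotopicRel m squareBoundary := by
    refine ⟨⟨⟨⟨fun q => K (min q.1 (collar q.2), (stretch q.2.1 q.1, stretch q.2.2 q.1)),
      by fun_prop⟩, ?_, ?_⟩, ?_⟩⟩
    · intro p
      change K (min 0 (collar p), (stretch p.1 0, stretch p.2 0)) = g p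
      rw [stretch_zero_right, stretch_zero_right, min_eq_left unitInterval.nonneg', hK0]
    · intro p
      change K (min 1 (collar p), (stretch p.1 1, stretch p.2 1)) = K (collar p, (0, 0))
      rw [min_eq_right unitInterval.le_one']
      by_cases hp : collar p = 1
      · rw [hp, hK1, hK1]
      · exact hKb _ _ (stretch_one_mem hp)
    · intro t p hp
      change K (min t (collar p), (stretch p.1 t, stretch p.2 t)) = g p
      rw [hKb _ _ (stretch_mem hp t), collar_of_mem hp, min_eq_right unitInterval.nonneg', hx₀,
        hg p hp]
  have h2 : m.HomotopicRel (ContinuousMap.const _ x₀) squareBoundary := by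
    refine ⟨⟨⟨⟨fun q => K (σ q.1 * collar q.2, (0, 0)), by fun_prop⟩, ?_, ?_⟩, ?_⟩⟩
    · intro p
      change K (σ 0 * collar p, (0, 0)) = K (collar p, (0, 0))
      rw [unitInterval.symm_zero, one_mul]
    · intro p
      change K (σ 1 * collar p, (0, 0)) = x₀
      rw [unitInterval.symm_one, zero_mul, hx₀]
    · intro t p hp
      change K (σ t * collar p, (0, 0)) = K (collar p, (0, 0))
      rw [collar_of_mem hp, mul_zero]
  exact h1.trans h2

/-! ### Regular fibrations -/

theorem FundamentalGroup.mapOfEq_mk {X Y : Type} [TopologicalSpace X] [TopologicalSpace Y]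
    (f : C(X, Y)) {x : X} {y : Y} (h : f x = y) (ω : Path x x) :
    FundamentalGroup.mapOfEq f h (Path.Homotopic.Quotient.mk ω) =
      Path.Homotopic.Quotient.mk ((ω.map f.continuous).cast h.symm h.symm) := by
  rw [FundamentalGroup.mapOfEq_apply]
  rfl

theorem FundamentalGroup.mk_eq_one_iff {X : Type} [TopologicalSpace X] {x : X} {ω : Path x x} :
    @Eq (FundamentalGroup X x) (Path.Homotopic.Quotient.mk ω) 1 ↔ ω.Homotopic (Path.refl x) :=
  Path.Homotopic.Quotient.eq

theorem ContinuousMap.Nullhomotopic.homotopic_const {X Y : Type} [TopologicalSpace X]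
    [TopologicalSpace Y] [PathConnectedSpace Y] {f : C(X, Y)} (hf : f.Nullhomotopic) (y : Y) :
    f.Homotopic (ContinuousMap.const X y) := by
  obtain ⟨y', h⟩ := hf
  let γ := PathConnectedSpace.somePath y' y
  exact h.trans ⟨⟨⟨fun q => γ q.1, by fun_prop⟩, fun _ => γ.source, fun _ => γ.target⟩⟩

/-- A regular fibration with a chosen fiber: homotopies in the base lift, along constant paths
the lift can be chosen constant, and `j` identifies `F` with the fiber over `b`. -/
structure IsRegularFibration {E B F : Type} [TopologicalSpace E] [TopologicalSpace B]
    [TopologicalSpace F] (p : C(E, B)) (b : B) (j : C(F, E)) : Prop where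
  lift : ∀ (T : Type) [TopologicalSpace T] (G : C(T × I, B)) (Z₀ : C(T, E)),
    (∀ t, p (Z₀ t) = G (t, 0)) → ∃ Z : C(T × I, E), (∀ q, p (Z q) = G q) ∧
      (∀ t, Z (t, 0) = Z₀ t) ∧ ∀ t, (∀ r, G (t, r) = G (t, 0)) → ∀ r, Z (t, r) = Z₀ t
  map_fiber : ∀ y, p (j y) = b
  injective : Function.Injective j
  lift_fiber : ∀ (T : Type) [TopologicalSpace T] (f : C(T, E)), (∀ t, p (f t) = b) →
    ∃ f' : C(T, F), ∀ t, j (f' t) = f t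

namespace IsRegularFibration

variable {E B F : Type} [TopologicalSpace E] [TopologicalSpace B] [TopologicalSpace F]
  {p : C(E, B)} {b : B} {j : C(F, E)}

theorem exists_path_lift (h : IsRegularFibration p b j) {e : E} {b' : B} (γ : Path (p e) b') :
    ∃ (e' : E) (δ : Path e e'), p e' = b' ∧ ∀ t, p (δ t) = γ t := by
  obtain ⟨Z, hZ, hZ0, -⟩ := h.lift Unit ⟨fun q => γ q.2, by fun_prop⟩
    (ContinuousMap.const Unit e) (fun _ => γ.source.symm)
  refine ⟨Z ((), 1), ⟨⟨fun t => Z ((), t), by fun_prop⟩, hZ0 _, rfl⟩, ?_, fun t => hZ _⟩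
  exact (hZ _).trans γ.target

theorem exists_fiber_eq (h : IsRegularFibration p b j) {e : E} (he : p e = b) :
    ∃ y, j y = e := by
  obtain ⟨f, hf⟩ := h.lift_fiber Unit (ContinuousMap.const Unit e) fun _ => he
  exact ⟨f (), hf ()⟩

theorem pathConnectedSpace [PathConnectedSpace B] [PathConnectedSpace F]
    (h : IsRegularFibration p b j) : PathConnectedSpace E := by
  obtain ⟨y₀⟩ : Nonempty F := PathConnectedSpace.nonempty
  have key : ∀ e, Joined (j y₀) e := by
    intro e
    obtain ⟨e', δ, he', -⟩ := h.exists_path_lift (PathConnectedSpace.somePath (p e) b)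
    obtain ⟨y, rfl⟩ := h.exists_fiber_eq he'
    have h1 : Joined (j y₀) (j y) :=
      ⟨(PathConnectedSpace.somePath y₀ y).map j.continuous⟩
    exact h1.trans ⟨δ.symm⟩
  exact ⟨⟨j y₀⟩, fun e e' => (key e).symm.trans (key e')⟩

/-- A map to the total space is moved into a fiber by lifting a contraction of its projection. -/
theorem isAspherical [PathConnectedSpace B] (h : IsRegularFibration p b j)
    (hB : IsAspherical B) (hF : IsAspherical F) : IsAspherical E := by
  intro S _ hS f
  obtain ⟨H⟩ := (hB S hS (p.comp f)).homotopic_const b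
  obtain ⟨Z, hZ, hZ0, -⟩ := h.lift S ⟨fun q => H (q.2, q.1), by fun_prop⟩ f
    (fun s => (H.apply_zero s).symm)
  obtain ⟨f', hf'⟩ := h.lift_fiber S ⟨fun s => Z (s, 1), by fun_prop⟩
    (fun s => (hZ _).trans (H.apply_one s))
  have h1 : f.Homotopic (j.comp f') := by
    refine ⟨⟨⟨fun q => Z (q.2, q.1), by fun_prop⟩, hZ0, fun s => (hf' s).symm⟩⟩
  obtain ⟨e, he⟩ := (hF S hS f').comp_right j
  exact ⟨e, h1.trans he⟩

theorem map_surjective [PathConnectedSpace F] (h : IsRegularFibration p b j) (y₀ : F) :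
    Function.Surjective (FundamentalGroup.mapOfEq p (h.map_fiber y₀)) := by
  intro c
  induction c using Path.Homotopic.Quotient.ind with
  | mk γ =>
    obtain ⟨e', δ, he', hδ⟩ := h.exists_path_lift (γ.cast (h.map_fiber y₀) rfl)
    obtain ⟨y₁, rfl⟩ := h.exists_fiber_eq he'
    let ε := (PathConnectedSpace.somePath y₁ y₀).map j.continuous
    refine ⟨Path.Homotopic.Quotient.mk (δ.trans ε), ?_⟩
    rw [FundamentalGroup.mapOfEq_mk]
    have : ((δ.trans ε).map p.continuous).cast (h.map_fiber y₀).symm (h.map_fiber y₀).symm =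
        γ.trans (Path.refl b) := by
      ext t
      simp only [Path.cast_coe, Path.map_coe, Function.comp_apply, Path.trans_apply]
      split_ifs
      · exact hδ _
      · exact h.map_fiber _
    rw [this, Path.Homotopic.Quotient.mk_trans]
    exact Path.Homotopic.Quotient.trans_refl _

/-- Exactness of the homotopy sequence at the total space. -/
theorem exists_eq_map_fiber (h : IsRegularFibration p b j) (y₀ : F)
    {c : FundamentalGroup E (j y₀)}
    (hc : FundamentalGroup.mapOfEq p (h.map_fiber y₀) c = 1) :
    ∃ d : FundamentalGroup F y₀, FundamentalGroup.mapOfEq j rfl d = c := by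
  induction c using Path.Homotopic.Quotient.ind with
  | mk ω =>
    rw [FundamentalGroup.mapOfEq_mk, FundamentalGroup.mk_eq_one_iff] at hc
    obtain ⟨H⟩ := hc
    obtain ⟨Z, hZ, hZ0, hZs⟩ := h.lift I ⟨fun q => H (q.2, q.1), by fun_prop⟩ ω
      (fun s => (H.apply_zero s).symm)
    have hend : ∀ s : I, (s = 0 ∨ s = 1) → ∀ r, Z (s, r) = j y₀ := by
      intro s hs r
      have : ∀ r, H (r, s) = b := by
        intro r
        rcases hs with rfl | rfl
        · exact H.source r
        · exact H.target r
      rw [hZs s fun r => (this r).trans (this 0).symm]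
      rcases hs with rfl | rfl
      · exact ω.source
      · exact ω.target
    obtain ⟨f', hf'⟩ := h.lift_fiber I ⟨fun s => Z (s, 1), by fun_prop⟩
      (fun s => (hZ _).trans (H.apply_one s))
    let η : Path y₀ y₀ := ⟨f', h.injective ((hf' 0).trans (hend 0 (Or.inl rfl) 1)),
      h.injective ((hf' 1).trans (hend 1 (Or.inr rfl) 1))⟩
    refine ⟨Path.Homotopic.Quotient.mk η, ?_⟩
    rw [FundamentalGroup.mapOfEq_mk]
    refine Path.Homotopic.Quotient.eq.mpr (Path.Homotopic.symm ⟨⟨⟨⟨fun q => Z (q.2, q.1),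
      by fun_prop⟩, hZ0, fun s => (hf' s).symm⟩, ?_⟩⟩)
    rintro r s (rfl | rfl)
    · exact (hend 0 (Or.inl rfl) r).trans ω.source.symm
    · exact (hend 1 (Or.inr rfl) r).trans ω.target.symm

/-- The fundamental group of the fiber injects, because squares in the base with constant
boundary contract. -/
theorem map_fiber_injective (h : IsRegularFibration p b j) (hB : IsAspherical B) (y₀ : F) :
    Function.Injective (FundamentalGroup.mapOfEq j (rfl : j y₀ = j y₀)) := by
  rw [injective_iff_map_eq_one]
  intro c hc
  induction c using Path.Homotopic.Quotient.ind with
  | mk γ =>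
    rw [FundamentalGroup.mapOfEq_mk, FundamentalGroup.mk_eq_one_iff] at hc
    obtain ⟨H⟩ := hc
    have hH0 : ∀ t, H (0, t) = j (γ t) := H.apply_zero
    have hH1 : ∀ t, H (1, t) = j y₀ := H.apply_one
    have hHs : ∀ s, H (s, 0) = j y₀ := H.source
    have hHt : ∀ s, H (s, 1) = j y₀ := H.target
    let g : C(I × I, B) := p.comp H.toContinuousMap
    have hg : ∀ q ∈ squareBoundary, g q = b := by
      rintro ⟨s, t⟩ (hq | hq | hq | hq) <;> simp only at hq <;> subst hq
      · exact (congrArg p (hH0 t)).trans (h.map_fiber _)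
      · exact (congrArg p (hH1 t)).trans (h.map_fiber _)
      · exact (congrArg p (hHs s)).trans (h.map_fiber _)
      · exact (congrArg p (hHt s)).trans (h.map_fiber _)
    obtain ⟨K⟩ := hB.homotopicRel_const hg
    obtain ⟨Z, hZ, hZ0, hZs⟩ := h.lift (I × I) ⟨fun q => K (q.2, q.1), by fun_prop⟩
      H.toContinuousMap (fun q => (K.apply_zero q).symm)
    have hbd : ∀ q ∈ squareBoundary, ∀ r, Z (q, r) = H q := fun q hq r =>
      hZs q (fun r => (K.eq_fst r hq).trans (K.eq_fst 0 hq).symm) r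
    obtain ⟨f', hf'⟩ := h.lift_fiber (I × I) ⟨fun q => Z (q, 1), by fun_prop⟩
      (fun q => (hZ _).trans (K.apply_one q))
    have hf : ∀ q ∈ squareBoundary, j (f' q) = H q := fun q hq => (hf' q).trans (hbd q hq 1)
    rw [FundamentalGroup.mk_eq_one_iff]
    refine ⟨⟨⟨f', fun t => ?_, fun t => ?_⟩, ?_⟩⟩
    · exact h.injective ((hf (0, t) (Or.inl rfl)).trans (hH0 t))
    · exact h.injective ((hf (1, t) (Or.inr (Or.inl rfl))).trans (hH1 t))
    · rintro s t (rfl | rfl)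
      · exact h.injective ((hf (s, 0) (Or.inr (Or.inr (Or.inl rfl)))).trans
          ((hHs s).trans (congrArg j γ.source.symm)))
      · exact h.injective ((hf (s, 1) (Or.inr (Or.inr (Or.inr rfl)))).trans
          ((hHt s).trans (congrArg j γ.target.symm)))

theorem center_eq_bot [PathConnectedSpace F] (h : IsRegularFibration p b j)
    (hB : IsAspherical B) (y₀ : F)
    (hZB : Subgroup.center (FundamentalGroup B b) = ⊥)
    (hZF : Subgroup.center (FundamentalGroup F y₀) = ⊥) :
    Subgroup.center (FundamentalGroup E (j y₀)) = ⊥ := by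
  rw [Subgroup.eq_bot_iff_forall]
  intro z hz
  have h1 : FundamentalGroup.mapOfEq p (h.map_fiber y₀) z ∈
      Subgroup.center (FundamentalGroup B b) := by
    rw [Subgroup.mem_center_iff] at hz ⊢
    intro c
    obtain ⟨c, rfl⟩ := h.map_surjective y₀ c
    rw [← map_mul, ← map_mul, hz]
  rw [hZB, Subgroup.mem_bot] at h1
  obtain ⟨d, rfl⟩ := h.exists_eq_map_fiber y₀ h1
  have h2 : d ∈ Subgroup.center (FundamentalGroup F y₀) := by
    rw [Subgroup.mem_center_iff] at hz ⊢
    intro c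
    apply h.map_fiber_injective hB y₀
    rw [map_mul, map_mul, hz]
  rw [hZF, Subgroup.mem_bot] at h2
  rw [h2, map_one]

end IsRegularFibration

/-! ### Normalized configurations -/

/-- Configurations of `k + 2` distinct points in the plane with the first two points equal to
`0` and `1`. -/
abbrev NormConf (k : ℕ) : Type :=
  {m : Fin (k + 2) → ℂ // Function.Injective m ∧ m 0 = 0 ∧ m 1 = 1}

namespace NormConf

variable {k : ℕ}

/-- The configuration `(0, 1, …, k + 1)`. -/
def std (k : ℕ) : NormConf k :=
  ⟨fun i => ((i : ℕ) : ℂ), fun _ _ h => Fin.ext (Nat.cast_injective h), by simp, by simp⟩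

/-- Forget the last point. -/
def forget : C(NormConf (k + 1), NormConf k) :=
  ⟨fun m => ⟨fun i => m.1 i.castSucc, fun _ _ h => Fin.castSucc_injective _ (m.2.1 h),
    m.2.2.1, m.2.2.2⟩, Continuous.subtype_mk (continuous_pi fun i =>
      (continuous_apply i.castSucc).comp continuous_subtype_val) _⟩

/-- Append a new point. -/
def append (m : NormConf k) (z : ℂ) (hz : ∀ i, z ≠ m.1 i) : NormConf (k + 1) :=
  ⟨Fin.snoc (α := fun _ => ℂ) m.1 z, by
    refine ⟨Fin.snoc_injective_iff.mpr ⟨m.2.1, ?_⟩, ?_, ?_⟩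
    · rintro ⟨i, hi⟩
      exact hz i hi.symm
    · exact (Fin.snoc_castSucc (α := fun _ => ℂ) z m.1 0).trans m.2.2.1
    · exact (Fin.snoc_castSucc (α := fun _ => ℂ) z m.1 1).trans m.2.2.2⟩

theorem forget_append (m : NormConf k) (z : ℂ) (hz : ∀ i, z ≠ m.1 i) :
    forget (m.append z hz) = m :=
  Subtype.ext (funext fun i => Fin.snoc_castSucc (α := fun _ => ℂ) z m.1 i)

theorem append_last (m : NormConf k) (z : ℂ) (hz : ∀ i, z ≠ m.1 i) :
    (m.append z hz).1 (Fin.last _) = z :=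
  Fin.snoc_last (α := fun _ => ℂ) z m.1

theorem eq_of_forget_eq {m m' : NormConf (k + 1)} (h : forget m = forget m')
    (hl : m.1 (Fin.last _) = m'.1 (Fin.last _)) : m = m' := by
  refine Subtype.ext (funext fun i => ?_)
  induction i using Fin.lastCases with
  | last => exact hl
  | cast i => exact congrFun (congrArg Subtype.val h) i

theorem last_ne (m : NormConf (k + 1)) (i : Fin (k + 2)) :
    m.1 (Fin.last _) ≠ (forget m).1 i := fun h =>
  (Fin.castSucc_lt_last i).ne' (m.2.1 h)

theorem continuous_append {T : Type} [TopologicalSpace T] {m : T → NormConf k} {z : T → ℂ}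
    (hm : Continuous m) (hz : Continuous z) (h : ∀ t i, z t ≠ (m t).1 i) :
    Continuous fun t => (m t).append (z t) (h t) := by
  refine Continuous.subtype_mk (continuous_pi fun i => ?_) _
  induction i using Fin.lastCases with
  | last => simpa using hz
  | cast i =>
    simp only [Fin.snoc_castSucc]
    exact (continuous_apply i).comp (continuous_subtype_val.comp hm)

/-- The fiber of `forget` over the standard configuration is a punctured plane. -/
def fiberMap (k : ℕ) : C(PuncturedPlane (k + 2), NormConf (k + 1)) :=
  ⟨fun z => (std k).append z.1 z.2,
    continuous_append continuous_const continuous_subtype_val fun z => z.2⟩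

theorem isRegularFibration_forget (k : ℕ) :
    IsRegularFibration (forget (k := k)) (std k) (fiberMap k) where
  lift T _ G Z₀ h := by
    obtain ⟨ζ, hζ, hζ0, hne, hst⟩ := exists_avoiding_lift (x := fun q => (G q).1)
      (continuous_subtype_val.comp G.continuous) (fun q => (G q).2.1)
      (z₀ := fun t => (Z₀ t).1 (Fin.last _))
      ((continuous_apply _).comp (continuous_subtype_val.comp Z₀.continuous))
      (fun t i => by
        have := last_ne (Z₀ t) i
        rwa [h t] at this)
    refine ⟨⟨fun q => (G q).append (ζ q) (hne q), continuous_append G.continuous hζ hne⟩,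
      fun q => forget_append _ _ (hne q), fun t => ?_, fun t ht r => ?_⟩
    · exact eq_of_forget_eq ((forget_append _ _ (hne _)).trans (h t).symm)
        ((append_last _ _ (hne _)).trans (hζ0 t))
    · refine eq_of_forget_eq ((forget_append _ _ (hne _)).trans ((ht r).trans (h t).symm))
        ((append_last _ _ (hne _)).trans (hst t (fun r => congrArg Subtype.val (ht r)) r))
  map_fiber y := forget_append _ _ y.2
  injective y y' h := by
    have := congrArg (fun m : NormConf (k + 1) => m.1 (Fin.last _)) h
    exact Subtype.ext ((append_last (std k) _ y.2).symm.trans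
      (this.trans (append_last (std k) _ y'.2)))
  lift_fiber T _ f hf := by
    have hne : ∀ t i, (f t).1 (Fin.last _) ≠ (std k).1 i := fun t i => by
      have := last_ne (f t) i
      rwa [hf t] at this
    refine ⟨⟨fun t => ⟨(f t).1 (Fin.last _), hne t⟩, Continuous.subtype_mk
      ((continuous_apply _).comp (continuous_subtype_val.comp f.continuous)) _⟩, fun t => ?_⟩
    exact eq_of_forget_eq ((forget_append _ _ (hne t)).trans (hf t).symm)
      (append_last _ _ (hne t))

instance : Subsingleton (NormConf 0) := by
  refine ⟨fun m m' => Subtype.ext (funext fun i => ?_)⟩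
  fin_cases i
  · exact m.2.2.1.trans m'.2.2.1.symm
  · exact m.2.2.2.trans m'.2.2.2.symm

instance (n : ℕ) : PathConnectedSpace (PuncturedPlane n) :=
  PuncturedPlane.isQuotientCoveringMap_proj.surjective.pathConnectedSpace
    PuncturedPlane.isQuotientCoveringMap_proj.continuous

instance pathConnectedSpace (k : ℕ) : PathConnectedSpace (NormConf k) := by
  induction k with
  | zero => exact ⟨⟨std 0⟩, fun x y => Subsingleton.elim x y ▸ Joined.refl x⟩
  | succ k ih => exact (isRegularFibration_forget k).pathConnectedSpace

theorem isAspherical (k : ℕ) : IsAspherical (NormConf k) := by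
  induction k with
  | zero =>
    have : Nonempty (NormConf 0) := ⟨std 0⟩
    exact IsAspherical.of_contractible _
  | succ k ih => exact (isRegularFibration_forget k).isAspherical ih PuncturedPlane.isAspherical

theorem center_fundamentalGroup (k : ℕ) (m : NormConf k) :
    Subgroup.center (FundamentalGroup (NormConf k) m) = ⊥ := by
  induction k with
  | zero =>
    have : Nonempty (NormConf 0) := ⟨std 0⟩
    have : Subsingleton (FundamentalGroup (NormConf 0) m) := by
      refine ⟨fun c d => ?_⟩
      exact Subsingleton.elim (α := Path.Homotopic.Quotient m m) c d
    exact Subgroup.eq_bot_of_subsingleton _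
  | succ k ih =>
    let y₀ : PuncturedPlane (k + 2) := PuncturedPlane.gapPoint 0
    refine Subgroup.center_eq_bot_of_mulEquiv
      (FundamentalGroup.fundamentalGroupMulEquivOfPathConnected m (fiberMap k y₀)) ?_
    exact (isRegularFibration_forget k).center_eq_bot (isAspherical k) y₀ (ih (std k))
      (PuncturedPlane.center_fundamentalGroup (by omega) y₀)

end NormConf

/-! ### Retracts, products and local simple connectedness -/

theorem IsAspherical.of_retract {A X : Type} [TopologicalSpace A] [TopologicalSpace X]
    (s : C(X, A)) (r : C(A, X)) (h : ∀ x, r (s x) = x) (hA : IsAspherical A) :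
    IsAspherical X := by
  intro S _ hS f
  have : f = r.comp (s.comp f) := by ext t; simp [h]
  rw [this]
  exact (hA S hS (s.comp f)).comp_right r

theorem SemilocallySimplyConnected.of_retract {A X : Type} [TopologicalSpace A]
    [TopologicalSpace X] (s : C(X, A)) (r : C(A, X)) (h : ∀ x, r (s x) = x)
    (hA : SemilocallySimplyConnected A) : SemilocallySimplyConnected X := by
  intro x
  obtain ⟨U, hU, hx, hU'⟩ := hA (s x)
  refine ⟨s ⁻¹' U, hU.preimage s.continuous, hx, fun y γ δ hγ hδ => ?_⟩
  have key := ((hU' (s y) (γ.map s.continuous) (δ.map s.continuous) hγ hδ).map r).pathCast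
    (h x).symm (h y).symm
  have e : ∀ γ : Path x y, (((γ.map s.continuous).map r.continuous).cast
      (h x).symm (h y).symm) = γ := fun γ => by
    ext t
    exact h (γ t)
  rwa [e, e] at key

theorem SemilocallySimplyConnected.prod {X Y : Type} [TopologicalSpace X] [TopologicalSpace Y]
    (hX : SemilocallySimplyConnected X) (hY : SemilocallySimplyConnected Y) :
    SemilocallySimplyConnected (X × Y) := by
  rintro ⟨x, y⟩
  obtain ⟨U, hU, hx, hU'⟩ := hX x
  obtain ⟨V, hV, hy, hV'⟩ := hY y
  refine ⟨U ×ˢ V, hU.prod hV, ⟨hx, hy⟩, fun ⟨x', y'⟩ γ δ hγ hδ => ?_⟩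
  obtain ⟨H⟩ := hU' x' (γ.map continuous_fst) (δ.map continuous_fst) (fun t => (hγ t).1)
    (fun t => (hδ t).1)
  obtain ⟨K⟩ := hV' y' (γ.map continuous_snd) (δ.map continuous_snd) (fun t => (hγ t).2)
    (fun t => (hδ t).2)
  exact ⟨Path.Homotopic.prodHomotopy H K⟩

/-- Open subsets of locally convex spaces are semilocally simply connected. -/
theorem IsOpen.semilocallySimplyConnected {V : Type} [AddCommGroup V] [Module ℝ V]
    [TopologicalSpace V] [IsTopologicalAddGroup V] [ContinuousSMul ℝ V] [LocallyConvexSpace ℝ V]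
    {Ω : Set V} (hΩ : IsOpen Ω) : SemilocallySimplyConnected Ω := by
  rintro ⟨x, hx⟩
  obtain ⟨C, ⟨hC, hconv⟩, hCΩ⟩ :=
    (LocallyConvexSpace.convex_basis (𝕜 := ℝ) x).mem_iff.mp (hΩ.mem_nhds hx)
  refine ⟨Subtype.val ⁻¹' interior C, isOpen_interior.preimage continuous_subtype_val,
    mem_interior_iff_mem_nhds.mpr hC, fun y γ δ hγ hδ => ?_⟩
  have hmem : ∀ s t : I, (1 - (s : ℝ)) • (γ t : V) + (s : ℝ) • (δ t : V) ∈ Ω := fun s t =>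
    hCΩ (hconv (interior_subset (hγ t)) (interior_subset (hδ t)) (sub_nonneg.mpr s.2.2) s.2.1
      (by ring))
  have hc : Continuous fun q : I × I =>
      (1 - (q.1 : ℝ)) • (γ q.2 : V) + (q.1 : ℝ) • (δ q.2 : V) := by fun_prop
  refine ⟨⟨⟨⟨fun q => ⟨_, hmem q.1 q.2⟩, hc.subtype_mk _⟩, fun t => ?_, fun t => ?_⟩, ?_⟩⟩
  · exact Subtype.ext (by simp)
  · exact Subtype.ext (by simp)
  · rintro s t (rfl | rfl) <;> refine Subtype.ext ?_ <;> simp [← add_smul]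

/-! ### Fiberwise configuration spaces -/

namespace FiberConf

section General

variable {E B : Type} {p : E → B} {n : ℕ}

/-- The points of a fiberwise configuration. -/
def point (e : FiberConf p n) (i : Fin n) : E := e.1 i

theorem point_ne (e : FiberConf p n) {i j : Fin n} (h : i ≠ j) : e.point i ≠ e.point j :=
  (e.2 i j h).1

theorem point_injective (e : FiberConf p n) : Function.Injective e.point := fun i j h => by
  by_contra hij
  exact e.point_ne hij h

theorem ext_point {e e' : FiberConf p n} (h : ∀ i, e.point i = e'.point i) : e = e' :=
  Subtype.ext (funext h)

theorem point_smul (τ : Equiv.Perm (Fin n)) (e : FiberConf p n) (i : Fin n) :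
    (τ • e).point i = e.point (τ⁻¹ i) := rfl

theorem eq_one_of_smul_eq {τ : Equiv.Perm (Fin n)} {e : FiberConf p n} (h : τ • e = e) :
    τ = 1 := by
  rw [← inv_eq_one]
  refine Equiv.ext fun i => e.point_injective ?_
  rw [← point_smul, h]
  rfl

variable [TopologicalSpace E]

theorem continuous_point (i : Fin n) : Continuous fun e : FiberConf p n => e.point i :=
  (continuous_apply i).comp continuous_subtype_val

theorem continuous_iff {T : Type} [TopologicalSpace T] {f : T → FiberConf p n} :
    Continuous f ↔ ∀ i, Continuous fun t => (f t).point i := by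
  constructor
  · intro hf i
    exact (continuous_point i).comp hf
  · intro h
    exact Continuous.subtype_mk (continuous_pi h) fun t => (f t).2

instance : ContinuousConstSMul (Equiv.Perm (Fin n)) (FiberConf p n) :=
  ⟨fun τ => continuous_iff.mpr fun i => continuous_point (τ⁻¹ i)⟩

/-- A free action of a finite group on a Hausdorff space is a covering action. -/
theorem isQuotientCoveringMap_mk [T2Space (FiberConf p n)] :
    IsQuotientCoveringMap (Quotient.mk _ : FiberConf p n → UFiberConf p n)
      (Equiv.Perm (Fin n)) where
  toIsQuotientMap := isQuotientMap_quotient_mk'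
  continuous_const_smul := continuous_const_smul
  apply_eq_iff_mem_orbit := Quotient.eq''
  disjoint e := by
    have h : ∀ τ : Equiv.Perm (Fin n), ∃ W ∈ 𝓝 e, ((τ • ·) '' W ∩ W).Nonempty → τ = 1 := by
      intro τ
      by_cases hτ : τ = 1
      · exact ⟨Set.univ, Filter.univ_mem, fun _ => hτ⟩
      · obtain ⟨U, V, hU, hV, hxU, hxV, hd⟩ := t2_separation
          (x := e) (y := τ • e) fun he => hτ (eq_one_of_smul_eq he.symm)
        refine ⟨U ∩ (τ • ·) ⁻¹' V, Filter.inter_mem (hU.mem_nhds hxU)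
          ((hV.preimage (continuous_const_smul τ)).mem_nhds hxV), ?_⟩
        rintro ⟨_, ⟨x, hx, rfl⟩, hx'⟩
        exact (Set.disjoint_left.mp hd hx'.1 hx.2).elim
    choose W hW hW' using h
    refine ⟨⋂ τ, W τ, Filter.iInter_mem.mpr hW, fun τ hτ => hW' τ (hτ.mono ?_)⟩
    exact Set.inter_subset_inter (Set.image_mono (Set.iInter_subset W τ)) (Set.iInter_subset W τ)

end General

variable {n : ℕ}

/-- A configuration in the plane from an injective tuple. -/
def ofInjective (x : Fin n → ℂ) (hx : Function.Injective x) : Conf ℂ n :=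
  ⟨x, fun _ _ hij => ⟨fun h => hij (hx h), rfl⟩⟩

theorem isOpen_injective : IsOpen {x : Fin n → ℂ | ∀ i j, i ≠ j → x i ≠ x j ∧ () = ()} := by
  simp only [Set.ofPred_forall]
  refine isOpen_iInter_of_finite fun i => isOpen_iInter_of_finite fun j =>
    isOpen_iInter_of_finite fun h => ?_
  simp only [and_true]
  exact isOpen_ne_fun (continuous_apply i) (continuous_apply j)

instance : T2Space (Conf ℂ n) :=
  inferInstanceAs (T2Space {x : Fin n → ℂ // ∀ i j, i ≠ j → x i ≠ x j ∧ () = ()})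

instance : LocallyPathConnectedSpace (Conf ℂ n) :=
  isOpen_injective.locallyPathConnectedSpace

theorem semilocallySimplyConnected_conf : SemilocallySimplyConnected (Conf ℂ n) :=
  isOpen_injective.semilocallySimplyConnected

end FiberConf

namespace CInf

theorem exists_coord_ne_zero {w : CInf} (hw : w ≠ 0) : ∃ j, coord j w ≠ 0 := by
  by_contra h
  push Not at h
  exact hw (ext_coord fun i => by rw [h i, map_zero])

/-- Ratios of vectors on a line depend continuously on the vectors. -/
theorem continuous_ratio {T : Type} [TopologicalSpace T] {v w : T → CInf} {c : T → ℂ}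
    (hv : Continuous v) (hw : Continuous w) (h0 : ∀ t, w t ≠ 0) (h : ∀ t, v t = c t • w t) :
    Continuous c := by
  rw [continuous_iff_continuousAt]
  intro t
  obtain ⟨j, hj⟩ := exists_coord_ne_zero (h0 t)
  have hne : ∀ᶠ t' in 𝓝 t, coord j (w t') ≠ 0 :=
    ((continuous_coord j).comp hw).continuousAt.eventually_ne hj
  have : ContinuousAt (fun t' => coord j (v t') / coord j (w t')) t :=
    ((continuous_coord j).comp hv).continuousAt.div ((continuous_coord j).comp hw).continuousAt hj
  refine this.congr ?_
  filter_upwards [hne] with t' ht'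
  rw [h t', map_smul, smul_eq_mul, mul_div_cancel_right₀ _ ht']

instance : ContinuousSMul ℝ CInf :=
  ⟨((Complex.continuous_ofReal.comp continuous_fst).smul continuous_snd :
    Continuous fun q : ℝ × CInf => ((q.1 : ℂ)) • q.2)⟩

/-- The nonzero vectors. -/
abbrev Punctured : Type := {w : CInf // w ≠ 0}

theorem isOpen_ne_zero : IsOpen {w : CInf | w ≠ 0} := isOpen_ne

instance : LocallyPathConnectedSpace Punctured := isOpen_ne_zero.locallyPathConnectedSpace

theorem semilocallySimplyConnected_punctured : SemilocallySimplyConnected Punctured :=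
  isOpen_ne_zero.semilocallySimplyConnected

theorem continuous_mk : Continuous fun w : Punctured => Projectivization.mk ℂ w.1 w.2 :=
  continuous_coinduced_rng

end CInf

/-! ### Normalizing configurations by affine maps -/

namespace FiberConf

/-- The nonzero complex numbers. -/
abbrev Cstar : Type := {w : ℂ // w ≠ 0}

variable {n k : ℕ}

/-- Apply the affine map `z ↦ a + w * z` to a configuration. -/
def affine (w : Cstar) (a : ℂ) (x : Conf ℂ n) : Conf ℂ n :=
  ofInjective (fun i => a + w.1 * x.point i) fun _ _ h =>
    x.point_injective (mul_left_cancel₀ w.2 (add_left_cancel h))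

theorem point_affine (w : Cstar) (a : ℂ) (x : Conf ℂ n) (i : Fin n) :
    (affine w a x).point i = a + w.1 * x.point i := rfl

theorem continuous_affine {T : Type} [TopologicalSpace T] {w : T → Cstar} {a : T → ℂ}
    {x : T → Conf ℂ n} (hw : Continuous w) (ha : Continuous a) (hx : Continuous x) :
    Continuous fun t => affine (w t) (a t) (x t) := by
  rw [continuous_iff]
  intro i
  have := continuous_iff.mp hx i
  exact ha.add ((continuous_subtype_val.comp hw).mul this)

theorem affine_one_zero (x : Conf ℂ n) : affine ⟨1, one_ne_zero⟩ 0 x = x :=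
  ext_point fun i => by rw [point_affine, zero_add, one_mul]

/-- A normalized configuration as a configuration. -/
def ofNorm (m : NormConf k) : Conf ℂ (k + 2) := ofInjective m.1 m.2.1

theorem point_ofNorm (m : NormConf k) (i : Fin (k + 2)) : (ofNorm m).point i = m.1 i := rfl

theorem continuous_ofNorm : Continuous (ofNorm (k := k)) :=
  continuous_iff.mpr fun i => (continuous_apply i).comp continuous_subtype_val

/-- The difference of the first two points. -/
def diff (x : Conf ℂ (k + 2)) : Cstar :=
  ⟨x.point 1 - x.point 0, sub_ne_zero.mpr (x.point_ne (by simp))⟩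

theorem continuous_diff : Continuous (diff (k := k)) :=
  ((continuous_point 1).sub (continuous_point 0)).subtype_mk _

/-- Normalize a configuration by the affine map that moves its first two points to `0` and
`1`. -/
def normalize : C(Conf ℂ (k + 2), NormConf k) :=
  ⟨fun x => ⟨fun i => (x.point i - x.point 0) / (diff x).1, fun i j h => by
    have := (div_left_inj' (diff x).2).mp h
    exact x.point_injective (sub_left_inj.mp this), by simp, div_self (diff x).2⟩,
    Continuous.subtype_mk (continuous_pi fun i =>
      ((continuous_point i).sub (continuous_point 0)).div
        (continuous_subtype_val.comp continuous_diff) fun x => (diff x).2) _⟩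

theorem normalize_apply (x : Conf ℂ (k + 2)) (i : Fin (k + 2)) :
    (normalize x).1 i = (x.point i - x.point 0) / (diff x).1 := rfl

theorem normalize_ofNorm (m : NormConf k) : normalize (ofNorm m) = m := by
  refine Subtype.ext (funext fun i => ?_)
  rw [normalize_apply]
  change (m.1 i - m.1 0) / (m.1 1 - m.1 0) = m.1 i
  rw [m.2.2.1, m.2.2.2, sub_zero, sub_zero, div_one]

theorem affine_normalize (x : Conf ℂ (k + 2)) :
    affine (diff x) (x.point 0) (ofNorm (normalize x)) = x :=
  ext_point fun i => by
    rw [point_affine, point_ofNorm, normalize_apply, mul_div_cancel₀ _ (diff x).2,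
      add_sub_cancel]

theorem diff_ofNorm (m : NormConf k) : diff (ofNorm m) = ⟨1, one_ne_zero⟩ := by
  refine Subtype.ext ?_
  change m.1 1 - m.1 0 = 1
  rw [m.2.2.1, m.2.2.2, sub_zero]

end FiberConf

/-- If a loop in `A` acts on `X`, its trace in `X` commutes with all loops, since both products
are homotopic to the diagonal of a torus. -/
theorem FundamentalGroup.map_act_mem_center {A X : Type} [TopologicalSpace A] [TopologicalSpace X]
    (act : C(A × X, X)) {a₀ : A} (h : ∀ x, act (a₀, x) = x) (x₀ : X) (l : Path a₀ a₀) :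
    FundamentalGroup.mapOfEq act (h x₀) (Path.Homotopic.Quotient.mk (l.prod (Path.refl x₀))) ∈
      Subgroup.center (FundamentalGroup X x₀) := by
  rw [Subgroup.mem_center_iff]
  intro d
  induction d using Path.Homotopic.Quotient.ind with
  | mk δ =>
    have hδ : FundamentalGroup.mapOfEq act (h x₀)
        (Path.Homotopic.Quotient.mk ((Path.refl a₀).prod δ)) = Path.Homotopic.Quotient.mk δ := by
      rw [FundamentalGroup.mapOfEq_mk]
      congr 1
      ext t
      exact h (δ t)
    have hcomm : ∀ u v : FundamentalGroup (A × X) (a₀, x₀),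
        u = Path.Homotopic.prod (.mk l) (.refl x₀) → v = Path.Homotopic.prod (.refl a₀) (.mk δ) →
        v * u = u * v := by
      rintro u v rfl rfl
      rw [FundamentalGroup.mul_def, FundamentalGroup.mul_def,
        Path.Homotopic.comp_prod_eq_prod_comp, Path.Homotopic.comp_prod_eq_prod_comp]
      simp
    have := congrArg (FundamentalGroup.mapOfEq act (h x₀)) (hcomm
      (Path.Homotopic.Quotient.mk (l.prod (Path.refl x₀)))
      (Path.Homotopic.Quotient.mk ((Path.refl a₀).prod δ)) rfl rfl)
    rwa [map_mul, map_mul, hδ] at this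

namespace FiberConf

variable {k : ℕ} {n : ℕ}

/-- Rotating and scaling configurations. -/
def scale : C(Cstar × Conf ℂ n, Conf ℂ n) :=
  ⟨fun q => affine q.1 0 q.2, continuous_affine continuous_fst continuous_const continuous_snd⟩

theorem scale_one (x : Conf ℂ n) : scale (⟨1, one_ne_zero⟩, x) = x := affine_one_zero x

/-- The covering of the unordered by the ordered configurations. -/
def unorder {E B : Type} [TopologicalSpace E] (p : E → B) (n : ℕ) :
    C(FiberConf p n, UFiberConf p n) :=
  ⟨Quotient.mk _, continuous_quotient_mk'⟩

/-- Rotating and scaling unordered configurations. -/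
def uscale : C(Cstar × UConf ℂ n, UConf ℂ n) :=
  ⟨fun q => Quotient.map' (s₁ := MulAction.orbitRel _ _) (s₂ := MulAction.orbitRel _ _)
    (affine q.1 0) (by
      rintro _ x ⟨τ, rfl⟩
      exact ⟨τ, rfl⟩) q.2, by
    have hq : IsOpenQuotientMap
        (Prod.map (id : Cstar → Cstar) (unorder (fun _ : ℂ => ()) n)) :=
      IsOpenQuotientMap.id.prodMap isQuotientCoveringMap_mk.isOpenQuotientMap
    rw [hq.isQuotientMap.continuous_iff]
    exact (unorder _ n).continuous.comp scale.continuous⟩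

theorem uscale_one (x : UConf ℂ n) : uscale (⟨1, one_ne_zero⟩, x) = x := by
  induction x using Quotient.inductionOn with
  | h x => exact congrArg (unorder _ n) (affine_one_zero x)

/-- A pure braid that becomes trivial after normalization is homotopic to a full rotation of the
base configuration, so it is central even among all braids. -/
theorem map_unorder_mem_center {m : NormConf k}
    {c : FundamentalGroup (Conf ℂ (k + 2)) (ofNorm m)}
    (hc : FundamentalGroup.mapOfEq normalize (normalize_ofNorm m) c = 1) :
    FundamentalGroup.mapOfEq (unorder (fun _ : ℂ => ()) (k + 2)) rfl c ∈
      Subgroup.center (FundamentalGroup (UConf ℂ (k + 2)) (unorder _ _ (ofNorm m))) := by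
  induction c using Path.Homotopic.Quotient.ind with
  | mk ω =>
    rw [FundamentalGroup.mapOfEq_mk, FundamentalGroup.mk_eq_one_iff] at hc
    obtain ⟨H⟩ := hc
    let l : Path (⟨1, one_ne_zero⟩ : Cstar) ⟨1, one_ne_zero⟩ :=
      (ω.map continuous_diff).cast (diff_ofNorm m).symm (diff_ofNorm m).symm
    have hl : ∀ t, l t = diff (ω t) := fun t => rfl
    have hb0 : (ofNorm m).point 0 = 0 := m.2.2.1
    have hω : @Eq (FundamentalGroup (Conf ℂ (k + 2)) (ofNorm m)) (Path.Homotopic.Quotient.mk ω)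
        (FundamentalGroup.mapOfEq scale (scale_one (ofNorm m))
        (Path.Homotopic.Quotient.mk (l.prod (Path.refl (ofNorm m))))) := by
      rw [FundamentalGroup.mapOfEq_mk]
      refine Path.Homotopic.Quotient.eq.mpr ⟨⟨⟨⟨fun q => affine (l q.2)
        ((1 - ((q.1 : ℝ) : ℂ)) * (ω q.2).point 0) (ofNorm (H q)), ?_⟩, ?_, ?_⟩, ?_⟩⟩
      · refine continuous_affine (by fun_prop) ?_ (continuous_ofNorm.comp H.continuous)
        have h1 : Continuous fun q : I × I => (ω q.2).point 0 :=
          (continuous_point 0).comp (ω.continuous.comp continuous_snd)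
        fun_prop
      · intro t
        change affine (l t) _ (ofNorm (H (0, t))) = ω t
        rw [H.apply_zero]
        change affine (diff (ω t)) ((1 - (((0 : I) : ℝ) : ℂ)) * (ω t).point 0)
          (ofNorm (normalize (ω t))) = ω t
        rw [Set.Icc.coe_zero, Complex.ofReal_zero, sub_zero, one_mul, affine_normalize]
      · intro t
        change affine (l t) ((1 - (((1 : I) : ℝ) : ℂ)) * (ω t).point 0) (ofNorm (H (1, t))) =
          affine (l t) 0 (ofNorm m)
        rw [H.apply_one, Set.Icc.coe_one, Complex.ofReal_one, sub_self, zero_mul]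
        rfl
      · have key : ∀ s t : I, ω t = ofNorm m → H (s, t) = m →
            affine (l t) ((1 - ((s : ℝ) : ℂ)) * (ω t).point 0) (ofNorm (H (s, t))) = ω t := by
          intro s t h1 h2
          rw [h2, hl, h1, hb0, mul_zero, diff_ofNorm, affine_one_zero]
        rintro s t (rfl | rfl)
        · exact key s 0 ω.source (H.source s)
        · exact key s 1 ω.target (H.target s)
    have hu : FundamentalGroup.mapOfEq (unorder (fun _ : ℂ => ()) (k + 2)) rfl
        (FundamentalGroup.mapOfEq scale (scale_one (ofNorm m))
          (Path.Homotopic.Quotient.mk (l.prod (Path.refl (ofNorm m))))) =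
        FundamentalGroup.mapOfEq uscale (uscale_one (unorder _ _ (ofNorm m)))
          (Path.Homotopic.Quotient.mk (l.prod (Path.refl (unorder _ _ (ofNorm m))))) := by
      rw [FundamentalGroup.mapOfEq_mk, FundamentalGroup.mapOfEq_mk, FundamentalGroup.mapOfEq_mk]
      rfl
    rw [hω, hu]
    exact FundamentalGroup.map_act_mem_center uscale uscale_one _ l

theorem map_normalize_surjective (m : NormConf k) : Function.Surjective
    (FundamentalGroup.mapOfEq normalize (normalize_ofNorm m)) := by
  intro c
  induction c using Path.Homotopic.Quotient.ind with
  | mk γ =>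
    refine ⟨Path.Homotopic.Quotient.mk (γ.map continuous_ofNorm), ?_⟩
    rw [FundamentalGroup.mapOfEq_mk]
    congr 1
    exact Path.ext (funext fun t => normalize_ofNorm (γ t))

instance : PathConnectedSpace (Conf ℂ (k + 2)) := by
  have hC : PathConnectedSpace Cstar := by
    have := isPathConnected_compl_singleton_of_one_lt_rank
      (by rw [Complex.rank_real_complex]; norm_num) (0 : ℂ)
    exact isPathConnected_iff_pathConnectedSpace.mp this
  have hs : Function.Surjective fun q : Cstar × ℂ × NormConf k =>
      affine q.1 q.2.1 (ofNorm q.2.2) := fun x =>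
    ⟨(diff x, x.point 0, normalize x), affine_normalize x⟩
  exact hs.pathConnectedSpace (continuous_affine continuous_fst (by fun_prop)
    (continuous_ofNorm.comp (by fun_prop)))

end FiberConf

/-! ### Fiberwise configurations in the tautological bundle -/

/-- The ordered fiberwise configuration space of the tautological line bundle, for at least two
points. -/
abbrev TautConf (k : ℕ) : Type := FiberConf tautProj (k + 2)

namespace TautConf

open CInf FiberConf

variable {k : ℕ}

/-- The vector underlying a point of a fiberwise configuration. -/
def vec (e : TautConf k) (i : Fin (k + 2)) : CInf := (e.point i).1.1

/-- The line containing a fiberwise configuration. -/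
def line (e : TautConf k) : CPInf := tautProj (e.point 0)

theorem tautProj_point (e : TautConf k) (i : Fin (k + 2)) : tautProj (e.point i) = e.line := by
  by_cases h : i = 0
  · rw [h, line]
  · exact (e.2 i 0 h).2

theorem ext_vec {e e' : TautConf k} (hv : ∀ i, e.vec i = e'.vec i) (hl : e.line = e'.line) :
    e = e' :=
  ext_point fun i => Subtype.ext (Prod.ext (hv i)
    ((tautProj_point e i).trans (hl.trans (tautProj_point e' i).symm)))

theorem vec_mem (e : TautConf k) (i : Fin (k + 2)) : e.vec i ∈ e.line.submodule := by
  have h : (e.point i).1.1 ∈ (tautProj (e.point i)).submodule := (e.point i).2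
  rwa [tautProj_point] at h

theorem vec_injective (e : TautConf k) : Function.Injective e.vec := fun i j h =>
  e.point_injective (Subtype.ext (Prod.ext h
    ((tautProj_point e i).trans (tautProj_point e j).symm)))

theorem continuous_vec (i : Fin (k + 2)) : Continuous fun e : TautConf k => e.vec i :=
  continuous_fst.comp (continuous_subtype_val.comp (continuous_point i))

/-- The difference of the first two vectors; it spans the line. -/
def dir (e : TautConf k) : Punctured :=
  ⟨e.vec 1 - e.vec 0, sub_ne_zero.mpr fun h => by simpa using e.vec_injective h⟩

theorem continuous_dir : Continuous (dir (k := k)) :=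
  ((continuous_vec 1).sub (continuous_vec 0)).subtype_mk _

theorem exists_dir_eq (e : TautConf k) : ∃ a : ℂ, a ≠ 0 ∧ a • e.line.rep = e.dir.1 := by
  have h : e.dir.1 ∈ e.line.submodule := Submodule.sub_mem _ (e.vec_mem 1) (e.vec_mem 0)
  rw [Projectivization.submodule_eq, Submodule.mem_span_singleton] at h
  obtain ⟨a, ha⟩ := h
  refine ⟨a, ?_, ha⟩
  rintro rfl
  exact e.dir.2 (by rw [← ha, zero_smul])

theorem mk_dir (e : TautConf k) : Projectivization.mk ℂ e.dir.1 e.dir.2 = e.line := by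
  obtain ⟨a, -, ha⟩ := e.exists_dir_eq
  have h := (Projectivization.mk_eq_mk_iff' ℂ _ _ e.dir.2 e.line.rep_nonzero).mpr ⟨a, ha⟩
  rw [h, Projectivization.mk_rep]

theorem exists_coeff (e : TautConf k) (i : Fin (k + 2)) : ∃ c : ℂ, e.vec i = c • e.dir.1 := by
  obtain ⟨a, ha0, ha⟩ := e.exists_dir_eq
  have h := e.vec_mem i
  rw [Projectivization.submodule_eq, Submodule.mem_span_singleton] at h
  obtain ⟨b, hb⟩ := h
  refine ⟨b / a, ?_⟩
  rw [← ha, smul_smul, div_mul_cancel₀ _ ha0, hb]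

/-- The coordinate of a point with respect to `dir`. -/
def coeff (e : TautConf k) (i : Fin (k + 2)) : ℂ := (e.exists_coeff i).choose

theorem vec_eq (e : TautConf k) (i : Fin (k + 2)) : e.vec i = e.coeff i • e.dir.1 :=
  (e.exists_coeff i).choose_spec

theorem continuous_coeff (i : Fin (k + 2)) : Continuous fun e : TautConf k => e.coeff i :=
  continuous_ratio (continuous_vec i) (continuous_subtype_val.comp continuous_dir)
    (fun e => e.dir.2) fun e => e.vec_eq i

/-- The coordinates of a fiberwise configuration form a configuration in the plane. -/
def coeffs : C(TautConf k, Conf ℂ (k + 2)) :=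
  ⟨fun e => ofInjective e.coeff fun i j h => e.vec_injective (by rw [vec_eq, vec_eq, h]),
    FiberConf.continuous_iff.mpr continuous_coeff⟩

theorem coeff_sub (e : TautConf k) : e.coeff 1 - e.coeff 0 = 1 := by
  refine smul_left_injective ℂ e.dir.2 ?_
  change (e.coeff 1 - e.coeff 0) • e.dir.1 = (1 : ℂ) • e.dir.1
  rw [sub_smul, ← vec_eq, ← vec_eq, one_smul]
  rfl

theorem diff_coeffs (e : TautConf k) : diff (coeffs e) = ⟨1, one_ne_zero⟩ :=
  Subtype.ext e.coeff_sub

/-- Transport a configuration in the plane to the line spanned by a vector. -/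
def along (w : Punctured) (x : Conf ℂ (k + 2)) : TautConf k :=
  ⟨fun i => ⟨(x.point i • w.1, Projectivization.mk ℂ w.1 w.2), by
    change _ ∈ (Projectivization.mk ℂ w.1 w.2).submodule
    rw [Projectivization.submodule_mk]
    exact Submodule.smul_mem _ _ (Submodule.mem_span_singleton_self _)⟩, fun i j hij =>
    ⟨fun h => x.point_ne hij (smul_left_injective ℂ w.2
      (congrArg (fun b : TautBundle => b.1.1) h)), rfl⟩⟩

theorem vec_along (w : Punctured) (x : Conf ℂ (k + 2)) (i : Fin (k + 2)) :
    (along w x).vec i = x.point i • w.1 := rfl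

theorem dir_along (w : Punctured) (x : Conf ℂ (k + 2)) :
    (along w x).dir.1 = (diff x).1 • w.1 := (sub_smul _ _ _).symm

theorem continuous_along {T : Type} [TopologicalSpace T] {w : T → Punctured}
    {x : T → Conf ℂ (k + 2)} (hw : Continuous w) (hx : Continuous x) :
    Continuous fun t => along (w t) (x t) := by
  rw [FiberConf.continuous_iff]
  intro i
  refine Continuous.subtype_mk (Continuous.prodMk ?_ (continuous_mk.comp hw)) _
  exact ((continuous_point i).comp hx).smul (continuous_subtype_val.comp hw)

theorem along_dir_coeffs (e : TautConf k) : along e.dir (coeffs e) = e :=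
  ext_vec (fun i => (e.vec_eq i).symm) e.mk_dir

/-- The normalized configuration of a fiberwise configuration; it does not depend on a basis of
the line. -/
def norm : C(TautConf k, NormConf k) := normalize.comp coeffs

theorem norm_along (w : Punctured) (x : Conf ℂ (k + 2)) : norm (along w x) = normalize x := by
  have hc : ∀ i, (along w x).coeff i * (diff x).1 = x.point i := fun i => by
    refine smul_left_injective ℂ w.2 ?_
    change ((along w x).coeff i * (diff x).1) • w.1 = x.point i • w.1
    rw [mul_smul, ← dir_along, ← vec_eq, vec_along]
  refine Subtype.ext (funext fun i => ?_)
  change (normalize (coeffs (along w x))).1 i = _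
  rw [normalize_apply, normalize_apply, diff_coeffs, div_one, ← hc i, ← hc 0, ← sub_mul,
    mul_div_cancel_right₀ _ (diff x).2]
  rfl

theorem affine_norm (e : TautConf k) :
    affine ⟨1, one_ne_zero⟩ (e.coeff 0) (ofNorm (norm e)) = coeffs e := by
  have := affine_normalize (coeffs e)
  rwa [diff_coeffs] at this

/-- The space of fiberwise configurations as a retract of the space of configurations on marked
lines. -/
def alongMap : C(Punctured × Conf ℂ (k + 2), TautConf k) :=
  ⟨fun q => along q.1 q.2, continuous_along continuous_fst continuous_snd⟩

/-- The section of `alongMap` given by the difference of the first two points. -/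
def marking : C(TautConf k, Punctured × Conf ℂ (k + 2)) :=
  ⟨fun e => (e.dir, coeffs e), continuous_dir.prodMk coeffs.continuous⟩

theorem alongMap_marking (e : TautConf k) : alongMap (marking e) = e := along_dir_coeffs e

instance : T2Space (TautConf k) :=
  T2Space.of_injective_continuous (Function.LeftInverse.injective alongMap_marking)
    marking.continuous

instance : PathConnectedSpace (TautConf k) :=
  (Function.RightInverse.surjective alongMap_marking).pathConnectedSpace alongMap.continuous

instance : LocallyPathConnectedSpace (TautConf k) :=
  (IsQuotientMap.of_inverse marking.continuous alongMap.continuous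
    alongMap_marking).locallyPathConnectedSpace

theorem semilocallySimplyConnected : SemilocallySimplyConnected (TautConf k) :=
  .of_retract marking alongMap alongMap_marking
    (semilocallySimplyConnected_punctured.prod semilocallySimplyConnected_conf)

theorem isAspherical : IsAspherical (TautConf k) := by
  refine IsAspherical.of_retract (A := Punctured × ℂ × NormConf k)
    ⟨fun e => (e.dir, e.coeff 0, norm e),
      continuous_dir.prodMk ((continuous_coeff 0).prodMk norm.continuous)⟩
    ⟨fun q => along q.1 (affine ⟨1, one_ne_zero⟩ q.2.1 (ofNorm q.2.2)),
      continuous_along continuous_fst (continuous_affine continuous_const (by fun_prop)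
        (continuous_ofNorm.comp (by fun_prop)))⟩ (fun e => ?_) ?_
  · change along e.dir (affine ⟨1, one_ne_zero⟩ (e.coeff 0) (ofNorm (norm e))) = e
    rw [affine_norm, along_dir_coeffs]
  · exact (IsAspherical.of_contractible Punctured).prod
      ((IsAspherical.of_contractible ℂ).prod (NormConf.isAspherical k))

/-- A fiberwise configuration consists of a normalized configuration and of points of two
contractible spaces, so normalization is injective on fundamental groups. -/
theorem map_norm_injective {e₀ : TautConf k} {m : NormConf k} (he : norm e₀ = m) :
    Function.Injective (FundamentalGroup.mapOfEq norm he) := by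
  subst he
  rw [injective_iff_map_eq_one]
  intro c hc
  induction c using Path.Homotopic.Quotient.ind with
  | mk ω =>
    rw [FundamentalGroup.mapOfEq_mk, FundamentalGroup.mk_eq_one_iff] at hc
    obtain ⟨H⟩ := hc
    obtain ⟨K⟩ : (ω.map continuous_dir).Homotopic (Path.refl _) :=
      SimplyConnectedSpace.paths_homotopic _ _
    have hH0 : ∀ t, H (0, t) = norm (ω t) := H.apply_zero
    have hH1 : ∀ t, H (1, t) = norm e₀ := H.apply_one
    have hK0 : ∀ t, K (0, t) = (ω t).dir := K.apply_zero
    have hK1 : ∀ t, K (1, t) = e₀.dir := K.apply_one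
    let A (q : I × I) : TautConf k := along (K q) (affine ⟨1, one_ne_zero⟩
      ((1 - ((q.1 : ℝ) : ℂ)) * (ω q.2).coeff 0 + ((q.1 : ℝ) : ℂ) * e₀.coeff 0) (ofNorm (H q)))
    have hA : Continuous A := by
      refine continuous_along K.continuous (continuous_affine continuous_const ?_
        (continuous_ofNorm.comp H.continuous))
      have h1 : Continuous fun q : I × I => (ω q.2).coeff 0 :=
        (continuous_coeff 0).comp (ω.continuous.comp continuous_snd)
      fun_prop
    have hA0 : ∀ t, A (0, t) = ω t := fun t => by
      simp only [A]
      rw [hH0, hK0, Set.Icc.coe_zero, Complex.ofReal_zero, sub_zero, one_mul, zero_mul, add_zero,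
        affine_norm, along_dir_coeffs]
    have hend : ∀ s t, K (s, t) = e₀.dir → H (s, t) = norm e₀ →
        (1 - ((s : ℝ) : ℂ)) * (ω t).coeff 0 + ((s : ℝ) : ℂ) * e₀.coeff 0 = e₀.coeff 0 →
        A (s, t) = e₀ := fun s t h1 h2 h3 => by
      simp only [A]
      rw [h1, h2, h3, affine_norm, along_dir_coeffs]
    rw [FundamentalGroup.mk_eq_one_iff]
    refine ⟨⟨⟨⟨A, hA⟩, hA0, fun t => hend 1 t (hK1 t) (hH1 t) (by simp)⟩, ?_⟩⟩
    rintro s t (rfl | rfl)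
    · refine (hend s 0 (K.source s) (H.source s) ?_).trans ω.source.symm
      rw [ω.source]
      ring
    · refine (hend s 1 (K.target s) (H.target s) ?_).trans ω.target.symm
      rw [ω.target]
      ring

/-- The inclusion of the configurations on one fixed line. -/
def fiberInclusion : C(Conf ℂ (k + 2), TautConf k) :=
  ⟨fun x => along ⟨e₀, e₀_ne_zero⟩ x, continuous_along continuous_const continuous_id⟩

theorem norm_fiberInclusion (x : Conf ℂ (k + 2)) : norm (fiberInclusion x) = normalize x :=
  norm_along _ x

theorem smul_fiberInclusion (τ : Equiv.Perm (Fin (k + 2))) (x : Conf ℂ (k + 2)) :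
    fiberInclusion (τ • x) = τ • fiberInclusion x := rfl

/-- The inclusion of the unordered configurations on one fixed line. -/
def ufiberInclusion : C(UConf ℂ (k + 2), UFiberConf tautProj (k + 2)) :=
  ⟨Quotient.map' (s₁ := MulAction.orbitRel _ _) (s₂ := MulAction.orbitRel _ _) fiberInclusion (by
      rintro _ x ⟨τ, rfl⟩
      exact ⟨τ, rfl⟩),
    continuous_quot_lift _ ((unorder tautProj (k + 2)).continuous.comp fiberInclusion.continuous)⟩

theorem ufiberInclusion_unorder (x : Conf ℂ (k + 2)) :
    ufiberInclusion (unorder _ _ x) = unorder _ _ (fiberInclusion x) := rfl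

end TautConf

/-! ### Extensions and centers -/

theorem Equiv.Perm.center_eq_bot_of_three_le {n : ℕ} (hn : 3 ≤ n) :
    Subgroup.center (Equiv.Perm (Fin n)) = ⊥ := by
  rw [Subgroup.eq_bot_iff_forall]
  intro τ hτ
  refine Equiv.ext fun i => ?_
  by_contra hi
  have hi' : τ i ≠ i := hi
  obtain ⟨l, hl⟩ : ∃ l, l ∉ ({i, τ i} : Finset (Fin n)) := by
    by_contra! h
    have h1 : (Finset.univ : Finset (Fin n)).card ≤ ({i, τ i} : Finset (Fin n)).card :=
      Finset.card_le_card fun x _ => h x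
    have h2 := Finset.card_le_two (a := i) (b := τ i)
    rw [Finset.card_univ, Fintype.card_fin] at h1
    omega
  simp only [Finset.mem_insert, Finset.mem_singleton, not_or] at hl
  -- The transposition of `τ i` and `l` fixes `i` but moves `τ i`.
  have h := Equiv.congr_fun (Subgroup.mem_center_iff.mp hτ (Equiv.swap (τ i) l)) i
  rw [Equiv.Perm.mul_apply, Equiv.Perm.mul_apply, Equiv.swap_apply_left,
    Equiv.swap_apply_of_ne_of_ne hi'.symm (Ne.symm hl.1)] at h
  exact hl.2 h

/-- Let `φ` be an epimorphism onto a centerless group, and let `i` embed its source in a larger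
group. If `i` maps the kernel of `φ` to the center, then the kernel is the center of the source. -/
theorem MonoidHom.ker_eq_center_of_map_ker_le {P B S : Type*} [Group P] [Group B] [Group S]
    {i : P →* B} {φ : P →* S} (hi : Function.Injective i) (hφ : Function.Surjective φ)
    (hS : Subgroup.center S = ⊥) (hk : ∀ p, φ p = 1 → i p ∈ Subgroup.center B) :
    φ.ker = Subgroup.center P := by
  refine le_antisymm (fun p hp => Subgroup.mem_center_iff.mpr fun q => hi ?_) fun p hp => ?_
  · rw [map_mul, map_mul]
    exact Subgroup.mem_center_iff.mp (hk p hp) (i q)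
  · rw [MonoidHom.mem_ker, ← Subgroup.mem_bot, ← hS]
    refine Subgroup.mem_center_iff.mpr fun s => ?_
    obtain ⟨q, rfl⟩ := hφ s
    rw [← map_mul, ← map_mul, Subgroup.mem_center_iff.mp hp q]

section Extension

variable {P B S U G : Type*} [Group P] [Group B] [Group S] [Group U] [Group G] {i : P →* B}
  {j : S →* U} {φ : P →* S} {Φ : B →* U} {mon : B →* G} {mon' : U →* G}

/-- A morphism of extensions of the same group is surjective if it is so on the kernels. -/
theorem MonoidHom.surjective_of_extension (hmon : Function.Surjective mon)
    (hrange' : mon'.ker = j.range) (hΦ : ∀ p, Φ (i p) = j (φ p)) (hm : ∀ b, mon' (Φ b) = mon b)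
    (hφ : Function.Surjective φ) : Function.Surjective Φ := by
  intro u
  obtain ⟨b, hb⟩ := hmon (mon' u)
  have hu : u * (Φ b)⁻¹ ∈ mon'.ker := by
    rw [MonoidHom.mem_ker, map_mul, map_inv, hm, hb, mul_inv_cancel]
  rw [hrange'] at hu
  obtain ⟨s, hs⟩ := hu
  obtain ⟨p, rfl⟩ := hφ s
  exact ⟨i p * b, by rw [map_mul, hΦ, hs, inv_mul_cancel_right]⟩

/-- For a morphism of extensions of the same centerless group, the kernel is the center of the
source if this holds on the kernels of the extensions. -/
theorem MonoidHom.ker_eq_center_of_extension (hi : Function.Injective i)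
    (hj : Function.Injective j) (hmon : Function.Surjective mon) (hrange : mon.ker = i.range)
    (hΦ : ∀ p, Φ (i p) = j (φ p)) (hm : ∀ b, mon' (Φ b) = mon b)
    (hG : Subgroup.center G = ⊥) (hφ : φ.ker = Subgroup.center P)
    (hk : ∀ p, φ p = 1 → i p ∈ Subgroup.center B) : Φ.ker = Subgroup.center B := by
  refine le_antisymm (fun b hb => ?_) fun b hb => ?_
  · have hb' : b ∈ mon.ker := by
      rw [MonoidHom.mem_ker, ← hm, MonoidHom.mem_ker.mp hb, map_one]
    rw [hrange] at hb'
    obtain ⟨p, rfl⟩ := hb'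
    refine hk p (hj ?_)
    rw [← hΦ, MonoidHom.mem_ker.mp hb, map_one]
  · have hb' : b ∈ mon.ker := by
      rw [MonoidHom.mem_ker, ← Subgroup.mem_bot, ← hG]
      refine Subgroup.mem_center_iff.mpr fun g => ?_
      obtain ⟨c, rfl⟩ := hmon g
      rw [← map_mul, ← map_mul, Subgroup.mem_center_iff.mp hb c]
    rw [hrange] at hb'
    obtain ⟨p, rfl⟩ := hb'
    have hp : p ∈ φ.ker := by
      rw [hφ]
      refine Subgroup.mem_center_iff.mpr fun q => hi ?_
      rw [map_mul, map_mul, Subgroup.mem_center_iff.mp hb (i q)]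
    rw [MonoidHom.mem_ker, hΦ, MonoidHom.mem_ker.mp hp, map_one]

end Extension

/-- A group modulo its center is the image of any epimorphism whose kernel is the center. -/
def MonoidHom.quotientCenterEquiv {P S : Type*} [Group P] [Group S] (φ : P →* S)
    (hφ : Function.Surjective φ) (hk : φ.ker = Subgroup.center P) :
    P ⧸ Subgroup.center P ≃* S :=
  (QuotientGroup.quotientMulEquivOfEq hk.symm).trans
    (QuotientGroup.quotientKerEquivOfSurjective φ hφ)

/-! ### Naturality of monodromy -/

theorem FundamentalGroup.mapOfEq_comp {X Y Z : Type} [TopologicalSpace X] [TopologicalSpace Y]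
    [TopologicalSpace Z] {f : C(X, Y)} {g : C(Y, Z)} {f' : C(X, Z)} (hgf : ∀ x, g (f x) = f' x)
    {x : X} {y : Y} {z : Z} (hf : f x = y) (hg : g y = z) (hf' : f' x = z)
    (c : FundamentalGroup X x) :
    mapOfEq g hg (mapOfEq f hf c) = mapOfEq f' hf' c := by
  induction c using Path.Homotopic.Quotient.ind with
  | mk ω =>
    rw [mapOfEq_mk, mapOfEq_mk, mapOfEq_mk]
    congr 1
    exact Path.ext (funext fun t => hgf (ω t))

theorem IsCoveringMap.mapOfEq_injective {E X : Type} [TopologicalSpace E] [TopologicalSpace X]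
    {p : C(E, X)} (cov : IsCoveringMap p) {e : E} {x : X} (h : p e = x) :
    Function.Injective (FundamentalGroup.mapOfEq p h) := by
  subst h
  intro c d hcd
  rw [FundamentalGroup.mapOfEq_apply, FundamentalGroup.mapOfEq_apply] at hcd
  exact cov.injective_path_homotopic_map e e (by
    rw [Path.Homotopic.Quotient.cast_rfl_rfl, Path.Homotopic.Quotient.cast_rfl_rfl] at hcd
    exact hcd)

/-- Monodromy is natural in the covering. -/
theorem IsCoveringMap.monodromy_mk_map {E X E' X' : Type} [TopologicalSpace E]
    [TopologicalSpace X] [TopologicalSpace E'] [TopologicalSpace X'] {p : E → X} {p' : E' → X'}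
    (cov : IsCoveringMap p) (cov' : IsCoveringMap p') (f : C(E, E')) (F : C(X, X'))
    (h : ∀ e, p' (f e) = F (p e)) {x y : X} (γ : Path x y) (e : p ⁻¹' {x}) :
    (cov'.monodromy (.mk (γ.map F.continuous))
      ⟨f e, (h e).trans (congrArg F e.2)⟩).1 = f (cov.monodromy (.mk γ) e) := by
  have h0 := γ.source.trans e.2.symm
  have hl : f.comp (cov.liftPath γ e h0) = cov'.liftPath (γ.map F.continuous) (f e)
      ((γ.map F.continuous).source.trans ((h e).trans (congrArg F e.2)).symm) :=
    (cov'.eq_liftPath_iff' _).mpr ⟨funext fun t =>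
      (h _).trans (congrArg F (congrFun (cov.liftPath_lifts γ e h0) t)),
      congrArg f (cov.liftPath_zero γ e h0)⟩
  exact (congrArg (fun g : C(I, E') => g 1) hl).symm

/-- Homomorphisms from fundamental groups to deck groups are natural for equivariant maps of
quotient coverings. -/
theorem IsQuotientCoveringMap.fundamentalGroupToMulOpposite_mapOfEq {E X E' X' G : Type}
    [TopologicalSpace E] [TopologicalSpace X] [TopologicalSpace E'] [TopologicalSpace X']
    [Group G] [MulAction G E] [MulAction G E'] {p : E → X} {p' : E' → X'}
    (hp : IsQuotientCoveringMap p G) (hp' : IsQuotientCoveringMap p' G) (f : C(E, E'))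
    (F : C(X, X')) (h : ∀ e, p' (f e) = F (p e)) (hf : ∀ (g : G) (e : E), f (g • e) = g • f e)
    (e : E) (c : FundamentalGroup X (p e)) :
    hp'.fundamentalGroupToMulOpposite ⟨f e, rfl⟩ (FundamentalGroup.mapOfEq F (h e).symm c) =
      hp.fundamentalGroupToMulOpposite ⟨e, rfl⟩ c := by
  rw [IsQuotientCoveringMap.fundamentalGroupToMulOpposite_apply_eq_Iff]
  induction c using Path.Homotopic.Quotient.ind with
  | mk γ =>
    rw [FundamentalGroup.mapOfEq_mk, ← hf]
    have h1 := hp.unop_fundamentalGroupToMulOpposite_smul (e := ⟨e, rfl⟩)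
      (γ := Path.Homotopic.Quotient.mk γ)
    have h2 := hp.isCoveringMap.monodromy_mk_map hp'.isCoveringMap f F h γ ⟨e, rfl⟩
    refine (congrArg f h1).trans (h2.symm.trans ?_)
    have key : ∀ (x' : X') (hx : x' = F (p e)) (he : p' (f e) = x') (δ : Path (F (p e)) (F (p e))),
        (hp'.isCoveringMap.monodromy (.mk δ) ⟨f e, h e⟩).1 =
          (hp'.isCoveringMap.monodromy (.mk (δ.cast hx hx)) ⟨f e, he⟩).1 := by
      rintro _ rfl he δ
      rfl
    exact key _ (h e) rfl _

/-! ### Braid groups and fiberwise braid groups -/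

namespace FiberConf

variable {E B : Type} [TopologicalSpace E] (p : E → B) (n : ℕ) [T2Space (FiberConf p n)]

theorem map_unorder_injective (x : FiberConf p n) :
    Function.Injective (FundamentalGroup.mapOfEq (unorder p n) (x := x) rfl) :=
  IsCoveringMap.mapOfEq_injective (p := unorder p n) isQuotientCoveringMap_mk.isCoveringMap rfl

/-- The permutation of the strands of a braid. It takes values in the opposite group because
monodromy commutes with the action of the symmetric group, so permutations compose in the reverse
order. -/
abbrev strandPerm (x : FiberConf p n) :
    FundamentalGroup (UFiberConf p n) (unorder p n x) →* (Equiv.Perm (Fin n))ᵐᵒᵖ :=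
  isQuotientCoveringMap_mk.fundamentalGroupToMulOpposite ⟨x, rfl⟩

theorem ker_strandPerm (x : FiberConf p n) :
    (strandPerm p n x).ker = (FundamentalGroup.mapOfEq (unorder p n) (x := x) rfl).range :=
  (isQuotientCoveringMap_mk.ker_fundamentalGroupToMulOpposite ⟨x, rfl⟩).trans
    (isQuotientCoveringMap_mk.ker_monodromyPerm ⟨x, rfl⟩)

theorem strandPerm_surjective [PathConnectedSpace (FiberConf p n)] (x : FiberConf p n) :
    Function.Surjective (strandPerm p n x) :=
  IsQuotientCoveringMap.fundamentalGroupToMulOpposite_surjective _ _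

end FiberConf

namespace TautConf

open FiberConf

variable {k : ℕ}

/-- The effect of the inclusion of a fiber on pure braid groups. -/
abbrev pureMap (k : ℕ) : FundamentalGroup (Conf ℂ (k + 2)) (ofNorm (NormConf.std k)) →*
    FundamentalGroup (TautConf k) (fiberInclusion (ofNorm (NormConf.std k))) :=
  FundamentalGroup.mapOfEq fiberInclusion rfl

/-- The effect of the inclusion of a fiber on braid groups. -/
abbrev braidMap (k : ℕ) :
    FundamentalGroup (UConf ℂ (k + 2)) (unorder _ _ (ofNorm (NormConf.std k))) →*
      FundamentalGroup (UFiberConf tautProj (k + 2))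
        (unorder _ _ (fiberInclusion (ofNorm (NormConf.std k)))) :=
  FundamentalGroup.mapOfEq ufiberInclusion (ufiberInclusion_unorder _)

theorem map_norm_pureMap (c : FundamentalGroup (Conf ℂ (k + 2)) (ofNorm (NormConf.std k))) :
    FundamentalGroup.mapOfEq norm ((norm_fiberInclusion _).trans (normalize_ofNorm _))
      (pureMap k c) = FundamentalGroup.mapOfEq normalize (normalize_ofNorm _) c :=
  FundamentalGroup.mapOfEq_comp norm_fiberInclusion _ _ _ c

/-- Normalization is onto on fundamental groups, and it factors through `pureMap` and an injective
map. -/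
theorem pureMap_surjective : Function.Surjective (pureMap k) := fun s => by
  obtain ⟨c, hc⟩ := map_normalize_surjective (NormConf.std k) (FundamentalGroup.mapOfEq norm
    ((norm_fiberInclusion _).trans (normalize_ofNorm _)) s)
  exact ⟨c, map_norm_injective _ ((map_norm_pureMap c).trans hc)⟩

theorem map_unorder_mem_center_of_pureMap
    {c : FundamentalGroup (Conf ℂ (k + 2)) (ofNorm (NormConf.std k))} (hc : pureMap k c = 1) :
    FundamentalGroup.mapOfEq (unorder (fun _ : ℂ => ()) (k + 2)) rfl c ∈
      Subgroup.center (FundamentalGroup (UConf ℂ (k + 2)) (unorder _ _ _)) :=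
  map_unorder_mem_center (by rw [← map_norm_pureMap, hc, map_one])

theorem center_fundamentalGroup :
    Subgroup.center (FundamentalGroup (TautConf k)
      (fiberInclusion (ofNorm (NormConf.std k)))) = ⊥ := by
  refine Subgroup.center_eq_bot_of_mulEquiv (MulEquiv.ofBijective (FundamentalGroup.mapOfEq norm
    ((norm_fiberInclusion _).trans (normalize_ofNorm _))) ⟨map_norm_injective _, fun m => ?_⟩)
    (NormConf.center_fundamentalGroup k _)
  obtain ⟨c, hc⟩ := map_normalize_surjective (NormConf.std k) m
  exact ⟨pureMap k c, (map_norm_pureMap c).trans hc⟩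

theorem ker_pureMap : (pureMap k).ker =
    Subgroup.center (FundamentalGroup (Conf ℂ (k + 2)) (ofNorm (NormConf.std k))) :=
  MonoidHom.ker_eq_center_of_map_ker_le (map_unorder_injective _ _ _) pureMap_surjective
    center_fundamentalGroup fun _ => map_unorder_mem_center_of_pureMap

theorem braidMap_mapOfEq_unorder
    (c : FundamentalGroup (Conf ℂ (k + 2)) (ofNorm (NormConf.std k))) :
    braidMap k (FundamentalGroup.mapOfEq (unorder _ _) rfl c) =
      FundamentalGroup.mapOfEq (unorder _ _) rfl (pureMap k c) := by
  let f : C(Conf ℂ (k + 2), UFiberConf tautProj (k + 2)) := (unorder _ _).comp fiberInclusion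
  refine (FundamentalGroup.mapOfEq_comp (f' := f) (fun _ => rfl) _ _ rfl c).trans ?_
  exact (FundamentalGroup.mapOfEq_comp (f' := f) (fun _ => rfl) _ _ rfl c).symm

theorem strandPerm_braidMap
    (c : FundamentalGroup (UConf ℂ (k + 2)) (unorder _ _ (ofNorm (NormConf.std k)))) :
    strandPerm _ _ _ (braidMap k c) = strandPerm _ _ _ c :=
  IsQuotientCoveringMap.fundamentalGroupToMulOpposite_mapOfEq isQuotientCoveringMap_mk
    isQuotientCoveringMap_mk fiberInclusion ufiberInclusion ufiberInclusion_unorder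
    smul_fiberInclusion (ofNorm (NormConf.std k)) c

theorem braidMap_surjective : Function.Surjective (braidMap k) :=
  MonoidHom.surjective_of_extension (strandPerm_surjective _ _ _) (ker_strandPerm _ _ _)
    braidMap_mapOfEq_unorder strandPerm_braidMap pureMap_surjective

theorem ker_braidMap (hk : 3 ≤ k + 2) : (braidMap k).ker =
    Subgroup.center (FundamentalGroup (UConf ℂ (k + 2)) (unorder _ _ (ofNorm (NormConf.std k)))) :=
  MonoidHom.ker_eq_center_of_extension (map_unorder_injective _ _ _) (map_unorder_injective _ _ _)
    (strandPerm_surjective _ _ _) (ker_strandPerm _ _ _) braidMap_mapOfEq_unorder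
    strandPerm_braidMap
    (Subgroup.center_mulOpposite_eq_bot (Equiv.Perm.center_eq_bot_of_three_le hk)) ker_pureMap
    fun _ => map_unorder_mem_center_of_pureMap

end TautConf

end

theorem mainTheorem7 :
    (∀ n : ℕ, 3 ≤ n →
      IsClassifyingSpace (BraidGroup n ⧸ Subgroup.center (BraidGroup n))
        (UFiberConf tautProj n)) ∧
    (∀ n : ℕ, 2 ≤ n →
      IsClassifyingSpace (PureBraidGroup n ⧸ Subgroup.center (PureBraidGroup n))
        (FiberConf tautProj n)) := by
  refine ⟨fun n hn => ?_, fun n hn => ?_⟩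
  · obtain ⟨k, rfl⟩ : ∃ k, n = k + 2 := ⟨n - 2, by omega⟩
    have hcov := FiberConf.isQuotientCoveringMap_mk (p := tautProj) (n := k + 2)
    have : PathConnectedSpace (UFiberConf tautProj (k + 2)) :=
      hcov.surjective.pathConnectedSpace hcov.continuous
    have : LocallyPathConnectedSpace (UFiberConf tautProj (k + 2)) :=
      hcov.toIsQuotientMap.locallyPathConnectedSpace
    exact UnivCover.isClassifyingSpace
      (.of_isLocalHomeomorph hcov.isCoveringMap.isLocalHomeomorph hcov.surjective
        TautConf.semilocallySimplyConnected)
      (.of_covering hcov.isCoveringMap hcov.surjective TautConf.isAspherical) _ _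
      ((TautConf.braidMap k).quotientCenterEquiv TautConf.braidMap_surjective
        (TautConf.ker_braidMap hn))
  · obtain ⟨k, rfl⟩ : ∃ k, n = k + 2 := ⟨n - 2, by omega⟩
    exact UnivCover.isClassifyingSpace TautConf.semilocallySimplyConnected TautConf.isAspherical
      _ _ ((TautConf.pureMap k).quotientCenterEquiv TautConf.pureMap_surjective
        TautConf.ker_pureMap)
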